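/- A \emph{Banach Lie algebra} is a real Banach space $\mathbb M$ (norm $|\cdot|$) with a continuous Lie bracket. A \emph{stratification} of $\mathbb M$ consists of closed subspaces $H_1,\dots,H_\nu$ such that $H_1\times\cdots\times H_\nu\to\mathbb M$, $(s_1,\dots,s_\nu)\mapsto\sum_i s_i$, is bijective (with associated projections $\pi_i:\mathbb M\to H_i$), $[H_i,H_j]\subset H_{i+j}$ if $i+j\le\nu$, and $[H_i,H_j]=\{0\}$ otherwise. With the group operation given by the Baker--Campbell--Hausdorff formula $xy=x+y+\sum_{m=2}^{\nu}P_m(x,y)$, where $P_m$ is the degree $m$ term given by Dynkin's formula (so that $x^{-1}=-x$ and the identity is $0$), $\mathbb M$ is called a \emph{Banach homogeneous group}. It carries the dilations $\delta_r x=\sum_{i=1}^{\nu} r^i\pi_i(x)$, $r>0$. A \emph{Banach homogeneous norm} is a function $\|x\|=\max_{1\le i\le \nu}\sigma_i|\pi_i(x)|^{1/i}$ with constants $\sigma_1=1$, $\sigma_i>0$, such that $\|xy\|\le\|x\|+\|y\|$ for all $x,y$; the corresponding distance is $\rho(x,y)=\|x^{-1}y\|$. A \emph{stratified group} $\mathbb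 G=V_1\oplus\cdots\oplus V_s$ is a finite-dimensional Banach homogeneous group with $[V_1,V_j]=V_{j+1}$ for all $j\ge1$, where $V_j=\{0\}$ for $j>s$. A \emph{homogeneous distance} on $\mathbb G$ is a distance $d$ with $d(zx,zy)=d(x,y)$ and $d(\delta_rx,\delta_ry)=r\,d(x,y)$ for all $x,y,z\in\mathbb G$, $r>0$. A Banach space $X$ has the \emph{Radon--Nikodym property} (RNP) if every Lipschitz map $[0,1]\to X$ is differentiable almost everywhere. Let $A\subset\mathbb G$, $x\in\mathbb G$ and $\zeta\in\mathbb G$. The set $A$ is \emph{dense at $x$ in direction $\zeta$} if \[\frac{\mathcal L^1(\{0<\theta<t:\ x\,\delta_\theta\zeta\notin A\})}{t}\to0\quad\text{as }t\downarrow0.\] Points $\zeta_x^t\in\mathbb G$, $t>0$, \emph{approximate in $A$ the direction $\zeta$ at $x$} if $x\zeta_x^t\in A$ for every $t>0$ and $d(\zeta_x^t,\delta_t\zeta)/t\to0$ as $t\downarrow0$. If $x\in A$ and $\zeta\ne0$, a map $f:A\to\mathbb M$ is \emph{differentiable at $x$ in direction $\zeta$} if points approximating in $A$ the direction $\zeta$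 at $x$ exist and there is $w\in\mathbb M$ such that, for every choice $t\mapsto\zeta_x^t$ of such points, \[\lim_{t\downarrow0}\delta_{1/t}\big(f(x)^{-1}f(x\zeta_x^t)\big)=w .\] \textbf{Theorem.} Let $\mathbb G=V_1\oplus\cdots\oplus V_s$ be a stratified group with a homogeneous distance $d$ and a Haar measure $\mu$, and let $\mathbb M=H_1\oplus\cdots\oplus H_\nu$ be a Banach homogeneous group with a Banach homogeneous norm and the corresponding distance $\rho$. Suppose that $H_1$, as a Banach space, has the RNP. Let $A\subset\mathbb G$ be $\mu$-measurable, let $\zeta\in V_1\setminus\{0\}$, and let $f:A\to\mathbb M$ be Lipschitz with respect to $d$ and $\rho$. Then for $\mu$-almost every $x\in A$: \begin{enumerate} \item $A$ is dense at $x$ in direction $\zeta$; \item $f$ is differentiable at $x$ in direction $\zeta$. \end{enumerate} -/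

import Mathlib

open MeasureTheory Filter Topology Set
open scoped NNReal ENNReal

/-- A (real) Banach Lie algebra: a Banach space with a continuous Lie bracket. -/
class BanachLieAlgebra (M : Type*) extends NormedAddCommGroup M, LieRing M, NormedSpace ℝ M,
    LieAlgebra ℝ M, CompleteSpace M where
  continuous_lie : Continuous fun p : M × M => ⁅p.1, p.2⁆

/-- A Banach space `X` has the Radon–Nikodym property if every Lipschitz map `[0,1] → X` is
differentiable almost everywhere. -/
def HasRNP (X : Type*) [NormedAddCommGroup X] [NormedSpace ℝ X] : Prop :=
  ∀ (f : ℝ → X) (K : ℝ≥0), LipschitzOnWith K f (Icc (0 : ℝ) 1) →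
    ∀ᵐ t ∂(volume.restrict (Icc (0 : ℝ) 1)), DifferentiableWithinAt ℝ f (Icc (0 : ℝ) 1) t

namespace BanachLieAlgebra

section BCH

variable {M : Type*} [BanachLieAlgebra M]

/-- The left-normed product `[[⋯[[x₁,x₂],x₃]⋯],xₖ]` of a list `x₁, …, xₖ`. -/
def leftNormed : List M → M
  | [] => 0
  | a :: l => l.foldl (fun u v => ⁅u, v⁆) a

/-- The word `x ⋯ x y ⋯ y ⋯ x ⋯ x y ⋯ y` with exponents `p₁, q₁, …, pₖ, qₖ`, where
`e i = (p_i, q_i)`. -/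
def dynkinWord {k : ℕ} (e : Fin k → ℕ × ℕ) (x y : M) : List M :=
  (List.ofFn fun i => List.replicate (e i).1 x ++ List.replicate (e i).2 y).flatten

/-- The `2k`-tuples `(p₁, q₁, …, pₖ, qₖ)` with `p_i + q_i ≥ 1` for all `i` and
`∑ (p_i + q_i) = m` (so that all entries are at most `m`). -/
def dynkinIndex (m k : ℕ) : Finset (Fin k → ℕ × ℕ) :=
  (Fintype.piFinset fun _ : Fin k => Finset.range (m + 1) ×ˢ Finset.range (m + 1)).filter
    fun e => (∀ i, 1 ≤ (e i).1 + (e i).2) ∧ ∑ i, ((e i).1 + (e i).2) = m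

/-- The homogeneous term `P_m(x, y)` of the Baker–Campbell–Hausdorff series, by Dynkin's
formula. (Only `1 ≤ k ≤ m` contribute.) -/
noncomputable def dynkin (m : ℕ) (x y : M) : M :=
  ∑ k ∈ Finset.Icc 1 m, ∑ e ∈ dynkinIndex m k,
    ((-1 : ℝ) ^ (k - 1) / (k : ℝ) *
      ((m : ℝ)⁻¹ / ((∏ i, ((e i).1.factorial * (e i).2.factorial) : ℕ) : ℝ))) •
      leftNormed (dynkinWord e x y)

end BCH

/-- A stratification `M = H₁ ⊕ ⋯ ⊕ H_ν` of a Banach Lie algebra `M` (with `H_i = layer i`,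
`ν = step`): closed subspaces such that addition `H₁ × ⋯ × H_ν → M` is bijective (hence a Banach
isomorphism), with `[H_i, H_j] ⊆ H_{i+j}` if `i + j ≤ ν` and `[H_i, H_j] = 0` otherwise. The
family is extended by `0` to the indices `0` and `i > ν`. In particular `M` is nilpotent, and with
the product `Stratification.mul` below it is a Banach homogeneous group. -/
structure Stratification (M : Type*) [BanachLieAlgebra M] where
  step : ℕ
  layer : ℕ → Submodule ℝ M
  layer_zero : layer 0 = ⊥
  layer_of_step_lt : ∀ i, step < i → layer i = ⊥
  isClosed_layer : ∀ i, IsClosed (layer i : Set M)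
  bijective_sum : Function.Bijective (DirectSum.coeLinearMap layer)
  lie_mem : ∀ i j, ∀ x ∈ layer i, ∀ y ∈ layer j, ⁅x, y⁆ ∈ layer (i + j)

namespace Stratification

section Basic

variable {M : Type*} [BanachLieAlgebra M] (H : Stratification M)

/-- The group operation `x y = x + y + ∑_{m=2}^ν P_m(x, y)`. Its neutral element is `0` and the
inverse of `x` is `-x`. -/
noncomputable def mul (x y : M) : M :=
  x + y + ∑ m ∈ Finset.Icc 2 H.step, dynkin m x y

/-- The canonical projection `π_i : M → H_i`, as an endomorphism of `M`. -/
noncomputable def proj (i : ℕ) : M →ₗ[ℝ] M :=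
  (H.layer i).subtype ∘ₗ DirectSum.component ℝ ℕ (fun j => H.layer j) i ∘ₗ
    (LinearEquiv.ofBijective (DirectSum.coeLinearMap H.layer) H.bijective_sum).symm.toLinearMap

/-- The dilation `δ_r`, acting on `H_i` as multiplication by `r ^ i`. -/
noncomputable def dil (r : ℝ) (x : M) : M :=
  ∑ i ∈ Finset.Icc 1 H.step, r ^ i • H.proj i x

/-- `‖x‖ = max_{1 ≤ i ≤ ν} σ_i |π_i(x)|^{1/i}`. -/
noncomputable def hnorm (σ : ℕ → ℝ≥0) (x : M) : ℝ :=
  ((Finset.Icc 1 H.step).sup fun i => σ i * ‖H.proj i x‖₊ ^ (1 / (i : ℝ)) : ℝ≥0)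

/-- The positive constants `σ_1 = 1, σ_2, …, σ_ν` define a Banach homogeneous norm, i.e.
`hnorm σ` is subadditive for the group operation (its homogeneity `‖δ_r x‖ = r ‖x‖` is
automatic). -/
structure IsHomogeneousNorm (σ : ℕ → ℝ≥0) : Prop where
  pos : ∀ i, 1 ≤ i → i ≤ H.step → 0 < σ i
  one : σ 1 = 1
  hnorm_mul_le : ∀ x y, H.hnorm σ (H.mul x y) ≤ H.hnorm σ x + H.hnorm σ y

/-- The Banach homogeneous distance `ρ(x, y) = ‖x⁻¹ y‖`. -/
noncomputable def hdist (σ : ℕ → ℝ≥0) (x y : M) : ℝ :=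
  H.hnorm σ (H.mul (-x) y)

/-- The stratification makes `M` a stratified group: `M` is finite dimensional and
`[H_1, H_j] = H_{j+1}` for all `j ≥ 1` (where `H_j = 0` for `j > ν`). -/
structure IsStratifiedGroup : Prop where
  finiteDimensional : FiniteDimensional ℝ M
  span_lie : ∀ j, 1 ≤ j →
    Submodule.span ℝ {z | ∃ x ∈ H.layer 1, ∃ y ∈ H.layer j, ⁅x, y⁆ = z} = H.layer (j + 1)

/-- `d` is a homogeneous distance: a distance that is invariant under left translations and
one-homogeneous under dilations. -/
structure IsHomogeneousDist (d : M → M → ℝ) : Prop where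
  eq_zero_iff : ∀ x y, d x y = 0 ↔ x = y
  symm : ∀ x y, d x y = d y x
  triangle : ∀ x y z, d x z ≤ d x y + d y z
  mul_left : ∀ x y z, d (H.mul z x) (H.mul z y) = d x y
  dil : ∀ r, 0 < r → ∀ x y, d (H.dil r x) (H.dil r y) = r * d x y

/-- `μ` is a (left) Haar measure for the group operation `H.mul`: a Borel measure that is finite on
compact sets, positive on nonempty open sets and invariant under left translations. -/
structure IsHaar [MeasurableSpace M] [BorelSpace M] (μ : Measure M) : Prop where
  lt_top_of_isCompact : ∀ K : Set M, IsCompact K → μ K < ∞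
  pos_of_isOpen : ∀ U : Set M, IsOpen U → U.Nonempty → 0 < μ U
  map_mul_left : ∀ g : M, μ.map (fun x => H.mul g x) = μ

/-- `A` is dense at `x` in direction `ζ`. -/
def DenseInDirection (A : Set M) (x ζ : M) : Prop :=
  Tendsto (fun t : ℝ =>
      volume {θ : ℝ | 0 < θ ∧ θ < t ∧ H.mul x (H.dil θ ζ) ∉ A} / ENNReal.ofReal t)
    (𝓝[>] 0) (𝓝 0)

/-- The points `c t`, `t > 0`, approximate in `A` the direction `ζ` at the point `x`. -/
def Approximates (d : M → M → ℝ) (A : Set M) (x ζ : M) (c : ℝ → M) : Prop :=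
  (∀ t, 0 < t → H.mul x (c t) ∈ A) ∧
    Tendsto (fun t => d (c t) (H.dil t ζ) / t) (𝓝[>] 0) (𝓝 0)

end Basic

section Maps

variable {G M : Type*} [BanachLieAlgebra G] [BanachLieAlgebra M]

/-- `f : A → M` (only the values of `f` on `A` matter) is differentiable at `x` in direction `ζ`
with directional derivative `w`: here `x ∈ A`, `ζ ≠ 0`, the direction `ζ` can be approximated in
`A` at `x`, and `δ_{1/t}(f(x)⁻¹ f(x c(t))) → w` as `t ↓ 0` for every choice `c` of approximating
points. -/
def HasDirDeriv (V : Stratification G) (H : Stratification M) (d : G → G → ℝ) (A : Set G)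
    (f : G → M) (x ζ : G) (w : M) : Prop :=
  x ∈ A ∧ ζ ≠ 0 ∧ (∃ c, V.Approximates d A x ζ c) ∧
    ∀ c, V.Approximates d A x ζ c →
      Tendsto (fun t : ℝ => H.dil (1 / t) (H.mul (-f x) (f (V.mul x (c t))))) (𝓝[>] 0) (𝓝 w)

/-- `f : A → M` is differentiable at `x` in direction `ζ`. -/
def DirDifferentiableAt (V : Stratification G) (H : Stratification M) (d : G → G → ℝ) (A : Set G)
    (f : G → M) (x ζ : G) : Prop :=
  ∃ w, HasDirDeriv V H d A f x ζ w

end Maps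

end Stratification

end BanachLieAlgebra

/-!
### Truncated exponential and logarithm of nilpotent elements
-/

/-! The proof reduces differentiability of `f` to that of its first layer. The projection `π₁` is a
homomorphism onto the additive group of `H₁`, and it is 1-Lipschitz because `σ₁ = 1`. Along a line
`θ ↦ x (θ ζ)` the map `π₁ ∘ f` is therefore Lipschitz into a space with the RNP. After affine
extension across the gaps of its domain it is differentiable at almost every parameter. Lebesgue's
density theorem on the same lines gives density in direction `ζ`. Tonelli's theorem turns "almost
everywhere on every line" into "`μ`-almost everywhere" (`IsHaar.measure_eq_zero_of_line`). This
needs Borel exceptional sets, so the argument runs on compact `K ⊆ A`, which exhaust `A` up to a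
null set. On `K` the map `π₁ ∘ f` is continuous, and the set where the difference quotients fail to
converge is a countable combination of projections of compact sets.

The step from `π₁ ∘ f` to `f` is `tendsto_dil_of_tendsto_proj_one`. Cut `[0, t]` into `n` pieces and
rescale the increments of the curve by `1 / t`. Each increment has homogeneous norm `O(1/n)`, so its
components in the layers `i ≥ 2` have size `O(1/n²)`. For small `t` its first component is `w / n`
up to `O(1/n²)`. The group product of `n` such factors lies within `O(1/n)` of `w`, by a discrete
Gronwall argument (`exists_norm_prod_sub_le`). Arbitrary approximating points in `A` differ from
points of `K` on the line by `o(t)`, which the Lipschitz condition absorbs.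

Two facts have to be established first. The product is given only by Dynkin's formula, so its
associativity must be proved: `truncExp_mul_truncExp` identifies it with multiplication of
exponentials in a faithful nilpotent representation (`mul_assoc'`). The distance `d` is given only
by its axioms, so its continuity for the Banach topology must be proved: products of segments in
`V₁` fill the group, and Baire's theorem bounds `d` near the identity
(`IsHomogeneousDist.tendsto_norm`). -/

section TruncatedExpLog

open Polynomial

/-- The exponential series truncated after the term of degree `K`. -/
noncomputable def truncExp {A : Type*} [Ring A] [Algebra ℝ A] (K : ℕ) (a : A) : A :=
  ∑ i ∈ Finset.range (K + 1), ((i.factorial : ℝ)⁻¹) • a ^ i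

/-- The series of `log (1 + u)` truncated after the term of degree `K`. -/
noncomputable def truncLog {A : Type*} [Ring A] [Algebra ℝ A] (K : ℕ) (u : A) : A :=
  ∑ k ∈ Finset.Icc 1 K, ((-1 : ℝ) ^ (k - 1) / (k : ℝ)) • u ^ k

theorem aeval_truncExp {A B : Type*} [Ring A] [Algebra ℝ A] [Ring B] [Algebra ℝ B]
    (φ : A →ₐ[ℝ] B) (K : ℕ) (a : A) : φ (truncExp K a) = truncExp K (φ a) := by
  simp [truncExp]

theorem aeval_truncLog {A B : Type*} [Ring A] [Algebra ℝ A] [Ring B] [Algebra ℝ B]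
    (φ : A →ₐ[ℝ] B) (K : ℕ) (a : A) : φ (truncLog K a) = truncLog K (φ a) := by
  simp [truncLog]

theorem X_pow_succ_dvd_of_derivative {p : ℝ[X]} {n : ℕ} (h0 : p.coeff 0 = 0)
    (h : X ^ n ∣ derivative p) : X ^ (n + 1) ∣ p := by
  rw [X_pow_dvd_iff] at h ⊢
  intro d hd
  rcases d with _ | d
  · exact h0
  · have := h d (by omega)
    rw [coeff_derivative] at this
    have h2 : (d : ℝ) + 1 ≠ 0 := by positivity
    exact (mul_eq_zero.mp this).resolve_right h2

theorem derivative_truncExp_X (K : ℕ) :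
    derivative (truncExp K (X : ℝ[X])) =
      truncExp K X - ((K.factorial : ℝ)⁻¹) • X ^ K := by
  have : derivative (truncExp K (X : ℝ[X])) =
      ∑ i ∈ Finset.range K, ((i.factorial : ℝ)⁻¹) • (X : ℝ[X]) ^ i := by
    rw [truncExp, derivative_sum, Finset.sum_range_succ']
    simp only [derivative_smul, derivative_X_pow, pow_zero, derivative_one, smul_zero, add_zero]
    refine Finset.sum_congr rfl fun i _ => ?_
    rw [Nat.factorial_succ, Nat.add_sub_cancel, ← C_mul', ← C_mul', ← mul_assoc, ← C_mul]
    congr 2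
    push_cast
    field_simp
  rw [this, truncExp, Finset.sum_range_succ]
  ring

theorem one_add_X_mul_derivative_truncLog_X (K : ℕ) :
    (1 + X) * derivative (truncLog K (X : ℝ[X])) = 1 - (-X) ^ K := by
  induction K with
  | zero => simp [truncLog]
  | succ K ih =>
    have h : truncLog (K + 1) (X : ℝ[X]) =
        truncLog K X + ((-1 : ℝ) ^ K / ((K + 1 : ℕ) : ℝ)) • X ^ (K + 1) := by
      rw [truncLog, Finset.sum_Icc_succ_top (by omega)]
      rfl
    have h2 : derivative (((-1 : ℝ) ^ K / ((K + 1 : ℕ) : ℝ)) • (X : ℝ[X]) ^ (K + 1)) =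
        (-X) ^ K := by
      rw [derivative_smul, derivative_X_pow, Nat.add_sub_cancel, ← C_mul', ← mul_assoc, ← C_mul,
        div_mul_cancel₀ _ (by positivity), neg_pow (X : ℝ[X])]
      simp
    rw [h, derivative_add, mul_add, ih, h2]
    ring

theorem X_dvd_truncExp_sub_one (K : ℕ) : (X : ℝ[X]) ∣ truncExp K X - 1 := by
  rw [truncExp, Finset.sum_range_succ']
  simp only [pow_zero, Nat.factorial_zero, Nat.cast_one, inv_one, one_smul, add_sub_cancel_right]
  refine Finset.dvd_sum fun i _ => dvd_smul_of_dvd _ ?_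
  exact dvd_pow_self _ (by omega)

theorem X_dvd_truncLog (K : ℕ) : (X : ℝ[X]) ∣ truncLog K X := by
  refine Finset.dvd_sum fun i hi => dvd_smul_of_dvd _ ?_
  exact dvd_pow_self _ (by have := (Finset.mem_Icc.mp hi).1; omega)

theorem truncLog_X_comp (K : ℕ) (q : ℝ[X]) :
    (truncLog K (X : ℝ[X])).comp q = truncLog K q := by
  simp [truncLog, smul_eq_C_mul]

theorem truncExp_X_comp (K : ℕ) (q : ℝ[X]) :
    (truncExp K (X : ℝ[X])).comp q = truncExp K q := by
  simp [truncExp, smul_eq_C_mul]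

/-- The logarithmic derivative is exact up to order `K`: with `e` the truncated exponential, `e`
times the derivative of the difference is divisible by `X ^ K`. As `e` has constant term 1 it is
coprime to `X`, and integration gains one more power. -/
theorem X_pow_succ_dvd_truncLog_truncExp (K : ℕ) :
    (X : ℝ[X]) ^ (K + 1) ∣ truncLog K (truncExp K X - 1) - X := by
  set e : ℝ[X] := truncExp K X with he
  obtain ⟨q, hq⟩ := X_dvd_truncExp_sub_one K
  rw [← he] at hq
  refine X_pow_succ_dvd_of_derivative ?_ ?_
  · have : (X : ℝ[X]) ∣ truncLog K (e - 1) - X :=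
      dvd_sub ((Dvd.intro q hq.symm).trans
        (by simpa [truncLog_X_comp] using
          (map_dvd (compRingHom (e - 1)) (X_dvd_truncLog K)))) dvd_rfl
    exact X_dvd_iff.mp this
  · have h1 : e * (derivative (truncLog K (e - 1) - X) - 0) =
        -(((K.factorial : ℝ)⁻¹) • X ^ K) - (1 - e) ^ K * derivative e := by
      have h2 := congrArg (fun p : ℝ[X] => p.comp (e - 1)) (one_add_X_mul_derivative_truncLog_X K)
      simp only [mul_comp, add_comp, sub_comp, one_comp, X_comp, pow_comp, neg_comp] at h2
      have h3 : derivative (truncLog K (e - 1)) =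
          derivative e * (derivative (truncLog K (X : ℝ[X]))).comp (e - 1) := by
        rw [← truncLog_X_comp, derivative_comp]; simp
      have h4 := derivative_truncExp_X K
      rw [← he] at h4
      rw [derivative_sub, h3, derivative_X]
      linear_combination (derivative e) * h2 + h4
    have hdvd : (X : ℝ[X]) ^ K ∣ e * (derivative (truncLog K (e - 1) - X) - 0) := by
      rw [h1]
      refine dvd_sub (dvd_neg.mpr (dvd_smul_of_dvd _ dvd_rfl)) (Dvd.dvd.mul_right ?_ _)
      refine pow_dvd_pow_of_dvd ?_ _
      rw [← dvd_neg, neg_sub]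
      exact Dvd.intro _ hq.symm
    have hcop : IsCoprime (X ^ K : ℝ[X]) e :=
      IsCoprime.pow_left ⟨-q, 1, by linear_combination hq⟩
    simpa using hcop.dvd_of_dvd_mul_left hdvd

/-- The difference `P` has no constant term and solves `(1 + X) P' = P` modulo `X ^ K`. Each
divisibility of `P` by a power of `X` passes to `P'` and so improves by one power, up to `K + 1`. -/
theorem X_pow_succ_dvd_truncExp_truncLog (K : ℕ) :
    (X : ℝ[X]) ^ (K + 1) ∣ truncExp K (truncLog K X) - (1 + X) := by
  set l : ℝ[X] := truncLog K X with hl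
  set P : ℝ[X] := truncExp K l - (1 + X) with hP
  have hX : (X : ℝ[X]) ∣ l := X_dvd_truncLog K
  have h0 : (X : ℝ[X]) ∣ P := by
    have h1 : l ∣ truncExp K l - 1 := by
      simpa [truncExp_X_comp] using map_dvd (compRingHom l) (X_dvd_truncExp_sub_one K)
    have : P = (truncExp K l - 1) - X := by rw [hP]; ring
    rw [this]
    exact dvd_sub (hX.trans h1) dvd_rfl
  have hE : derivative (truncExp K l) =
      derivative l * (truncExp K l - ((K.factorial : ℝ)⁻¹) • l ^ K) := by
    rw [← truncExp_X_comp, derivative_comp, derivative_truncExp_X]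
    simp [truncExp_X_comp]
  have key : (X : ℝ[X]) ^ K ∣ (1 + X) * derivative P - P := by
    have h2 := one_add_X_mul_derivative_truncLog_X K
    rw [← hl] at h2
    have : (1 + X) * derivative P - P = -(((K.factorial : ℝ)⁻¹) • l ^ K) * (1 - (-X) ^ K)
        - (-X) ^ K * truncExp K l := by
      rw [hP, derivative_sub, hE, derivative_add, derivative_one, derivative_X]
      linear_combination (truncExp K l - ((K.factorial : ℝ)⁻¹) • l ^ K) * h2
    rw [this]
    refine dvd_sub (Dvd.dvd.mul_right (dvd_neg.mpr (dvd_smul_of_dvd _ ?_)) _)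
      (Dvd.dvd.mul_right ?_ _)
    · exact pow_dvd_pow_of_dvd hX K
    · exact pow_dvd_pow_of_dvd (dvd_neg.mpr dvd_rfl) K
  have step : ∀ j ≤ K, (X : ℝ[X]) ^ (j + 1) ∣ P := by
    intro j
    induction j with
    | zero => intro _; simpa using h0
    | succ j ih =>
      intro hj
      have h1 : (X : ℝ[X]) ^ (j + 1) ∣ (1 + X) * derivative P := by
        have := dvd_add ((pow_dvd_pow X hj).trans key) (ih (by omega))
        simpa using this
      have hcop : IsCoprime (X ^ (j + 1) : ℝ[X]) (1 + X) :=
        IsCoprime.pow_left ⟨-1, 1, by ring⟩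
      exact X_pow_succ_dvd_of_derivative (X_dvd_iff.mp h0) (hcop.dvd_of_dvd_mul_left h1)
  exact step K le_rfl

variable {A : Type*} [Ring A] [Algebra ℝ A]

theorem truncLog_truncExp {K : ℕ} {a : A} (ha : a ^ (K + 1) = 0) :
    truncLog K (truncExp K a - 1) = a := by
  obtain ⟨q, hq⟩ := X_pow_succ_dvd_truncLog_truncExp K
  have := congrArg (aeval a) hq
  simpa [aeval_truncLog, aeval_truncExp, ha, sub_eq_zero] using this

theorem truncExp_truncLog {K : ℕ} {u : A} (hu : u ^ (K + 1) = 0) :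
    truncExp K (truncLog K u) = 1 + u := by
  obtain ⟨q, hq⟩ := X_pow_succ_dvd_truncExp_truncLog K
  have := congrArg (aeval u) hq
  simpa [aeval_truncLog, aeval_truncExp, hu, sub_eq_zero] using this

/-- By the binomial theorem `(a + b) ^ (2n + 1) = 0`, so for `K ≥ 2n` the truncation loses nothing
in any of the three exponentials. -/
theorem truncExp_add {K n : ℕ} {a b : A} (hab : Commute a b) (ha : a ^ (n + 1) = 0)
    (hb : b ^ (n + 1) = 0) (hK : 2 * n ≤ K) :
    truncExp K (a + b) = truncExp K a * truncExp K b := by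
  let _ : Module ℚ A := Module.compHom A (algebraMap ℚ ℝ)
  have hs : ∀ (q : ℚ) (x : A), q • x = ((q : ℝ)) • x := fun q x => rfl
  have h : ∀ x : A, x ^ (K + 1) = 0 → truncExp K x = IsNilpotent.exp x := fun x hx => by
    rw [IsNilpotent.exp_eq_sum hx, truncExp]
    simp [hs]
  have hz : ∀ x : A, x ^ (n + 1) = 0 → x ^ (K + 1) = 0 := fun x hx =>
    pow_eq_zero_of_le (by omega) hx
  rw [h _ (hz a ha), h _ (hz b hb), h, IsNilpotent.exp_add_of_commute hab ⟨_, ha⟩ ⟨_, hb⟩]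
  exact hab.add_pow_eq_zero_of_add_le_succ_of_pow_eq_zero ha hb (by omega)

end TruncatedExpLog

/-!
### Dynkin's formula in associative algebras
-/

section WordExpansion

/-- The left-normed product of a list in a Lie ring. -/
def lieLeftNormed {L : Type*} [LieRing L] : List L → L
  | [] => 0
  | a :: l => l.foldl (fun u v => ⁅u, v⁆) a

/-- The word with exponents `e` in the letters `x` and `y`. -/
def exponentWord {L : Type*} {k : ℕ} (e : Fin k → ℕ × ℕ) (x y : L) : List L :=
  (List.ofFn fun i => List.replicate (e i).1 x ++ List.replicate (e i).2 y).flatten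

theorem length_exponentWord {L : Type*} {k : ℕ} (e : Fin k → ℕ × ℕ) (x y : L) :
    (exponentWord e x y).length = ∑ i, ((e i).1 + (e i).2) := by
  simp [exponentWord, List.sum_ofFn, Function.comp_def]

theorem map_exponentWord {L L' : Type*} (φ : L → L') {k : ℕ} (e : Fin k → ℕ × ℕ) (x y : L) :
    (exponentWord e x y).map φ = exponentWord e (φ x) (φ y) := by
  simp [exponentWord, List.map_flatten, List.map_ofFn, Function.comp_def]

theorem mem_exponentWord {L : Type*} {k : ℕ} {e : Fin k → ℕ × ℕ} {x y a : L}
    (h : a ∈ exponentWord e x y) : a = x ∨ a = y := by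
  simp only [exponentWord, List.mem_flatten, List.mem_ofFn] at h
  obtain ⟨_, ⟨i, rfl⟩, h⟩ := h
  rcases List.mem_append.mp h with h | h
  · exact Or.inl (List.eq_of_mem_replicate h)
  · exact Or.inr (List.eq_of_mem_replicate h)

/-- Dynkin's formula for the homogeneous term of degree `m` of the Baker–Campbell–Hausdorff
series, in an arbitrary real Lie algebra. -/
noncomputable def lieDynkin {L : Type*} [LieRing L] [LieAlgebra ℝ L] (m : ℕ) (x y : L) : L :=
  ∑ k ∈ Finset.Icc 1 m, ∑ e ∈ BanachLieAlgebra.dynkinIndex m k,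
    ((-1 : ℝ) ^ (k - 1) / (k : ℝ) *
      ((m : ℝ)⁻¹ / ((∏ i, ((e i).1.factorial * (e i).2.factorial) : ℕ) : ℝ))) •
      lieLeftNormed (exponentWord e x y)

/-- Noncommutative multinomial expansion. The head of the list acts first, so that products of the
operators `rightAd` become left-normed brackets. -/
theorem sum_pow_apply {V ι : Type*} [AddCommGroup V] [Module ℝ V] (s : Finset ι)
    (T : ι → Module.End ℝ V) (k : ℕ) (v : V) :
    ((∑ a ∈ s, T a) ^ k) v =
      ∑ e ∈ Fintype.piFinset (fun _ : Fin k => s), (List.ofFn e).foldl (fun u a => T a u) v := by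
  induction k generalizing v with
  | zero => simp
  | succ k ih =>
    rw [pow_succ, Module.End.mul_apply, LinearMap.sum_apply, map_sum]
    simp_rw [ih]
    rw [← Finset.sum_product']
    refine Finset.sum_nbij' (fun p => Fin.cons p.1 p.2) (fun e => (e 0, Fin.tail e)) ?_ ?_ ?_ ?_ ?_
    · rintro ⟨a, e⟩ h
      simp only [Finset.mem_product, Fintype.mem_piFinset] at h ⊢
      exact Fin.cases h.1 h.2
    · intro e h
      simp only [Finset.mem_product, Fintype.mem_piFinset] at h ⊢
      exact ⟨h 0, fun i => h i.succ⟩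
    · rintro ⟨a, e⟩ _; simp
    · intro e _; simp
    · rintro ⟨a, e⟩ _; simp [List.ofFn_succ]

variable {𝔤 : Type*} [LieRing 𝔤] [LieAlgebra ℝ 𝔤]

/-- The operator `u ↦ ⁅u, a⁆`. -/
noncomputable def rightAd (a : 𝔤) : Module.End ℝ 𝔤 := -LieAlgebra.ad ℝ 𝔤 a

@[simp] theorem rightAd_apply (a u : 𝔤) : rightAd a u = ⁅u, a⁆ := by
  simp [rightAd]

theorem foldl_replicate_lie (a v : 𝔤) (p : ℕ) :
    (List.replicate p a).foldl (fun u v => ⁅u, v⁆) v = (rightAd a ^ p) v := by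
  induction p generalizing v with
  | zero => simp
  | succ p ih => rw [List.replicate_succ, List.foldl_cons, ih, pow_succ]; simp

/-- The exponent pairs `(p, q) ≠ 0` with entries at most `K`. -/
def exponentPairs (K : ℕ) : Finset (ℕ × ℕ) :=
  (Finset.range (K + 1) ×ˢ Finset.range (K + 1)).filter fun p => 1 ≤ p.1 + p.2

theorem truncExp_mul_truncExp_sub_one {A : Type*} [Ring A] [Algebra ℝ A] (K : ℕ) (a b : A) :
    truncExp K b * truncExp K a - 1 = ∑ p ∈ exponentPairs K,
      ((p.1.factorial * p.2.factorial : ℕ) : ℝ)⁻¹ • (b ^ p.2 * a ^ p.1) := by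
  have h : truncExp K b * truncExp K a = ∑ p ∈ Finset.range (K + 1) ×ˢ Finset.range (K + 1),
      ((p.1.factorial * p.2.factorial : ℕ) : ℝ)⁻¹ • (b ^ p.2 * a ^ p.1) := by
    rw [truncExp, truncExp, Finset.sum_mul_sum, Finset.sum_comm, ← Finset.sum_product']
    refine Finset.sum_congr rfl fun p _ => ?_
    rw [smul_mul_smul_comm, Nat.cast_mul, mul_inv, mul_comm]
  have h2 : (Finset.range (K + 1) ×ˢ Finset.range (K + 1)).filter (fun p => ¬ 1 ≤ p.1 + p.2) =
      {(0, 0)} := by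
    ext ⟨p, q⟩; simp; omega
  rw [h, ← Finset.sum_filter_add_sum_filter_not _ (fun p : ℕ × ℕ => 1 ≤ p.1 + p.2), h2]
  simp [exponentPairs]

/-- The expansion produces exactly the words of Dynkin's formula, bracketed onto `v`. The factor
with `y` stands on the left because operators act from the right, so `x` is bracketed first.
Dynkin's factor `1 / m` is still missing; it will come from the Euler operator. -/
theorem truncLog_rightAd_apply (K : ℕ) (x y v : 𝔤) :
    truncLog K (truncExp K (rightAd y) * truncExp K (rightAd x) - 1) v =
      ∑ k ∈ Finset.Icc 1 K, ∑ e ∈ Fintype.piFinset (fun _ : Fin k => exponentPairs K),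
        ((-1 : ℝ) ^ (k - 1) / (k : ℝ) *
          ((∏ i, ((e i).1.factorial * (e i).2.factorial) : ℕ) : ℝ)⁻¹) •
          (exponentWord e x y).foldl (fun u v => ⁅u, v⁆) v := by
  rw [truncExp_mul_truncExp_sub_one, truncLog, LinearMap.sum_apply]
  refine Finset.sum_congr rfl fun k _ => ?_
  rw [LinearMap.smul_apply, sum_pow_apply, Finset.smul_sum]
  refine Finset.sum_congr rfl fun e _ => ?_
  rw [mul_smul]
  congr 1
  have h : ∀ (l : List (ℕ × ℕ)) (v : 𝔤),
      l.foldl (fun u p => (((p.1.factorial * p.2.factorial : ℕ) : ℝ)⁻¹ •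
        (rightAd y ^ p.2 * rightAd x ^ p.1) : Module.End ℝ 𝔤) u) v =
      (((l.map fun p => p.1.factorial * p.2.factorial).prod : ℕ) : ℝ)⁻¹ •
        ((l.map fun p => List.replicate p.1 x ++ List.replicate p.2 y).flatten).foldl
          (fun u v => ⁅u, v⁆) v := by
    intro l
    induction l with
    | nil => intro v; simp
    | cons p l ih =>
      intro v
      have hl : ∀ (w : List 𝔤) (c : ℝ) (v : 𝔤), w.foldl (fun u v => ⁅u, v⁆) (c • v) =
          c • w.foldl (fun u v => ⁅u, v⁆) v := by
        intro w
        induction w with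
        | nil => intros; rfl
        | cons a w ih => intro c v; simp [ih]
      rw [List.foldl_cons, ih, List.map_cons, List.map_cons, List.flatten_cons, List.prod_cons,
        List.foldl_append, List.foldl_append, foldl_replicate_lie, foldl_replicate_lie,
        LinearMap.smul_apply, hl, smul_smul, Module.End.mul_apply]
      congr 1
      push_cast
      simp only [mul_inv]
      ring
  rw [h, List.map_ofFn, List.map_ofFn, List.prod_ofFn]
  rfl

end WordExpansion

/-! ### Polynomials in a formal variable `T` and the Euler operator -/

section AssociativeBCH

attribute [local instance] LieRing.ofAssociativeRing

variable {B : Type*} [Ring B] [Algebra ℝ B]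

/-- The operator `(shiftMul m b f) n = b * f (n - m)` on sequences in `B`; it plays the role of
the monomial `b T ^ m`. -/
def shiftMul (m : ℕ) (b : B) : Module.End ℝ (ℤ → B) where
  toFun f n := b * f (n - m)
  map_add' f g := by ext n; simp [mul_add]
  map_smul' c f := by ext n; simp

@[simp] theorem shiftMul_apply (m : ℕ) (b : B) (f : ℤ → B) (n : ℤ) :
    shiftMul m b f n = b * f (n - m) := rfl

/-- The Euler operator `(∂ f) n = n f n` on sequences in `B`. -/
def eulerOp (B : Type*) [Ring B] [Algebra ℝ B] : Module.End ℝ (ℤ → B) where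
  toFun f n := n • f n
  map_add' f g := by ext n; simp
  map_smul' c f := by ext n; simp [smul_comm]

@[simp] theorem eulerOp_apply (f : ℤ → B) (n : ℤ) : eulerOp B f n = n • f n := rfl

theorem shiftMul_mul (m n : ℕ) (a b : B) :
    shiftMul m a * shiftMul n b = shiftMul (m + n) (a * b) := by
  ext f k
  simp [Module.End.mul_apply, mul_assoc, sub_sub]

theorem shiftMul_add (m : ℕ) (a b : B) : shiftMul m (a + b) = shiftMul m a + shiftMul m b := by
  ext f k; simp [add_mul]

theorem shiftMul_smul (m : ℕ) (c : ℝ) (b : B) : shiftMul m (c • b) = c • shiftMul m b := by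
  ext f k; simp

/-- `shiftMul m` as a linear map. -/
def shiftMulₗ (m : ℕ) : B →ₗ[ℝ] Module.End ℝ (ℤ → B) where
  toFun := shiftMul m
  map_add' := shiftMul_add m
  map_smul' := shiftMul_smul m

@[simp] theorem shiftMulₗ_apply (m : ℕ) (b : B) : shiftMulₗ m b = shiftMul m b := rfl

theorem lie_shiftMul (m n : ℕ) (a b : B) :
    ⁅shiftMul m a, shiftMul n b⁆ = shiftMul (m + n) ⁅a, b⁆ := by
  rw [Ring.lie_def, shiftMul_mul, shiftMul_mul, Ring.lie_def, add_comm n m]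
  ext f k; simp [sub_mul]

theorem eulerOp_lie_shiftMul (m : ℕ) (b : B) :
    ⁅eulerOp B, shiftMul m b⁆ = (m : ℝ) • shiftMul m b := by
  ext f k
  have h : (k : B) * (b * f (k - m)) = b * (k * f (k - m)) := by
    rw [← mul_assoc, ← mul_assoc, Int.cast_commute]
  simp [Ring.lie_def, Module.End.mul_apply, h, sub_mul, mul_sub, Nat.cast_smul_eq_nsmul]
  rw [← mul_assoc, ← mul_assoc, Nat.cast_commute]

theorem foldl_lie_shiftMul (l : List B) (m : ℕ) (a : B) :
    (l.map (shiftMul 1)).foldl (fun u v => ⁅u, v⁆) (shiftMul m a) =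
      shiftMul (m + l.length) (l.foldl (fun u v => ⁅u, v⁆) a) := by
  induction l generalizing m a with
  | nil => simp
  | cons b l ih =>
    rw [List.map_cons, List.foldl_cons, lie_shiftMul, ih, List.foldl_cons, List.length_cons]
    congr 1; ring

/-- Since `[∂, b T] = b T`, bracketing `∂` with a word merely absorbs its first letter. This is how
words acting on a vector become left-normed products of their letters. -/
theorem foldl_lie_eulerOp (l : List B) (hl : l ≠ []) :
    (l.map (shiftMul 1)).foldl (fun u v => ⁅u, v⁆) (eulerOp B) =
      shiftMul l.length (lieLeftNormed l) := by
  cases l with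
  | nil => exact absurd rfl hl
  | cons b l =>
    rw [List.map_cons, List.foldl_cons, eulerOp_lie_shiftMul, Nat.cast_one, one_smul,
      foldl_lie_shiftMul, List.length_cons, add_comm]
    rfl

section NilpotentIdeal

theorem pow_succ_mem {A : Type*} [Ring A] [Algebra ℝ A] {J : Submodule ℝ A} (hJ : J * J ≤ J)
    {a : A} (ha : a ∈ J) (n : ℕ) : a ^ (n + 1) ∈ J := by
  induction n with
  | zero => simpa
  | succ n ih => rw [pow_succ]; exact hJ (Submodule.mul_mem_mul ih ha)

theorem truncExp_sub_one_mem {A : Type*} [Ring A] [Algebra ℝ A] {J : Submodule ℝ A}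
    (hJ : J * J ≤ J) {a : A} (ha : a ∈ J) (K : ℕ) : truncExp K a - 1 ∈ J := by
  rw [truncExp, Finset.sum_range_succ']
  simp only [pow_zero, Nat.factorial_zero, Nat.cast_one, inv_one, one_smul, add_sub_cancel_right]
  exact J.sum_mem fun i _ => J.smul_mem _ (pow_succ_mem hJ ha i)

theorem truncLog_mem {A : Type*} [Ring A] [Algebra ℝ A] {J : Submodule ℝ A}
    (hJ : J * J ≤ J) {a : A} (ha : a ∈ J) (K : ℕ) : truncLog K a ∈ J := by
  refine J.sum_mem fun i hi => J.smul_mem _ ?_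
  obtain ⟨j, rfl⟩ : ∃ j, i = j + 1 := ⟨i - 1, by have := (Finset.mem_Icc.mp hi).1; omega⟩
  exact pow_succ_mem hJ ha j

theorem pow_eq_zero_of_mem {A : Type*} [Ring A] [Algebra ℝ A] {J : Submodule ℝ A} {n : ℕ}
    (hJ : J ^ n = ⊥) {a : A} (ha : a ∈ J) : a ^ n = 0 := by
  have := Submodule.pow_mem_pow J ha n
  rwa [hJ, Submodule.mem_bot] at this

theorem lieLeftNormed_mem_pow {A : Type*} [Ring A] [Algebra ℝ A] {J : Submodule ℝ A}
    {l : List A} (hl : ∀ a ∈ l, a ∈ J) : lieLeftNormed l ∈ J ^ l.length := by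
  have key : ∀ (l : List A) (n : ℕ) (u : A), (∀ a ∈ l, a ∈ J) → u ∈ J ^ n →
      l.foldl (fun u v => ⁅u, v⁆) u ∈ J ^ (n + l.length) := by
    intro l
    induction l with
    | nil => intro n u _ hu; simpa
    | cons b l ih =>
      intro n u hl hu
      have hb : b ∈ J := hl b (by simp)
      have : ⁅u, b⁆ ∈ J ^ (n + 1) := by
        rw [Ring.lie_def]
        refine Submodule.sub_mem _ ?_ ?_
        · rw [pow_succ]; exact Submodule.mul_mem_mul hu hb
        · rw [pow_succ']; exact Submodule.mul_mem_mul hb hu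
      have := ih (n + 1) _ (fun a ha => hl a (by simp [ha])) this
      rw [List.foldl_cons, List.length_cons]
      convert this using 2
      ring
  cases l with
  | nil => exact Submodule.zero_mem _
  | cons b l =>
    have := key l 1 b (fun a ha => hl a (by simp [ha])) (by simpa using hl b (by simp))
    rw [List.length_cons, add_comm]
    exact this

/-- The span of the operators `shiftMul m b` with `m ≥ 1` and `b ∈ J`. -/
def positivePart (J : Submodule ℝ B) : Submodule ℝ (Module.End ℝ (ℤ → B)) :=
  Submodule.span ℝ {Q | ∃ m : ℕ, ∃ b ∈ J, Q = shiftMul (m + 1) b}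

theorem shiftMul_mem_positivePart {J : Submodule ℝ B} {b : B} (hb : b ∈ J) :
    shiftMul 1 b ∈ positivePart J := Submodule.subset_span ⟨0, b, hb, rfl⟩

theorem positivePart_mul_le {J : Submodule ℝ B} (hJ : J * J ≤ J) :
    positivePart J * positivePart J ≤ positivePart J := by
  rw [positivePart, Submodule.span_mul_span]
  refine Submodule.span_mono ?_
  rintro _ ⟨_, ⟨m, a, ha, rfl⟩, _, ⟨n, b, hb, rfl⟩, rfl⟩
  refine ⟨m + 1 + n, a * b, hJ (Submodule.mul_mem_mul ha hb), ?_⟩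
  simp only [shiftMul_mul]
  rfl

theorem positivePart_pow {J : Submodule ℝ B} {n : ℕ} (hJ : J ^ n = ⊥) :
    positivePart J ^ n = ⊥ := by
  have key : ∀ n : ℕ, positivePart J ^ n ≤
      Submodule.span ℝ {Q | ∃ m : ℕ, ∃ b ∈ J ^ n, Q = shiftMul m b} := by
    intro n
    induction n with
    | zero =>
      rw [Submodule.pow_zero, Submodule.one_le]
      refine Submodule.subset_span ⟨0, 1, Submodule.one_le.mp le_rfl, ?_⟩
      ext f k; simp
    | succ n ih =>
      rw [pow_succ]
      refine (mul_le_mul' ih le_rfl).trans ?_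
      rw [positivePart, Submodule.span_mul_span]
      refine Submodule.span_mono ?_
      rintro _ ⟨_, ⟨m, a, ha, rfl⟩, _, ⟨n, b, hb, rfl⟩, rfl⟩
      refine ⟨m + (n + 1), a * b, ?_, ?_⟩
      · exact Submodule.mul_mem_mul ha hb
      · simp only [shiftMul_mul]
  rw [eq_bot_iff]
  refine (key n).trans ?_
  rw [Submodule.span_le]
  rintro _ ⟨m, b, hb, rfl⟩
  rw [hJ, Submodule.mem_bot] at hb
  subst hb
  simp only [SetLike.mem_coe, Submodule.mem_bot]
  ext f k; simp

/-- Presents an element as a polynomial in `T` without constant term, so that coefficients can be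
compared. -/
theorem exists_of_mem_positivePart {J : Submodule ℝ B} {Q : Module.End ℝ (ℤ → B)}
    (hQ : Q ∈ positivePart J) :
    ∃ c : ℕ →₀ B, Q = c.sum fun m b => shiftMul (m + 1) b := by
  induction hQ using Submodule.span_induction with
  | mem Q h =>
    obtain ⟨m, b, -, rfl⟩ := h
    refine ⟨Finsupp.single m b, ?_⟩
    rw [Finsupp.sum_single_index]
    exact map_zero (shiftMulₗ (m + 1))
  | zero => exact ⟨0, by simp⟩
  | add Q R _ _ hQ hR =>
    obtain ⟨c, rfl⟩ := hQ
    obtain ⟨d, rfl⟩ := hR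
    refine ⟨c + d, ?_⟩
    rw [Finsupp.sum_add_index']
    · exact fun m => map_zero (shiftMulₗ (m + 1))
    · exact fun m => map_add (shiftMulₗ (m + 1))
  | smul r Q _ hQ =>
    obtain ⟨c, rfl⟩ := hQ
    refine ⟨r • c, ?_⟩
    rw [Finsupp.sum_smul_index', Finsupp.smul_sum]
    · exact Finsupp.sum_congr fun m _ => (map_smul (shiftMulₗ (m + 1)) r _).symm
    · exact fun m => map_zero (shiftMulₗ (m + 1))

end NilpotentIdeal

end AssociativeBCH

/-! ### Proof of the Baker–Campbell–Hausdorff–Dynkin formula -/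

section AssociativeBCH

attribute [local instance] LieRing.ofAssociativeRing

variable {B : Type*} [Ring B] [Algebra ℝ B]

theorem truncExp_neg_mul {K n : ℕ} {a : B} (ha : a ^ (n + 1) = 0) (hK : 2 * n ≤ K) :
    truncExp K (-a) * truncExp K a = 1 := by
  rw [← truncExp_add (n := n) (Commute.neg_left rfl) (by rw [neg_pow, ha, mul_zero]) ha hK,
    neg_add_cancel, truncExp, Finset.sum_range_succ']
  simp

theorem truncExp_mul_neg {K n : ℕ} {a : B} (ha : a ^ (n + 1) = 0) (hK : 2 * n ≤ K) :
    truncExp K a * truncExp K (-a) = 1 := by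
  have := truncExp_neg_mul (a := -a) (n := n) (by rw [neg_pow, ha, mul_zero]) hK
  rwa [neg_neg] at this

theorem truncExp_mulLeft (K : ℕ) (a : B) :
    truncExp K (LinearMap.mulLeft ℝ a) = LinearMap.mulLeft ℝ (truncExp K a) := by
  ext c
  simp [truncExp, LinearMap.pow_mulLeft, Finset.sum_mul]

theorem truncExp_mulRight (K : ℕ) (a : B) :
    truncExp K (LinearMap.mulRight ℝ a) = LinearMap.mulRight ℝ (truncExp K a) := by
  ext c
  simp [truncExp, LinearMap.pow_mulRight, Finset.mul_sum]

theorem rightAd_eq (a : B) :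
    rightAd a = LinearMap.mulRight ℝ a + LinearMap.mulLeft ℝ (-a) := by
  ext c
  simp [Ring.lie_def, sub_eq_add_neg]

/-- Left and right multiplications commute and are each nilpotent of order `n + 1`. The doubled
exponent of their sum is one reason for truncating at `K ≥ 2n`. -/
theorem rightAd_pow_eq_zero {n : ℕ} {a : B} (ha : a ^ (n + 1) = 0) :
    rightAd a ^ (2 * n + 1) = 0 := by
  rw [rightAd_eq]
  refine Commute.add_pow_eq_zero_of_add_le_succ_of_pow_eq_zero (m := n + 1) (n := n + 1) ?_ ?_ ?_
    (by omega)
  · ext c; simp [Module.End.mul_apply, mul_assoc]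
  · rw [LinearMap.pow_mulRight, ha]; ext; simp
  · rw [LinearMap.pow_mulLeft, neg_pow, ha]; ext; simp

theorem truncExp_rightAd_apply {K n : ℕ} {a : B} (ha : a ^ (n + 1) = 0) (hK : 2 * n ≤ K) (c : B) :
    truncExp K (rightAd a) c = truncExp K (-a) * c * truncExp K a := by
  rw [rightAd_eq, truncExp_add (n := n) _ _ _ hK, truncExp_mulLeft, truncExp_mulRight]
  · simp [Module.End.mul_apply]
  · ext c; simp [Module.End.mul_apply, mul_assoc]
  · rw [LinearMap.pow_mulRight, ha]; ext; simp
  · rw [LinearMap.pow_mulLeft, neg_pow, ha]; ext; simp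

theorem dynkinIndex_eq_filter {m K k : ℕ} (hm : m ≤ K) :
    BanachLieAlgebra.dynkinIndex m k =
      (Fintype.piFinset fun _ : Fin k => exponentPairs K).filter
        fun e => ∑ i, ((e i).1 + (e i).2) = m := by
  ext e
  simp only [BanachLieAlgebra.dynkinIndex, exponentPairs, Finset.mem_filter, Fintype.mem_piFinset,
    Finset.mem_product, Finset.mem_range]
  constructor
  · rintro ⟨h1, h2, h3⟩
    exact ⟨fun i => ⟨⟨by have := (h1 i).1; omega, by have := (h1 i).2; omega⟩, h2 i⟩, h3⟩
  · rintro ⟨h1, h3⟩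
    refine ⟨fun i => ?_, fun i => (h1 i).2, h3⟩
    have := Finset.single_le_sum (f := fun i => (e i).1 + (e i).2) (fun _ _ => Nat.zero_le _)
      (Finset.mem_univ i)
    simp only [h3] at this
    omega

theorem dynkinIndex_eq_empty {m k : ℕ} (hm : m < k) : BanachLieAlgebra.dynkinIndex m k = ∅ := by
  rw [Finset.eq_empty_iff_forall_notMem]
  intro e he
  simp only [BanachLieAlgebra.dynkinIndex, Finset.mem_filter] at he
  have := Finset.sum_le_sum fun i (_ : i ∈ Finset.univ) => he.2.1 i
  simp only [Finset.sum_const, Finset.card_univ, Fintype.card_fin, smul_eq_mul, mul_one,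
    he.2.2] at this
  omega

/-- Sorts the words by their length `m`. The weight `m` on the right cancels the `1 / m` of Dynkin's
coefficients, and words longer than `N` vanish by `h`. -/
theorem sum_words_eq_sum_lieDynkin {V : Type*} [AddCommGroup V] [Module ℝ V] {L : Type*}
    [LieRing L] [LieAlgebra ℝ L] (F : ℕ → L →ₗ[ℝ] V) {N K : ℕ} (hNK : N ≤ K) (x y : L)
    (h : ∀ k, ∀ e : Fin k → ℕ × ℕ, N < ∑ i, ((e i).1 + (e i).2) →
      lieLeftNormed (exponentWord e x y) = 0) :
    ∑ k ∈ Finset.Icc 1 K, ∑ e ∈ Fintype.piFinset (fun _ : Fin k => exponentPairs K),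
        ((-1 : ℝ) ^ (k - 1) / (k : ℝ) *
          ((∏ i, ((e i).1.factorial * (e i).2.factorial) : ℕ) : ℝ)⁻¹) •
          F (∑ i, ((e i).1 + (e i).2)) (lieLeftNormed (exponentWord e x y)) =
      ∑ m ∈ Finset.Icc 1 N, (m : ℝ) • F m (lieDynkin m x y) := by
  have h1 : ∀ m ∈ Finset.Icc 1 N, (m : ℝ) • F m (lieDynkin m x y) =
      ∑ k ∈ Finset.Icc 1 K, ∑ e ∈ Fintype.piFinset (fun _ : Fin k => exponentPairs K),
        if ∑ i, ((e i).1 + (e i).2) = m then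
        ((-1 : ℝ) ^ (k - 1) / (k : ℝ) *
          ((∏ i, ((e i).1.factorial * (e i).2.factorial) : ℕ) : ℝ)⁻¹) •
          F (∑ i, ((e i).1 + (e i).2)) (lieLeftNormed (exponentWord e x y)) else 0 := by
    intro m hm
    rw [Finset.mem_Icc] at hm
    have hm0 : (m : ℝ) ≠ 0 := by have := hm.1; positivity
    have h2 : lieDynkin m x y = ∑ k ∈ Finset.Icc 1 K, ∑ e ∈ BanachLieAlgebra.dynkinIndex m k,
        ((-1 : ℝ) ^ (k - 1) / (k : ℝ) *
        ((m : ℝ)⁻¹ / ((∏ i, ((e i).1.factorial * (e i).2.factorial) : ℕ) : ℝ))) •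
        lieLeftNormed (exponentWord e x y) := by
      rw [lieDynkin]
      refine Finset.sum_subset (Finset.Icc_subset_Icc_right (hm.2.trans hNK)) fun k hk hk' => ?_
      simp only [Finset.mem_Icc, not_and, not_le] at hk hk'
      rw [dynkinIndex_eq_empty (hk' hk.1), Finset.sum_empty]
    rw [h2, map_sum, Finset.smul_sum]
    refine Finset.sum_congr rfl fun k _ => ?_
    rw [dynkinIndex_eq_filter (hm.2.trans hNK), map_sum, Finset.smul_sum, Finset.sum_filter]
    refine Finset.sum_congr rfl fun e _ => ?_
    split_ifs with he
    · rw [map_smul, smul_smul, he]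
      congr 1
      field_simp
    · rfl
  rw [Finset.sum_congr rfl h1, Finset.sum_comm]
  refine Finset.sum_congr rfl fun k hk => ?_
  rw [Finset.sum_comm]
  refine Finset.sum_congr rfl fun e he => ?_
  rw [Finset.sum_ite_eq]
  split_ifs with hN
  · rfl
  · rw [h k e, map_zero, smul_zero]
    by_contra hcon
    refine hN (Finset.mem_Icc.mpr ⟨?_, not_lt.mp hcon⟩)
    have hk1 := (Finset.mem_Icc.mp hk).1
    rw [Fintype.mem_piFinset] at he
    refine le_trans ?_ (Finset.single_le_sum (f := fun i => (e i).1 + (e i).2)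
      (fun _ _ => Nat.zero_le _) (Finset.mem_univ ⟨0, hk1⟩))
    exact (Finset.mem_filter.mp (he _)).2

/-- The Baker–Campbell–Hausdorff–Dynkin formula for elements of a nilpotent subalgebra of an
associative algebra. -/
theorem truncExp_mul_truncExp {J : Submodule ℝ B} {N K : ℕ} (hJ : J * J ≤ J)
    (hN : J ^ (N + 1) = ⊥) (hK : 2 * N ≤ K) {x y : B} (hx : x ∈ J) (hy : y ∈ J) :
    truncExp K x * truncExp K y = truncExp K (∑ m ∈ Finset.Icc 1 N, lieDynkin m x y) := by
  set J' := positivePart J with hJ'def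
  have hJ' : J' * J' ≤ J' := positivePart_mul_le hJ
  have hN' : J' ^ (N + 1) = ⊥ := positivePart_pow hN
  set X := shiftMul 1 x
  set Y := shiftMul 1 y
  have hX : X ∈ J' := shiftMul_mem_positivePart hx
  have hY : Y ∈ J' := shiftMul_mem_positivePart hy
  have hX0 := pow_eq_zero_of_mem hN' hX
  have hY0 := pow_eq_zero_of_mem hN' hY
  have hu : truncExp K X * truncExp K Y - 1 ∈ J' := by
    have hX1 := truncExp_sub_one_mem hJ' hX K
    have hY1 := truncExp_sub_one_mem hJ' hY K
    have : truncExp K X * truncExp K Y - 1 = (truncExp K X - 1) * (truncExp K Y - 1) +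
        (truncExp K X - 1) + (truncExp K Y - 1) := by
      simp only [sub_mul, mul_sub, one_mul, mul_one]; abel
    rw [this]
    exact J'.add_mem (J'.add_mem (hJ' (Submodule.mul_mem_mul hX1 hY1)) hX1) hY1
  set Z := truncLog K (truncExp K X * truncExp K Y - 1) with hZdef
  have hZ : Z ∈ J' := truncLog_mem hJ' hu K
  have hZ0 := pow_eq_zero_of_mem hN' hZ
  have hexpZ : truncExp K Z = truncExp K X * truncExp K Y := by
    rw [hZdef, truncExp_truncLog (pow_eq_zero_of_le (by omega) (pow_eq_zero_of_mem hN' hu))]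
    abel
  have hexpnZ : truncExp K (-Z) = truncExp K (-Y) * truncExp K (-X) := by
    have h1 : truncExp K Z * (truncExp K (-Y) * truncExp K (-X)) = 1 := by
      rw [hexpZ, mul_assoc, ← mul_assoc (truncExp K Y), truncExp_mul_neg hY0 hK, one_mul,
        truncExp_mul_neg hX0 hK]
    calc truncExp K (-Z) = truncExp K (-Z) * (truncExp K Z * (truncExp K (-Y) * truncExp K (-X))) := by
          rw [h1, mul_one]
      _ = _ := by rw [← mul_assoc, truncExp_neg_mul hZ0 hK, one_mul]
  -- Both sides are conjugation by `exp X exp Y = exp Z`. Taking logarithms expresses `rightAd Z`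
  -- through `rightAd X` and `rightAd Y`.
  have hAd : truncExp K (rightAd Z) = truncExp K (rightAd Y) * truncExp K (rightAd X) := by
    refine LinearMap.ext fun c => ?_
    rw [Module.End.mul_apply, truncExp_rightAd_apply hZ0 hK, truncExp_rightAd_apply hX0 hK,
      truncExp_rightAd_apply hY0 hK, hexpZ, hexpnZ]
    simp only [mul_assoc]
  have hlog : rightAd Z = truncLog K (truncExp K (rightAd Y) * truncExp K (rightAd X) - 1) := by
    rw [← hAd, truncLog_truncExp]
    exact pow_eq_zero_of_le (by omega) (rightAd_pow_eq_zero hZ0)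
  -- The identity for `rightAd Z` is evaluated at the Euler operator, which multiplies the
  -- coefficient of `T ^ m` in `Z` by `m`.
  have hbr : ⁅eulerOp B, Z⁆ = ∑ m ∈ Finset.Icc 1 N, (m : ℝ) • shiftMul m (lieDynkin m x y) := by
    rw [← rightAd_apply, hlog, truncLog_rightAd_apply]
    refine Eq.trans ?_ (sum_words_eq_sum_lieDynkin (fun m => shiftMulₗ m) (N := N) (K := K)
      (by omega) x y ?_)
    · refine Finset.sum_congr rfl fun k hk => Finset.sum_congr rfl fun e he => ?_
      rw [← map_exponentWord, foldl_lie_eulerOp, length_exponentWord]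
      · rfl
      · rw [← List.length_pos_iff, length_exponentWord]
        rw [Fintype.mem_piFinset] at he
        refine lt_of_lt_of_le ?_ (Finset.single_le_sum (f := fun i => (e i).1 + (e i).2)
          (fun _ _ => Nat.zero_le _) (Finset.mem_univ ⟨0, (Finset.mem_Icc.mp hk).1⟩))
        exact (Finset.mem_filter.mp (he _)).2
    · intro k e he
      have h1 : lieLeftNormed (exponentWord e x y) ∈ J ^ (exponentWord e x y).length :=
        lieLeftNormed_mem_pow fun a ha => by
          rcases mem_exponentWord ha with rfl | rfl <;> assumption
      rw [length_exponentWord] at h1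
      obtain ⟨r, hr⟩ := Nat.exists_eq_add_of_lt he
      rw [hr, show N + r + 1 = (N + 1) + r by ring] at h1
      rcases r with _ | r
      · rw [add_zero, hN] at h1; exact (Submodule.mem_bot ℝ).mp h1
      · rw [Submodule.pow_add _ (by omega), hN, Submodule.bot_mul] at h1
        exact (Submodule.mem_bot ℝ).mp h1
  obtain ⟨c, hc⟩ := exists_of_mem_positivePart hZ
  -- Applying both sides of `hbr` to the unit sequence at 0 and reading the entry `m + 1` extracts
  -- the coefficient of `T ^ (m + 1)`.
  have hcoef : ∀ m, c m = if m + 1 ∈ Finset.Icc 1 N then lieDynkin (m + 1) x y else 0 := by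
    intro m
    have h1 := congrArg (fun Q : Module.End ℝ (ℤ → B) => Q (Pi.single 0 1) ((m + 1 : ℕ) : ℤ)) hbr
    have h2 : ∀ (j : ℕ) (b : B), shiftMul j b (Pi.single 0 1) ((m + 1 : ℕ) : ℤ) =
        if j = m + 1 then b else 0 := by
      intro j b
      rw [shiftMul_apply]
      split_ifs with hj
      · subst hj; simp
      · rw [Pi.single_eq_of_ne (by omega), mul_zero]
    have h3 : ⁅eulerOp B, Z⁆ = c.sum fun j b => ((j + 1 : ℕ) : ℝ) • shiftMul (j + 1) b := by
      rw [hc, Finsupp.sum, ← LieAlgebra.ad_apply ℝ, map_sum]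
      exact Finset.sum_congr rfl fun j _ => eulerOp_lie_shiftMul _ _
    rw [h3] at h1
    simp only [Finsupp.sum, LinearMap.sum_apply, Finset.sum_apply, LinearMap.smul_apply,
      Pi.smul_apply, h2, smul_ite, smul_zero, Nat.add_right_cancel_iff, Finset.sum_ite_eq'] at h1
    have h4 : ((m + 1 : ℕ) : ℝ) ≠ 0 := by positivity
    have h5 : ((m + 1 : ℕ) : ℝ) • c m = if m ∈ c.support then ((m + 1 : ℕ) : ℝ) • c m else 0 := by
      split_ifs with h
      · rfl
      · rw [Finsupp.notMem_support_iff.mp h, smul_zero]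
    rw [← h5] at h1
    refine smul_right_injective B h4 ?_
    simp only [h1, smul_ite, smul_zero]
  -- The shift fixes constant sequences, so restricting to them amounts to setting `T = 1`.
  have hconst : ∀ (Q : Module.End ℝ (ℤ → B)) (b : B),
      (∀ w : B, Q (fun _ => w) = fun _ => b * w) →
      ∀ w : B, truncExp K Q (fun _ => w) = fun _ => truncExp K b * w := by
    intro Q b hQ w
    have hp : ∀ i, (Q ^ i) (fun _ => w) = fun _ => b ^ i * w := by
      intro i
      induction i with
      | zero => simp
      | succ i ih => rw [pow_succ', Module.End.mul_apply, ih, hQ, pow_succ']; simp [mul_assoc]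
    ext n
    simp [truncExp, hp, Finset.sum_mul]
  have hZc : ∀ w : B, Z (fun _ => w) = fun _ => (∑ m ∈ Finset.Icc 1 N, lieDynkin m x y) * w := by
    intro w
    have h1 : (c.sum fun _ b => b) = ∑ m ∈ Finset.Icc 1 N, lieDynkin m x y := by
      have h2 : c.support ⊆ Finset.range N := by
        intro m hm
        rw [Finsupp.mem_support_iff, hcoef] at hm
        simp only [Finset.mem_Icc, ne_eq, ite_eq_right_iff, Classical.not_imp] at hm
        rw [Finset.mem_range]; omega
      rw [Finsupp.sum_of_support_subset c h2 _ (fun _ _ => rfl), Finset.range_eq_Ico,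
        ← Finset.Ico_add_one_right_eq_Icc, ← Finset.sum_Ico_add' _ 0 N 1]
      refine Finset.sum_congr rfl fun m hm => ?_
      rw [hcoef, if_pos]
      rw [Finset.mem_Ico] at hm
      rw [Finset.mem_Icc]; omega
    rw [← h1, hc]
    ext n
    simp [Finsupp.sum, Finset.sum_mul]
  have hfin := congrArg (fun Q : Module.End ℝ (ℤ → B) => Q (fun _ => 1) 0) hexpZ
  simp only [Module.End.mul_apply] at hfin
  rw [hconst Z _ hZc, hconst Y y (fun w => by ext; simp [Y]), hconst X x (fun w => by ext; simp [X])]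
    at hfin
  simpa using hfin.symm

end AssociativeBCH

/-! ### Layers, the nilpotent faithful representation, associativity -/

namespace BanachLieAlgebra

namespace Stratification

section Algebra

variable {M : Type*} [BanachLieAlgebra M] (H : Stratification M)

theorem proj_mem (i : ℕ) (x : M) : H.proj i x ∈ H.layer i := by
  simp [proj]

theorem proj_of_mem {j : ℕ} {x : M} (hx : x ∈ H.layer j) (i : ℕ) :
    H.proj i x = if i = j then x else 0 := by
  have h : (LinearEquiv.ofBijective (DirectSum.coeLinearMap H.layer) H.bijective_sum).symm x =
      DirectSum.lof ℝ ℕ (fun j => H.layer j) j ⟨x, hx⟩ := by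
    rw [LinearEquiv.symm_apply_eq]
    simp
  simp only [proj, LinearMap.comp_apply, LinearEquiv.coe_coe, h]
  split_ifs with hij
  · subst hij; simp [DirectSum.component.lof_self]
  · simp [DirectSum.component.of, Ne.symm hij]

theorem proj_of_mem_self {j : ℕ} {x : M} (hx : x ∈ H.layer j) : H.proj j x = x := by
  rw [H.proj_of_mem hx, if_pos rfl]

theorem proj_of_mem_ne {i j : ℕ} {x : M} (hx : x ∈ H.layer j) (hij : i ≠ j) :
    H.proj i x = 0 := by
  rw [H.proj_of_mem hx, if_neg hij]

theorem eq_zero_of_mem_layer {i : ℕ} (hi : i ∉ Finset.Icc 1 H.step) {x : M}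
    (hx : x ∈ H.layer i) : x = 0 := by
  rw [Finset.mem_Icc, not_and_or, not_le, not_le] at hi
  rcases hi with hi | hi
  · obtain rfl : i = 0 := by omega
    rwa [H.layer_zero, Submodule.mem_bot] at hx
  · rwa [H.layer_of_step_lt i hi, Submodule.mem_bot] at hx

theorem proj_eq_zero {i : ℕ} (hi : i ∉ Finset.Icc 1 H.step) (x : M) : H.proj i x = 0 :=
  H.eq_zero_of_mem_layer hi (H.proj_mem i x)

theorem sum_proj (x : M) : ∑ i ∈ Finset.Icc 1 H.step, H.proj i x = x := by
  set T : M →ₗ[ℝ] M := ∑ i ∈ Finset.Icc 1 H.step, H.proj i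
  have h : T ∘ₗ DirectSum.coeLinearMap H.layer = DirectSum.coeLinearMap H.layer := by
    refine DirectSum.linearMap_ext ℝ fun j => LinearMap.ext fun z => ?_
    simp only [LinearMap.comp_apply, DirectSum.coeLinearMap_lof, T, LinearMap.sum_apply]
    simp only [H.proj_of_mem z.2, Finset.sum_ite_eq']
    split_ifs with hj
    · rfl
    · exact (H.eq_zero_of_mem_layer hj z.2).symm
  obtain ⟨y, rfl⟩ := H.bijective_sum.2 x
  have := LinearMap.congr_fun h y
  simpa [T] using this

theorem layer_induction {p : M → Prop} (hadd : ∀ x y, p x → p y → p (x + y)) (h0 : p 0)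
    (hl : ∀ i, ∀ x ∈ H.layer i, p x) (x : M) : p x := by
  rw [← H.sum_proj x]
  exact Finset.sum_induction _ p hadd h0 fun i _ => hl i _ (H.proj_mem i x)

theorem ext_proj {x y : M} (h : ∀ i, H.proj i x = H.proj i y) : x = y := by
  rw [← H.sum_proj x, ← H.sum_proj y]
  exact Finset.sum_congr rfl fun i _ => h i

/-- The elements `∑_{i ≥ k} x_i` with `x_i` in the `i`-th layer. -/
noncomputable def tail (k : ℕ) : Submodule ℝ M := ⨅ i ∈ Finset.range k, LinearMap.ker (H.proj i)

theorem mem_tail {k : ℕ} {x : M} : x ∈ H.tail k ↔ ∀ i < k, H.proj i x = 0 := by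
  simp [tail, Submodule.mem_iInf]

theorem layer_le_tail {i k : ℕ} (hik : k ≤ i) : H.layer i ≤ H.tail k := fun x hx =>
  H.mem_tail.mpr fun j hj => H.proj_of_mem_ne hx (by omega)

theorem tail_antitone : Antitone H.tail := fun _ _ hij _ hx =>
  H.mem_tail.mpr fun k hk => H.mem_tail.mp hx k (hk.trans_le hij)

theorem mem_tail_one (x : M) : x ∈ H.tail 1 := H.mem_tail.mpr fun i hi => by
  obtain rfl : i = 0 := by omega
  exact H.proj_eq_zero (by simp) x

theorem tail_eq_bot {k : ℕ} (hk : H.step < k) {x : M} (hx : x ∈ H.tail k) : x = 0 := by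
  rw [← H.sum_proj x]
  exact Finset.sum_eq_zero fun i hi =>
    H.mem_tail.mp hx i ((Finset.mem_Icc.mp hi).2.trans_lt hk)

theorem tail_induction {k : ℕ} {p : M → Prop} (hadd : ∀ x y, p x → p y → p (x + y)) (h0 : p 0)
    (hl : ∀ i, k ≤ i → ∀ x ∈ H.layer i, p x) {x : M} (hx : x ∈ H.tail k) : p x := by
  rw [← H.sum_proj x]
  refine Finset.sum_induction _ p hadd h0 fun i _ => ?_
  by_cases hi : k ≤ i
  · exact hl i hi _ (H.proj_mem i x)
  · rw [H.mem_tail.mp hx i (not_le.mp hi)]; exact h0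

theorem lie_mem_tail {j k : ℕ} {x y : M} (hx : x ∈ H.tail j) (hy : y ∈ H.tail k) :
    ⁅x, y⁆ ∈ H.tail (j + k) := by
  refine H.tail_induction (k := j) (p := fun x => ⁅x, y⁆ ∈ H.tail (j + k)) ?_ ?_ ?_ hx
  · intro x x' hx hx'; rw [add_lie]; exact Submodule.add_mem _ hx hx'
  · rw [zero_lie]; exact Submodule.zero_mem _
  intro i hi x hx
  refine H.tail_induction (k := k) (p := fun y => ⁅x, y⁆ ∈ H.tail (j + k)) ?_ ?_ ?_ hy
  · intro x x' hx hx'; rw [lie_add]; exact Submodule.add_mem _ hx hx'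
  · rw [lie_zero]; exact Submodule.zero_mem _
  intro l hl y hy
  exact H.layer_le_tail (by omega) (H.lie_mem i l x hx y hy)

theorem lie_mem_tail_succ {k : ℕ} {y : M} (x : M) (hy : y ∈ H.tail k) :
    ⁅x, y⁆ ∈ H.tail (k + 1) := by
  rw [add_comm]; exact H.lie_mem_tail (H.mem_tail_one x) hy

theorem lie_mem_tail_two (x y : M) : ⁅x, y⁆ ∈ H.tail 2 := by
  have h : ⁅x, y⁆ ∈ H.tail (1 + 1) := H.lie_mem_tail (H.mem_tail_one x) (H.mem_tail_one y)
  rwa [one_add_one_eq_two] at h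

/-- The derivation acting as multiplication by `i` on the `i`-th layer. -/
noncomputable def degreeDeriv : M →ₗ[ℝ] M := ∑ i ∈ Finset.Icc 1 H.step, (i : ℝ) • H.proj i

theorem degreeDeriv_of_mem {j : ℕ} {x : M} (hx : x ∈ H.layer j) :
    H.degreeDeriv x = (j : ℝ) • x := by
  by_cases hj : j ∈ Finset.Icc 1 H.step
  · simp only [degreeDeriv, LinearMap.sum_apply, LinearMap.smul_apply, H.proj_of_mem hx,
      smul_ite, smul_zero, Finset.sum_ite_eq']
    rw [if_pos hj]
  · rw [H.eq_zero_of_mem_layer hj hx]; simp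

theorem degreeDeriv_lie (x y : M) :
    H.degreeDeriv ⁅x, y⁆ = ⁅H.degreeDeriv x, y⁆ + ⁅x, H.degreeDeriv y⁆ := by
  refine H.layer_induction (p := fun x => H.degreeDeriv ⁅x, y⁆ =
    ⁅H.degreeDeriv x, y⁆ + ⁅x, H.degreeDeriv y⁆) ?_ (by simp) ?_ x
  · intro x x' hx hx'
    rw [add_lie, map_add, hx, hx', map_add, add_lie, add_lie]; abel
  intro i x hx
  refine H.layer_induction (p := fun y => H.degreeDeriv ⁅x, y⁆ =
    ⁅H.degreeDeriv x, y⁆ + ⁅x, H.degreeDeriv y⁆) ?_ (by simp) ?_ y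
  · intro x x' hx hx'
    rw [lie_add, map_add, hx, hx', map_add, lie_add, lie_add]; abel
  intro j y hy
  rw [H.degreeDeriv_of_mem (H.lie_mem i j x hx y hy), H.degreeDeriv_of_mem hx,
    H.degreeDeriv_of_mem hy, smul_lie, lie_smul, ← add_smul]
  push_cast; rfl

/-- The eigenvalues `1, …, ν` are nonzero. This makes `faithfulRep` injective, which the adjoint
representation alone need not be because of the centre. -/
theorem degreeDeriv_injective : Function.Injective H.degreeDeriv := by
  rw [injective_iff_map_eq_zero]
  intro x hx
  refine H.ext_proj fun j => ?_
  by_cases hj : j ∈ Finset.Icc 1 H.step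
  · have h := congrArg (H.proj j) hx
    have hp : ∀ i ∈ Finset.Icc 1 H.step, H.proj j (H.proj i x) = if i = j then H.proj j x else 0 := by
      intro i _
      rw [H.proj_of_mem (H.proj_mem i x)]
      split_ifs with h1 h2 h2
      · rw [h1]
      · exact absurd h1.symm h2
      · exact absurd h2.symm h1
      · rfl
    simp only [degreeDeriv, LinearMap.sum_apply, LinearMap.smul_apply, map_sum, map_smul,
      map_zero] at h
    rw [Finset.sum_congr rfl fun i hi => by rw [hp i hi]] at h
    simp only [smul_ite, smul_zero, Finset.sum_ite_eq'] at h
    rw [if_pos hj] at h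
    have hj0 : (j : ℝ) ≠ 0 := by have := (Finset.mem_Icc.mp hj).1; positivity
    rw [map_zero]
    exact (smul_eq_zero.mp h).resolve_left hj0
  · rw [H.proj_eq_zero hj, H.proj_eq_zero hj]

/-- The adjoint representation of `M` on `M ⋊ ℝ`, where `ℝ` acts by the degree derivation. It is
faithful and nilpotent. -/
noncomputable def faithfulRep (x : M) : Module.End ℝ (M × ℝ) where
  toFun p := (⁅x, p.1⁆ + p.2 • H.degreeDeriv x, 0)
  map_add' p q := by
    ext
    · simp only [Prod.fst_add, lie_add, Prod.snd_add, add_smul]; abel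
    · simp
  map_smul' c p := by ext <;> simp [mul_smul]

@[simp] theorem faithfulRep_apply (x : M) (p : M × ℝ) :
    H.faithfulRep x p = (⁅x, p.1⁆ + p.2 • H.degreeDeriv x, 0) := rfl

theorem faithfulRep_add (x y : M) :
    H.faithfulRep (x + y) = H.faithfulRep x + H.faithfulRep y := by
  refine LinearMap.ext fun p => ?_
  simp only [faithfulRep_apply, LinearMap.add_apply, add_lie, map_add, smul_add, Prod.mk_add_mk,
    add_zero]
  congr 1; abel

theorem faithfulRep_smul (c : ℝ) (x : M) : H.faithfulRep (c • x) = c • H.faithfulRep x := by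
  refine LinearMap.ext fun p => ?_
  simp [smul_comm p.2 c]

theorem faithfulRep_zero : H.faithfulRep 0 = 0 := by
  have := H.faithfulRep_smul 0 0
  simpa using this

theorem faithfulRep_sum {ι : Type*} (s : Finset ι) (g : ι → M) :
    H.faithfulRep (∑ i ∈ s, g i) = ∑ i ∈ s, H.faithfulRep (g i) :=
  map_sum (AddMonoidHom.mk' H.faithfulRep H.faithfulRep_add) g s

attribute [local instance] LieRing.ofAssociativeRing

theorem faithfulRep_lie (x y : M) :
    H.faithfulRep ⁅x, y⁆ = ⁅H.faithfulRep x, H.faithfulRep y⁆ := by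
  refine LinearMap.ext fun p => ?_
  rw [Ring.lie_def, LinearMap.sub_apply, Module.End.mul_apply, Module.End.mul_apply]
  simp only [faithfulRep_apply, lie_add, lie_smul, zero_smul, add_zero, degreeDeriv_lie, smul_add,
    Prod.mk_sub_mk, sub_zero, lie_lie]
  rw [← lie_skew y (H.degreeDeriv x)]
  congr 1
  simp only [smul_neg]
  abel

theorem faithfulRep_injective : Function.Injective H.faithfulRep := by
  intro x y hxy
  have := congrArg (fun T : Module.End ℝ (M × ℝ) => (T (0, 1)).1) hxy
  simp only [faithfulRep_apply, lie_zero, one_smul, zero_add] at this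
  exact H.degreeDeriv_injective this

/-- The filtration of `M × ℝ` by degree. -/
def repFiltration (k : ℕ) : Set (M × ℝ) := {p | p.1 ∈ H.tail k ∧ (1 ≤ k → p.2 = 0)}

/-- The operators on `M × ℝ` raising the filtration. -/
def raisingOps (n : ℕ) : Submodule ℝ (Module.End ℝ (M × ℝ)) where
  carrier := {T | ∀ k, ∀ p ∈ H.repFiltration k, T p ∈ H.repFiltration (k + n)}
  add_mem' := fun {S T} hS hT k p hp => ⟨(H.tail _).add_mem (hS k p hp).1 (hT k p hp).1, fun h => by
    rw [LinearMap.add_apply, Prod.snd_add, (hS k p hp).2 h, (hT k p hp).2 h, add_zero]⟩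
  zero_mem' := fun k p _ => ⟨(H.tail _).zero_mem, fun _ => rfl⟩
  smul_mem' := fun c T hT k p hp => ⟨(H.tail _).smul_mem c (hT k p hp).1, fun h => by
    rw [LinearMap.smul_apply, Prod.smul_snd, (hT k p hp).2 h, smul_zero]⟩

theorem raisingOps_mul (m n : ℕ) : H.raisingOps m * H.raisingOps n ≤ H.raisingOps (m + n) := by
  rw [Submodule.mul_le]
  intro S hS T hT k p hp
  have := hS _ _ (hT k p hp)
  rwa [add_assoc, add_comm n m] at this

theorem raisingOps_one_mul_le : H.raisingOps 1 * H.raisingOps 1 ≤ H.raisingOps 1 := by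
  refine (H.raisingOps_mul 1 1).trans fun T hT k p hp => ?_
  have := hT k p hp
  exact ⟨H.tail_antitone (by omega) this.1, fun _ => this.2 (by omega)⟩

/-- Level 0 of the filtration is the whole space and level `step + 1` is zero. -/
theorem raisingOps_pow : H.raisingOps 1 ^ (H.step + 1) = ⊥ := by
  have key : ∀ n, H.raisingOps 1 ^ (n + 1) ≤ H.raisingOps (n + 1) := by
    intro n
    induction n with
    | zero => simp
    | succ n ih => exact (mul_le_mul' ih le_rfl).trans (H.raisingOps_mul (n + 1) 1)
  rw [eq_bot_iff]
  intro T hT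
  rw [Submodule.mem_bot]
  refine LinearMap.ext fun p => ?_
  have h := key _ hT 0 p ⟨H.mem_tail.mpr fun i hi => absurd hi (by omega), fun h => absurd h (by omega)⟩
  exact Prod.ext (H.tail_eq_bot (by omega) h.1) (h.2 (by omega))

theorem faithfulRep_mem (x : M) : H.faithfulRep x ∈ H.raisingOps 1 := by
  intro k p hp
  refine ⟨?_, fun _ => rfl⟩
  rcases k with _ | k
  · exact H.mem_tail_one _
  · rw [faithfulRep_apply, hp.2 (by omega), zero_smul, add_zero]
    exact H.lie_mem_tail_succ x hp.1

theorem faithfulRep_foldl (l : List M) (u : M) :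
    H.faithfulRep (l.foldl (fun u v => ⁅u, v⁆) u) =
      (l.map H.faithfulRep).foldl (fun u v => ⁅u, v⁆) (H.faithfulRep u) := by
  induction l generalizing u with
  | nil => rfl
  | cons a l ih => rw [List.foldl_cons, ih, faithfulRep_lie]; rfl

theorem faithfulRep_dynkin (m : ℕ) (x y : M) :
    H.faithfulRep (dynkin m x y) = lieDynkin m (H.faithfulRep x) (H.faithfulRep y) := by
  rw [dynkin, faithfulRep_sum, lieDynkin]
  refine Finset.sum_congr rfl fun k _ => ?_
  rw [faithfulRep_sum]
  refine Finset.sum_congr rfl fun e _ => ?_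
  rw [faithfulRep_smul]
  congr 1
  have h : exponentWord e (H.faithfulRep x) (H.faithfulRep y) =
      (dynkinWord e x y).map H.faithfulRep := (map_exponentWord _ e x y).symm
  rw [h]
  cases dynkinWord e x y with
  | nil => exact H.faithfulRep_zero
  | cons a l => exact H.faithfulRep_foldl l a

theorem dynkin_one (x y : M) : dynkin 1 x y = x + y := by
  have h : dynkinIndex 1 1 = {fun _ => (1, 0), fun _ => (0, 1)} := by decide
  rw [dynkin, Finset.Icc_self, Finset.sum_singleton, h, Finset.sum_pair]
  · simp [dynkinWord, leftNormed]
  · intro h; simpa using congrFun h 0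

theorem dynkin_two (x y : M) : dynkin 2 x y = (2 : ℝ)⁻¹ • ⁅x, y⁆ := by
  have h1 : dynkinIndex 2 1 = {fun _ => (2, 0), fun _ => (1, 1), fun _ => (0, 2)} := by decide
  have h2 : dynkinIndex 2 2 = {![(1, 0), (1, 0)], ![(1, 0), (0, 1)], ![(0, 1), (1, 0)],
    ![(0, 1), (0, 1)]} := by decide
  have h3 : Finset.Icc 1 2 = {1, 2} := by decide
  rw [dynkin, h3, Finset.sum_pair (by norm_num), h1, h2, Finset.sum_insert (by decide),
    Finset.sum_pair (by decide), Finset.sum_insert (by decide), Finset.sum_insert (by decide),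
    Finset.sum_pair (by decide)]
  simp [dynkinWord, leftNormed, List.ofFn_succ]
  rw [← lie_skew y x]
  module

theorem sum_dynkin {x y : M} : ∑ m ∈ Finset.Icc 1 H.step, dynkin m x y = H.mul x y := by
  rcases Nat.eq_zero_or_pos H.step with h | h
  · have h0 : ∀ z : M, z = 0 := fun z => by rw [← H.sum_proj z, h]; rfl
    rw [h0 (H.mul x y), h0 (∑ m ∈ Finset.Icc 1 H.step, dynkin m x y)]
  · rw [← Finset.add_sum_Ioc_eq_sum_Icc h, dynkin_one, mul]
    rfl

theorem truncExp_faithfulRep_mul (x y : M) :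
    truncExp (2 * H.step) (H.faithfulRep x) * truncExp (2 * H.step) (H.faithfulRep y) =
      truncExp (2 * H.step) (H.faithfulRep (H.mul x y)) := by
  rw [truncExp_mul_truncExp H.raisingOps_one_mul_le H.raisingOps_pow le_rfl (H.faithfulRep_mem x)
    (H.faithfulRep_mem y), ← H.sum_dynkin, faithfulRep_sum]
  simp_rw [faithfulRep_dynkin]

theorem truncExp_faithfulRep_injective :
    Function.Injective fun x => truncExp (2 * H.step) (H.faithfulRep x) := by
  intro x y hxy
  have h : ∀ z, truncLog (2 * H.step) (truncExp (2 * H.step) (H.faithfulRep z) - 1) =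
      H.faithfulRep z := fun z => truncLog_truncExp
    (pow_eq_zero_of_le (by omega) (pow_eq_zero_of_mem H.raisingOps_pow (H.faithfulRep_mem z)))
  apply H.faithfulRep_injective
  rw [← h x, ← h y]
  simp only at hxy
  rw [hxy]

/-- The map `x ↦ exp (faithfulRep x)` is injective and takes `H.mul` to the composition of
operators, which is associative. -/
theorem mul_assoc' (x y z : M) : H.mul (H.mul x y) z = H.mul x (H.mul y z) := by
  apply H.truncExp_faithfulRep_injective
  simp only [← truncExp_faithfulRep_mul, mul_assoc]

end Algebra

end Stratification

end BanachLieAlgebra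

/-! ### Words in two letters and estimates for the Dynkin terms -/

namespace BanachLieAlgebra

section Words

theorem dynkinWord_eq_map {M : Type*} {k : ℕ} (e : Fin k → ℕ × ℕ) (x y : M) :
    dynkinWord e x y = (exponentWord e true false).map fun b => cond b x y :=
  (map_exponentWord (fun b => cond b x y) e true false).symm

variable {M : Type*} [BanachLieAlgebra M]

theorem length_exponentWord_of_mem_dynkinIndex {m k : ℕ} {e : Fin k → ℕ × ℕ}
    (he : e ∈ dynkinIndex m k) : (exponentWord e true false).length = m := by
  rw [length_exponentWord]
  exact (Finset.mem_filter.mp he).2.2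

/-- The value of the left-normed product of a word in two letters. -/
def wordEval (l : List Bool) (x y : M) : M := leftNormed (l.map fun b => cond b x y)

theorem exists_dynkin_eq (m : ℕ) : ∃ (s : Finset (Σ k : ℕ, Fin k → ℕ × ℕ))
    (c : (Σ k : ℕ, Fin k → ℕ × ℕ) → ℝ) (w : (Σ k : ℕ, Fin k → ℕ × ℕ) → List Bool),
    (∀ e ∈ s, (w e).length = m) ∧
      ∀ x y : M, dynkin m x y = ∑ e ∈ s, c e • wordEval (w e) x y := by
  refine ⟨(Finset.Icc 1 m).sigma fun k => dynkinIndex m k,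
    fun e => (-1 : ℝ) ^ (e.1 - 1) / (e.1 : ℝ) *
      ((m : ℝ)⁻¹ / ((∏ i, ((e.2 i).1.factorial * (e.2 i).2.factorial) : ℕ) : ℝ)),
    fun e => exponentWord e.2 true false, ?_, ?_⟩
  · intro e he
    exact length_exponentWord_of_mem_dynkinIndex (Finset.mem_sigma.mp he).2
  · intro x y
    rw [dynkin, Finset.sum_sigma]
    simp only [wordEval, dynkinWord_eq_map]

/-- A class of maps `M → M → M` that is closed under linear combinations and contains the words
of length `m` contains the `m`-th Baker–Campbell–Hausdorff term. -/
theorem dynkin_induction {m : ℕ} {p : (M → M → M) → Prop} (h0 : p fun _ _ => 0)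
    (hadd : ∀ F F', p F → p F' → p fun x y => F x y + F' x y)
    (hsmul : ∀ (c : ℝ) F, p F → p fun x y => c • F x y)
    (hw : ∀ l : List Bool, l.length = m → p (wordEval l)) : p (dynkin m) := by
  obtain ⟨s, c, w, hlen, hsum⟩ := exists_dynkin_eq (M := M) m
  have : (dynkin m : M → M → M) = fun x y => ∑ e ∈ s, c e • wordEval (w e) x y :=
    funext fun x => funext fun y => hsum x y
  rw [this]
  clear this hsum
  induction s using Finset.cons_induction with
  | empty => simpa using h0
  | cons a s ha ih =>
    simp only [Finset.sum_cons]
    exact hadd _ _ (hsmul _ _ (hw _ (hlen a (Finset.mem_cons_self a s))))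
      (ih fun e he => hlen e (Finset.mem_cons_of_mem he))

theorem wordEval_concat {l : List Bool} (hl : l ≠ []) (b : Bool) (x y : M) :
    wordEval (l ++ [b]) x y = ⁅wordEval l x y, cond b x y⁆ := by
  cases l with
  | nil => exact absurd rfl hl
  | cons a l => simp [wordEval, leftNormed, List.foldl_append]

/-- A property of words that holds for the words of length `n ≥ 1` and is inherited when a letter
is appended holds for all words of length at least `n`. -/
theorem word_induction {n : ℕ} {p : (M → M → M) → Prop} (hn : 1 ≤ n)
    (hbase : ∀ l : List Bool, l.length = n → p (wordEval l))
    (hstep : ∀ F (b : Bool), p F → p fun x y => ⁅F x y, cond b x y⁆)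
    {l : List Bool} (hl : n ≤ l.length) : p (wordEval l) := by
  induction l using List.reverseRecOn with
  | nil => simp at hl; omega
  | append_singleton l b ih =>
    rw [List.length_append, List.length_singleton] at hl
    rcases Nat.lt_or_ge l.length n with h | h
    · exact hbase _ (by simp; omega)
    · have hne : l ≠ [] := by rintro rfl; simp at h; omega
      have := hstep _ b (ih h)
      have heq : (wordEval (l ++ [b]) : M → M → M) =
          fun x y => ⁅wordEval l x y, cond b x y⁆ :=
        funext fun x => funext fun y => wordEval_concat hne b x y
      rwa [heq]

/-- The four words of length two give `[x, x] = [y, y] = 0`, `[x, y]` and `[y, x]`, whence the three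
base cases. -/
theorem word_induction_two {p : (M → M → M) → Prop} (h0 : p fun _ _ => 0)
    (hxy : p fun x y => ⁅x, y⁆) (hyx : p fun x y => ⁅y, x⁆)
    (hstep : ∀ F (b : Bool), p F → p fun x y => ⁅F x y, cond b x y⁆)
    {l : List Bool} (hl : 2 ≤ l.length) : p (wordEval l) := by
  refine word_induction (n := 2) (by norm_num) ?_ hstep hl
  intro l hl
  have key : ∀ F : M → M → M, p F → (∀ x y, wordEval l x y = F x y) → p (wordEval l) := by
    intro F hF h
    rwa [show (wordEval l : M → M → M) = F from funext fun x => funext fun y => h x y]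
  match l, hl with
  | [true, true], _ => exact key _ h0 fun x y => lie_self x
  | [false, false], _ => exact key _ h0 fun x y => lie_self y
  | [true, false], _ => exact key _ hxy fun x y => rfl
  | [false, true], _ => exact key _ hyx fun x y => rfl

/-- To prove a property of `dynkin m` with `m ≥ 2`, it suffices to prove it for the basic
brackets and to show that it is inherited by linear combinations and further brackets. -/
theorem dynkin_induction_two {m : ℕ} (hm : 2 ≤ m) {p : (M → M → M) → Prop} (h0 : p fun _ _ => 0)
    (hadd : ∀ F F', p F → p F' → p fun x y => F x y + F' x y)
    (hsmul : ∀ (c : ℝ) F, p F → p fun x y => c • F x y)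
    (hxy : p fun x y => ⁅x, y⁆) (hyx : p fun x y => ⁅y, x⁆)
    (hstep : ∀ F (b : Bool), p F → p fun x y => ⁅F x y, cond b x y⁆) : p (dynkin m) :=
  dynkin_induction h0 hadd hsmul fun _ hl => word_induction_two h0 hxy hyx hstep (hl ▸ hm)

theorem dynkin_eq_zero_of_commute {m : ℕ} (hm : 2 ≤ m) {x y : M} (hxy : ⁅x, y⁆ = 0) :
    dynkin m x y = 0 := by
  refine dynkin_induction_two hm (p := fun F => F x y = 0) rfl ?_ ?_ hxy ?_ ?_
  · intro F F' h h'; simp [h, h']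
  · intro c F h; simp [h]
  · change ⁅y, x⁆ = 0
    rw [← lie_skew, hxy, neg_zero]
  · intro F b h; simp [h]

theorem continuous_dynkin (m : ℕ) : Continuous fun p : M × M => dynkin m p.1 p.2 := by
  refine dynkin_induction (p := fun F => Continuous fun p : M × M => F p.1 p.2)
    continuous_const ?_ ?_ ?_
  · intro F F' h h'; exact h.add h'
  · intro c F h; exact h.const_smul c
  · have hc : ∀ b : Bool, Continuous fun p : M × M => cond b p.1 p.2 := by
      rintro (_ | _)
      · exact continuous_snd
      · exact continuous_fst
    intro l _
    rcases Nat.eq_zero_or_pos l.length with h | h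
    · rw [List.length_eq_zero_iff] at h; subst h; exact continuous_const
    · refine word_induction (n := 1) (p := fun F => Continuous fun p : M × M => F p.1 p.2) le_rfl
        ?_ ?_ h
      · intro l hl
        obtain ⟨b, rfl⟩ := List.length_eq_one_iff.mp hl
        exact hc b
      · intro F b hF
        exact BanachLieAlgebra.continuous_lie.comp (hF.prodMk (hc b))

/-- Continuity at the origin bounds the bracket by 1 on vectors of norm `δ / 2`; rescaling both
arguments gives the constant `(2 / δ) ^ 2`. -/
theorem exists_norm_lie_le (M : Type*) [BanachLieAlgebra M] :
    ∃ b : ℝ, 0 ≤ b ∧ ∀ x y : M, ‖⁅x, y⁆‖ ≤ b * ‖x‖ * ‖y‖ := by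
  have h := (BanachLieAlgebra.continuous_lie (M := M)).continuousAt (x := (0, 0))
  rw [Metric.continuousAt_iff] at h
  obtain ⟨δ, hδ, h⟩ := h 1 one_pos
  refine ⟨(2 / δ) ^ 2, by positivity, fun x y => ?_⟩
  rcases eq_or_ne x 0 with rfl | hx
  · simp
  rcases eq_or_ne y 0 with rfl | hy
  · simp
  have hx' : 0 < ‖x‖ := norm_pos_iff.mpr hx
  have hy' : 0 < ‖y‖ := norm_pos_iff.mpr hy
  have hn : ∀ z : M, z ≠ 0 → ‖(δ / 2 / ‖z‖) • z‖ < δ := by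
    intro z hz
    have hz' : 0 < ‖z‖ := norm_pos_iff.mpr hz
    rw [norm_smul, Real.norm_of_nonneg (by positivity), div_mul_cancel₀ _ hz'.ne']
    linarith
  have := h (x := ((δ / 2 / ‖x‖) • x, (δ / 2 / ‖y‖) • y)) (by
    rw [Prod.dist_eq, dist_zero_right, dist_zero_right]
    exact max_lt (hn x hx) (hn y hy))
  rw [zero_lie, dist_zero_right, smul_lie, lie_smul, smul_smul, norm_smul,
    Real.norm_of_nonneg (by positivity)] at this
  have h2 : (2 / δ) ^ 2 * ‖x‖ * ‖y‖ * (δ / 2 / ‖x‖ * (δ / 2 / ‖y‖)) = 1 := by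
    field_simp
  have h3 : 0 < δ / 2 / ‖x‖ * (δ / 2 / ‖y‖) := by positivity
  refine le_of_mul_le_mul_right ?_ h3
  rw [h2, mul_comm]
  exact this.le

/-- Maps `F` with `F p 0 = 0` whose increments are controlled on bounded sets by
`‖p - q‖ ‖u‖ + ‖v - u‖`. -/
def SmallIncrements (F : M → M → M) : Prop :=
  (∀ p, F p 0 = 0) ∧ ∀ R : ℝ, ∃ C : ℝ, 0 ≤ C ∧ ∀ p q v u : M, ‖p‖ ≤ R → ‖q‖ ≤ R → ‖v‖ ≤ R →
    ‖u‖ ≤ R → ‖F p v - F q u‖ ≤ C * (‖p - q‖ * ‖u‖ + ‖v - u‖)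

theorem SmallIncrements.add {F F' : M → M → M} (hF : SmallIncrements F)
    (hF' : SmallIncrements F') : SmallIncrements fun x y => F x y + F' x y := by
  refine ⟨fun p => by simp [hF.1, hF'.1], fun R => ?_⟩
  obtain ⟨C, hC, h⟩ := hF.2 R
  obtain ⟨C', hC', h'⟩ := hF'.2 R
  refine ⟨C + C', by positivity, fun p q v u hp hq hv hu => ?_⟩
  calc ‖F p v + F' p v - (F q u + F' q u)‖ = ‖(F p v - F q u) + (F' p v - F' q u)‖ := by
        congr 1; abel
    _ ≤ _ := norm_add_le _ _
    _ ≤ _ := by rw [add_mul]; exact add_le_add (h p q v u hp hq hv hu) (h' p q v u hp hq hv hu)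

theorem SmallIncrements.const_smul {F : M → M → M} (hF : SmallIncrements F) (c : ℝ) :
    SmallIncrements fun x y => c • F x y := by
  refine ⟨fun p => by simp [hF.1], fun R => ?_⟩
  obtain ⟨C, hC, h⟩ := hF.2 R
  refine ⟨‖c‖ * C, by positivity, fun p q v u hp hq hv hu => ?_⟩
  rw [← smul_sub, norm_smul, mul_assoc]
  exact mul_le_mul_of_nonneg_left (h p q v u hp hq hv hu) (norm_nonneg _)

theorem SmallIncrements.zero : SmallIncrements fun _ _ : M => (0 : M) :=
  ⟨fun _ => rfl, fun _ => ⟨0, le_rfl, fun _ _ _ _ _ _ _ _ => by simp⟩⟩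

theorem SmallIncrements.lie : SmallIncrements fun x y : M => ⁅x, y⁆ := by
  obtain ⟨b, hb, hlie⟩ := exists_norm_lie_le M
  refine ⟨fun p => lie_zero p, fun R => ⟨b * (|R| + 1), by positivity,
    fun p q v u hp hq hv hu => ?_⟩⟩
  have h1 : ⁅p, v⁆ - ⁅q, u⁆ = ⁅p - q, u⁆ + ⁅p, v - u⁆ := by
    rw [sub_lie, lie_sub]; abel
  have hp' : ‖p‖ ≤ |R| := hp.trans (le_abs_self R)
  calc ‖⁅p, v⁆ - ⁅q, u⁆‖ ≤ ‖⁅p - q, u⁆‖ + ‖⁅p, v - u⁆‖ := by rw [h1]; exact norm_add_le _ _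
    _ ≤ b * ‖p - q‖ * ‖u‖ + b * ‖p‖ * ‖v - u‖ := add_le_add (hlie _ _) (hlie _ _)
    _ ≤ b * (|R| + 1) * (‖p - q‖ * ‖u‖) + b * (|R| + 1) * ‖v - u‖ := by
        rw [mul_assoc b ‖p - q‖]
        gcongr
        · exact le_mul_of_one_le_right hb (by linarith [abs_nonneg R])
        · linarith
    _ = _ := by ring

/-- Comparison with `F q 0 = 0` gives `F q u = O(‖u‖)`, so a change of the new letter from `p` to
`q` still carries the factor `‖u‖`. -/
theorem SmallIncrements.lie_letter {F : M → M → M} (hF : SmallIncrements F) (b : Bool) :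
    SmallIncrements fun x y => ⁅F x y, cond b x y⁆ := by
  obtain ⟨β, hβ, hlie⟩ := exists_norm_lie_le M
  refine ⟨fun p => by simp [hF.1], fun R => ?_⟩
  obtain ⟨C, hC, h⟩ := hF.2 R
  refine ⟨β * C * (2 * |R| + 1), by positivity, fun p q v u hp hq hv hu => ?_⟩
  have hR : 0 ≤ R := (norm_nonneg p).trans hp
  rw [abs_of_nonneg hR]
  set D := ‖p - q‖ * ‖u‖ + ‖v - u‖
  have hFu : ‖F q u‖ ≤ C * ‖u‖ := by
    have := h q q u 0 hq hq hu (by simpa using hR)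
    simpa [hF.1] using this
  have hb1 : ‖cond b p v‖ ≤ R := by cases b <;> assumption
  have hb2 : ‖cond b p v - cond b q u‖ ≤ ‖p - q‖ + ‖v - u‖ := by
    cases b
    · simp
    · simp
  have h1 : ⁅F p v, cond b p v⁆ - ⁅F q u, cond b q u⁆ =
      ⁅F p v - F q u, cond b p v⁆ + ⁅F q u, cond b p v - cond b q u⁆ := by
    rw [sub_lie, lie_sub]; abel
  have h2 : ‖u‖ * (‖p - q‖ + ‖v - u‖) ≤ (R + 1) * D := by
    have e1 : ‖u‖ * ‖v - u‖ ≤ R * ‖v - u‖ := by gcongr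
    have e2 : 0 ≤ R * (‖p - q‖ * ‖u‖) := by positivity
    have e3 := norm_nonneg (v - u)
    simp only [D]; nlinarith
  calc ‖⁅F p v, cond b p v⁆ - ⁅F q u, cond b q u⁆‖
      ≤ ‖⁅F p v - F q u, cond b p v⁆‖ + ‖⁅F q u, cond b p v - cond b q u⁆‖ := by
        rw [h1]; exact norm_add_le _ _
    _ ≤ β * ‖F p v - F q u‖ * ‖cond b p v‖ + β * ‖F q u‖ * ‖cond b p v - cond b q u‖ :=
        add_le_add (hlie _ _) (hlie _ _)
    _ ≤ β * (C * D) * R + β * (C * ‖u‖) * (‖p - q‖ + ‖v - u‖) := by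
        gcongr
        exact h p q v u hp hq hv hu
    _ = β * C * (D * R + ‖u‖ * (‖p - q‖ + ‖v - u‖)) := by ring
    _ ≤ β * C * (D * R + (R + 1) * D) := by gcongr
    _ = _ := by ring

theorem SmallIncrements.dynkin {m : ℕ} (hm : 2 ≤ m) :
    SmallIncrements (BanachLieAlgebra.dynkin m : M → M → M) := by
  refine dynkin_induction_two hm .zero (fun F F' => .add) (fun c F h => h.const_smul c) .lie ?_
    (fun F b h => h.lie_letter b)
  have := (SmallIncrements.lie (M := M)).const_smul (-1)
  simpa [lie_skew] using this

end Words

/-! ### The group law and the dilations -/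

namespace Stratification

section Group

variable {M : Type*} [BanachLieAlgebra M] (H : Stratification M)

theorem mul_of_commute {x y : M} (h : ⁅x, y⁆ = 0) : H.mul x y = x + y := by
  rw [mul, Finset.sum_eq_zero, add_zero]
  exact fun m hm => dynkin_eq_zero_of_commute (Finset.mem_Icc.mp hm).1 h

theorem mul_zero' (x : M) : H.mul x 0 = x := by
  rw [H.mul_of_commute (lie_zero x), add_zero]

theorem zero_mul' (x : M) : H.mul 0 x = x := by
  rw [H.mul_of_commute (zero_lie x), zero_add]

theorem neg_mul_self (x : M) : H.mul (-x) x = 0 := by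
  rw [H.mul_of_commute (by simp), neg_add_cancel]

theorem mul_neg_self (x : M) : H.mul x (-x) = 0 := by
  rw [H.mul_of_commute (by simp), add_neg_cancel]

theorem neg_mul_cancel_left' (x y : M) : H.mul (-x) (H.mul x y) = y := by
  rw [← mul_assoc', neg_mul_self, zero_mul']

theorem mul_neg_cancel_left' (x y : M) : H.mul x (H.mul (-x) y) = y := by
  rw [← mul_assoc', mul_neg_self, zero_mul']

theorem smul_mul_smul_self (s t : ℝ) (x : M) : H.mul (s • x) (t • x) = (s + t) • x := by
  rw [H.mul_of_commute (by simp), add_smul]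

theorem continuous_mul : Continuous fun p : M × M => H.mul p.1 p.2 :=
  (continuous_fst.add continuous_snd).add
    (continuous_finsetSum _ fun m _ => continuous_dynkin m)

/-- The old error `‖p - q‖` is multiplied by `1 + C ‖u‖` and not by a fixed Lipschitz constant. Over
`n` factors of size `1 / n` the errors therefore stay under control. -/
theorem exists_norm_mul_sub_mul_le (R : ℝ) : ∃ C : ℝ, 0 ≤ C ∧ ∀ p q v u : M, ‖p‖ ≤ R → ‖q‖ ≤ R →
    ‖v‖ ≤ R → ‖u‖ ≤ R →
    ‖H.mul p v - H.mul q u‖ ≤ ‖p - q‖ + C * (‖p - q‖ * ‖u‖ + ‖v - u‖) := by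
  have hS : SmallIncrements fun x y : M => ∑ m ∈ Finset.Icc 2 H.step, dynkin m x y := by
    have : ∀ s : Finset ℕ, (∀ m ∈ s, 2 ≤ m) →
        SmallIncrements fun x y : M => ∑ m ∈ s, dynkin m x y := by
      intro s
      induction s using Finset.cons_induction with
      | empty => intro _; simpa using SmallIncrements.zero
      | cons a s ha ih =>
        intro hs
        simp only [Finset.sum_cons]
        exact (SmallIncrements.dynkin (hs a (Finset.mem_cons_self a s))).add
          (ih fun m hm => hs m (Finset.mem_cons_of_mem hm))
    exact this _ fun m hm => (Finset.mem_Icc.mp hm).1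
  obtain ⟨C, hC, h⟩ := hS.2 R
  refine ⟨C + 1, by positivity, fun p q v u hp hq hv hu => ?_⟩
  have h1 := h p q v u hp hq hv hu
  have h2 : H.mul p v - H.mul q u = (p - q) + ((v - u) +
      (∑ m ∈ Finset.Icc 2 H.step, dynkin m p v - ∑ m ∈ Finset.Icc 2 H.step, dynkin m q u)) := by
    simp only [mul]; abel
  rw [h2]
  refine (norm_add_le _ _).trans (add_le_add le_rfl ((norm_add_le _ _).trans ?_))
  have : 0 ≤ ‖p - q‖ * ‖u‖ := by positivity
  nlinarith

theorem mul_sub_add_mem_tail_two (x y : M) : H.mul x y - (x + y) ∈ H.tail 2 := by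
  rw [mul, add_sub_cancel_left]
  refine Submodule.sum_mem _ fun m hm => ?_
  refine dynkin_induction_two (Finset.mem_Icc.mp hm).1 (p := fun F => F x y ∈ H.tail 2)
    (Submodule.zero_mem _) ?_ ?_ (H.lie_mem_tail_two _ _) (H.lie_mem_tail_two _ _)
    (fun F b _ => H.lie_mem_tail_two _ _)
  · intro F F' h h'; exact Submodule.add_mem _ h h'
  · intro c F h; exact Submodule.smul_mem _ c h

theorem proj_one_mul (x y : M) : H.proj 1 (H.mul x y) = H.proj 1 x + H.proj 1 y := by
  have := H.mem_tail.mp (H.mul_sub_add_mem_tail_two x y) 1 (by norm_num)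
  rwa [map_sub, map_add, sub_eq_zero] at this

/-- Modulo higher layers, the product is additive in elements of the `k`-th tail. -/
theorem mul_sub_mul_mem_tail {k : ℕ} {p q p' q' : M} (hp : p' - p ∈ H.tail k)
    (hq : q' - q ∈ H.tail k) :
    H.mul p' q' - H.mul p q - ((p' - p) + (q' - q)) ∈ H.tail (k + 1) := by
  have h1 : H.mul p' q' - H.mul p q - ((p' - p) + (q' - q)) =
      ∑ m ∈ Finset.Icc 2 H.step, (dynkin m p' q' - dynkin m p q) := by
    rw [Finset.sum_sub_distrib]; simp only [mul]; abel
  have hl : ∀ a b a' b' : M, a' - a ∈ H.tail k → b' - b ∈ H.tail k →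
      ⁅a', b'⁆ - ⁅a, b⁆ ∈ H.tail (k + 1) := by
    intro a b a' b' ha hb
    have : ⁅a', b'⁆ - ⁅a, b⁆ = ⁅a', b' - b⁆ - ⁅b, a' - a⁆ := by
      rw [lie_sub, lie_sub, ← lie_skew a' b, ← lie_skew a b]; abel
    rw [this]
    exact Submodule.sub_mem _ (H.lie_mem_tail_succ _ hb) (H.lie_mem_tail_succ _ ha)
  rw [h1]
  refine Submodule.sum_mem _ fun m hm => ?_
  refine dynkin_induction_two (Finset.mem_Icc.mp hm).1
    (p := fun F => F p' q' - F p q ∈ H.tail (k + 1)) (by simp) ?_ ?_ (hl _ _ _ _ hp hq)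
    (hl _ _ _ _ hq hp) ?_
  · intro F F' h h'
    have := Submodule.add_mem _ h h'
    rwa [sub_add_sub_comm] at this
  · intro c F h
    have := Submodule.smul_mem _ c h
    rwa [smul_sub] at this
  · intro F b h
    refine hl _ _ _ _ (H.tail_antitone (by omega) h) ?_
    cases b
    · exact hq
    · exact hp

/-- The product up to terms of third order. -/
theorem mul_sub_mem_tail_add_two {k : ℕ} {x p : M} (h : ⁅x, p⁆ ∈ H.tail (k + 1)) :
    H.mul x p - (x + p + (2 : ℝ)⁻¹ • ⁅x, p⁆) ∈ H.tail (k + 2) := by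
  have hs : ⁅p, x⁆ ∈ H.tail (k + 1) := by
    rw [← lie_skew]; exact Submodule.neg_mem _ h
  rcases Nat.lt_or_ge H.step 2 with h2 | h2
  · have h0 : ⁅x, p⁆ = 0 := by
      exact H.tail_eq_bot h2 (H.lie_mem_tail_two x p)
    rw [H.mul_of_commute h0, h0]; simp
  rw [mul, ← Finset.add_sum_Ioc_eq_sum_Icc h2, dynkin_two]
  have h3 : ∑ m ∈ Finset.Ioc 2 H.step, dynkin m x p ∈ H.tail (k + 2) := by
    refine Submodule.sum_mem _ fun m hm => ?_
    have hm3 : 3 ≤ m := (Finset.mem_Ioc.mp hm).1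
    refine dynkin_induction (p := fun F => F x p ∈ H.tail (k + 2)) (Submodule.zero_mem _) ?_ ?_ ?_
    · intro F F' h h'; exact Submodule.add_mem _ h h'
    · intro c F h; exact Submodule.smul_mem _ c h
    · intro l hl
      have hlie : ∀ a b : M, a ∈ H.tail (k + 1) → ⁅a, b⁆ ∈ H.tail (k + 2) := fun a b ha => by
        rw [← lie_skew]; exact Submodule.neg_mem _ (H.lie_mem_tail_succ b ha)
      refine word_induction (n := 3) (p := fun F => F x p ∈ H.tail (k + 2)) (by norm_num) ?_ ?_
        (hl ▸ hm3)
      · intro l hl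
        obtain ⟨l', b, rfl⟩ : ∃ l' b, l = l' ++ [b] :=
          ⟨l.dropLast, l.getLast (by rintro rfl; simp at hl), (List.dropLast_append_getLast _).symm⟩
        have hl' : l'.length = 2 := by simpa using hl
        rw [wordEval_concat (by rintro rfl; simp at hl')]
        refine hlie _ _ ?_
        refine word_induction_two (p := fun F => F x p ∈ H.tail (k + 1)) (Submodule.zero_mem _) h
          hs ?_ hl'.ge
        intro F b hF
        exact H.tail_antitone (by omega) (hlie _ _ hF)
      · intro F b hF
        exact hlie _ _ (H.tail_antitone (by omega) hF)
  convert h3 using 1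
  abel

/-- The group structure of a Banach homogeneous group. -/
@[reducible] noncomputable def group : Group M where
  mul := H.mul
  mul_assoc := H.mul_assoc'
  one := 0
  one_mul := H.zero_mul'
  mul_one := H.mul_zero'
  inv x := -x
  inv_mul_cancel := H.neg_mul_self

/-- The dilation as a linear map. -/
noncomputable def dilₗ (r : ℝ) : M →ₗ[ℝ] M := ∑ i ∈ Finset.Icc 1 H.step, r ^ i • H.proj i

theorem dilₗ_apply (r : ℝ) (x : M) : H.dilₗ r x = H.dil r x := by
  simp [dilₗ, dil]

theorem dil_of_mem {j : ℕ} {x : M} (hx : x ∈ H.layer j) (r : ℝ) : H.dil r x = r ^ j • x := by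
  by_cases hj : j ∈ Finset.Icc 1 H.step
  · simp only [dil, H.proj_of_mem hx, smul_ite, smul_zero, Finset.sum_ite_eq']
    rw [if_pos hj]
  · rw [H.eq_zero_of_mem_layer hj hx, ← dilₗ_apply]; simp

theorem proj_dil (i : ℕ) (r : ℝ) (x : M) : H.proj i (H.dil r x) = r ^ i • H.proj i x := by
  refine H.layer_induction (p := fun x => H.proj i (H.dil r x) = r ^ i • H.proj i x) ?_ ?_ ?_ x
  · intro x y hx hy
    simp only [← dilₗ_apply] at *
    rw [map_add, map_add, hx, hy, map_add, smul_add]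
  · rw [← dilₗ_apply]; simp
  · intro j x hx
    rw [H.dil_of_mem hx, map_smul, H.proj_of_mem hx]
    split_ifs with h
    · rw [h]
    · simp

theorem dil_dil (r s : ℝ) (x : M) : H.dil r (H.dil s x) = H.dil (r * s) x :=
  H.ext_proj fun i => by rw [proj_dil, proj_dil, proj_dil, smul_smul, mul_pow]

theorem dil_one (x : M) : H.dil 1 x = x :=
  H.ext_proj fun i => by rw [proj_dil, one_pow, one_smul]

theorem dil_zero (r : ℝ) : H.dil r 0 = 0 := by rw [← dilₗ_apply, map_zero]

theorem dil_lie (r : ℝ) (x y : M) : H.dil r ⁅x, y⁆ = ⁅H.dil r x, H.dil r y⁆ := by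
  simp only [← dilₗ_apply]
  refine H.layer_induction (p := fun x => H.dilₗ r ⁅x, y⁆ = ⁅H.dilₗ r x, H.dilₗ r y⁆) ?_ (by simp)
    ?_ x
  · intro x x' hx hx'; rw [add_lie, map_add, hx, hx', map_add, add_lie]
  intro i x hx
  refine H.layer_induction (p := fun y => H.dilₗ r ⁅x, y⁆ = ⁅H.dilₗ r x, H.dilₗ r y⁆) ?_ (by simp)
    ?_ y
  · intro x x' hx hx'; rw [lie_add, map_add, hx, hx', map_add, lie_add]
  intro j y hy
  rw [dilₗ_apply, dilₗ_apply, dilₗ_apply, H.dil_of_mem (H.lie_mem i j x hx y hy), H.dil_of_mem hx,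
    H.dil_of_mem hy, smul_lie, lie_smul, smul_smul, pow_add]

theorem dil_mul (r : ℝ) (x y : M) : H.dil r (H.mul x y) = H.mul (H.dil r x) (H.dil r y) := by
  simp only [mul, ← dilₗ_apply, map_add, map_sum]
  congr 1
  refine Finset.sum_congr rfl fun m hm => ?_
  refine dynkin_induction_two (Finset.mem_Icc.mp hm).1
    (p := fun F => H.dilₗ r (F x y) = F (H.dilₗ r x) (H.dilₗ r y)) (map_zero _) ?_ ?_ ?_ ?_ ?_
  · intro F F' h h'; rw [map_add, h, h']
  · intro c F h; rw [map_smul, h]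
  · simp only [dilₗ_apply, dil_lie]
  · simp only [dilₗ_apply, dil_lie]
  · intro F b h
    rw [dilₗ_apply, dil_lie, ← dilₗ_apply, h, ← dilₗ_apply]
    cases b <;> rfl

end Group

end Stratification

end BanachLieAlgebra

/-! ### Differentiability of Lipschitz curves from their first layer -/

namespace BanachLieAlgebra

namespace Stratification

section Curves

variable {M : Type*} [BanachLieAlgebra M] {H : Stratification M} {σ : ℕ → ℝ≥0}

theorem hnorm_nonneg (x : M) : 0 ≤ H.hnorm σ x := NNReal.coe_nonneg _

theorem norm_proj_le (hσ : H.IsHomogeneousNorm σ) {i : ℕ} (hi : i ∈ Finset.Icc 1 H.step) (x : M) :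
    ‖H.proj i x‖ ≤ (H.hnorm σ x / σ i) ^ i := by
  have hi' := Finset.mem_Icc.mp hi
  have hpos : 0 < σ i := hσ.pos i hi'.1 hi'.2
  have h1 : σ i * ‖H.proj i x‖₊ ^ (1 / (i : ℝ)) ≤
      (Finset.Icc 1 H.step).sup fun i => σ i * ‖H.proj i x‖₊ ^ (1 / (i : ℝ)) :=
    Finset.le_sup (f := fun i => σ i * ‖H.proj i x‖₊ ^ (1 / (i : ℝ))) hi
  have h2 : ‖H.proj i x‖₊ ^ (1 / (i : ℝ)) ≤
      ((Finset.Icc 1 H.step).sup fun i => σ i * ‖H.proj i x‖₊ ^ (1 / (i : ℝ))) / σ i := by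
    rw [le_div_iff₀ hpos, mul_comm]; exact h1
  have h3 := pow_le_pow_left₀ (zero_le) h2 i
  rw [one_div, NNReal.rpow_inv_natCast_pow _ (by omega)] at h3
  exact_mod_cast h3

theorem norm_proj_dil_le (hσ : H.IsHomogeneousNorm σ) {i : ℕ} (hi : i ∈ Finset.Icc 1 H.step)
    {r a : ℝ} (hr : 0 ≤ r) {x : M} (ha : r * H.hnorm σ x ≤ a) :
    ‖H.proj i (H.dil r x)‖ ≤ a ^ i * (1 / (σ i : ℝ)) ^ i := by
  have hx : 0 ≤ H.hnorm σ x := hnorm_nonneg x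
  rw [proj_dil, norm_smul, norm_pow, Real.norm_of_nonneg hr]
  calc r ^ i * ‖H.proj i x‖ ≤ r ^ i * (H.hnorm σ x / σ i) ^ i := by
        gcongr; exact norm_proj_le hσ hi x
    _ = (r * H.hnorm σ x) ^ i * (1 / (σ i : ℝ)) ^ i := by
        rw [← mul_pow, ← mul_pow]; congr 1; ring
    _ ≤ _ := by gcongr

/-- The constant comparing the norm of `M` with its homogeneous norm. -/
noncomputable def normConst (H : Stratification M) (σ : ℕ → ℝ≥0) : ℝ :=
  ∑ i ∈ Finset.Icc 1 H.step, (1 / (σ i : ℝ)) ^ i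

theorem normConst_nonneg : 0 ≤ H.normConst σ :=
  Finset.sum_nonneg fun i _ => by positivity

theorem norm_dil_le (hσ : H.IsHomogeneousNorm σ) {r a : ℝ} (hr : 0 ≤ r) {x : M}
    (ha : r * H.hnorm σ x ≤ a) (ha1 : a ≤ 1) : ‖H.dil r x‖ ≤ H.normConst σ * a := by
  have ha0 : 0 ≤ a := (mul_nonneg hr (hnorm_nonneg x)).trans ha
  rw [← H.sum_proj (H.dil r x), normConst, Finset.sum_mul]
  refine (norm_sum_le _ _).trans (Finset.sum_le_sum fun i hi => ?_)
  refine (norm_proj_dil_le hσ hi hr ha).trans ?_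
  rw [mul_comm]
  gcongr
  exact pow_le_of_le_one ha0 ha1 (by have := (Finset.mem_Icc.mp hi).1; omega)

theorem exists_norm_dil_le (hσ : H.IsHomogeneousNorm σ) (a : ℝ) : ∃ R : ℝ, 0 ≤ R ∧
    ∀ (r : ℝ) (x : M), 0 ≤ r → r * H.hnorm σ x ≤ a → ‖H.dil r x‖ ≤ R := by
  refine ⟨∑ i ∈ Finset.Icc 1 H.step, |a| ^ i * (1 / (σ i : ℝ)) ^ i,
    Finset.sum_nonneg fun i _ => by positivity, fun r x hr ha => ?_⟩
  rw [← H.sum_proj (H.dil r x)]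
  exact (norm_sum_le _ _).trans (Finset.sum_le_sum fun i hi =>
    norm_proj_dil_le hσ hi hr (ha.trans (le_abs_self a)))

theorem sub_proj_one (x : M) : x - H.proj 1 x = ∑ i ∈ Finset.Icc 2 H.step, H.proj i x := by
  rcases Nat.eq_zero_or_pos H.step with h | h
  · have h0 : ∀ z : M, z = 0 := fun z => by rw [← H.sum_proj z, h]; rfl
    rw [h0 (x - H.proj 1 x), h0 (∑ i ∈ Finset.Icc 2 H.step, H.proj i x)]
  · have hx : H.proj 1 x + ∑ i ∈ Finset.Icc 2 H.step, H.proj i x = x :=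
      (Finset.add_sum_Ioc_eq_sum_Icc (f := fun i => H.proj i x) h).trans (H.sum_proj x)
    rw [sub_eq_iff_eq_add', hx]

/-- The layer `i` contributes `O(a ^ i)` with `i ≥ 2`. This quadratic gain is why the first layer
alone decides differentiability. -/
theorem norm_dil_sub_proj_one_le (hσ : H.IsHomogeneousNorm σ) {r a : ℝ} (hr : 0 ≤ r) {x : M}
    (ha : r * H.hnorm σ x ≤ a) (ha1 : a ≤ 1) :
    ‖H.dil r x - H.proj 1 (H.dil r x)‖ ≤ H.normConst σ * a ^ 2 := by
  have ha0 : 0 ≤ a := (mul_nonneg hr (hnorm_nonneg x)).trans ha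
  rw [sub_proj_one, normConst, Finset.sum_mul]
  refine (norm_sum_le _ _).trans ?_
  refine (Finset.sum_le_sum (g := fun i => (1 / (σ i : ℝ)) ^ i * a ^ 2) fun i hi => ?_).trans
    (Finset.sum_le_sum_of_subset_of_nonneg (Finset.Icc_subset_Icc_left (by norm_num))
      fun i _ _ => by positivity)
  have hi' := Finset.mem_Icc.mp hi
  refine (norm_proj_dil_le hσ (Finset.mem_Icc.mpr ⟨by omega, hi'.2⟩) hr ha).trans ?_
  rw [mul_comm]
  gcongr ?_ * ?_
  exact pow_le_pow_of_le_one ha0 ha1 hi'.1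

/-- A product of `n` factors that are close to `w / n` is close to `w`. -/
theorem exists_norm_prod_sub_le (H : Stratification M) (R D : ℝ) (hD : 0 ≤ D) {w : M}
    (hw : ‖w‖ ≤ R) :
    ∃ C : ℝ, ∀ n : ℕ, 1 ≤ n → ∀ p v : ℕ → M, p 0 = 0 →
      (∀ j < n, p (j + 1) = H.mul (p j) (v j)) → (∀ j ≤ n, ‖p j‖ ≤ R) → (∀ j < n, ‖v j‖ ≤ R) →
      (∀ j < n, ‖v j - (n : ℝ)⁻¹ • w‖ ≤ D / n ^ 2) → ‖p n - w‖ ≤ C / n := by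
  obtain ⟨C, hC, h⟩ := H.exists_norm_mul_sub_mul_le R
  have hR : 0 ≤ R := (norm_nonneg w).trans hw
  refine ⟨C * D * Real.exp (C * R), fun n hn p v hp0 hp hpR hvR hv => ?_⟩
  have hn0 : (0 : ℝ) < n := by exact_mod_cast hn
  set a := C * R / n
  set b := C * (D / n ^ 2)
  have ha : 0 ≤ a := by positivity
  have hb : 0 ≤ b := by positivity
  -- Discrete Gronwall argument, comparing with the one-parameter subgroup through `w`: each factor
  -- multiplies the error by `1 + C R / n` and adds `C D / n²`.
  have key : ∀ j ≤ n, ‖p j - ((j : ℝ) / n) • w‖ ≤ j * b * (1 + a) ^ j := by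
    intro j
    induction j with
    | zero => intro _; simp [hp0]
    | succ j ih =>
      intro hj
      have hj' : j < n := hj
      have ih := ih hj'.le
      set e := ‖p j - ((j : ℝ) / n) • w‖
      have h1 : (((j + 1 : ℕ) : ℝ) / n) • w = H.mul (((j : ℝ) / n) • w) ((n : ℝ)⁻¹ • w) := by
        rw [smul_mul_smul_self]; congr 1; push_cast; field_simp
      have hjn : (j : ℝ) / n ≤ 1 := by
        rw [div_le_one hn0]; exact_mod_cast hj'.le
      have hqR : ‖((j : ℝ) / n) • w‖ ≤ R := by
        rw [norm_smul, Real.norm_of_nonneg (by positivity)]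
        exact (mul_le_of_le_one_left (norm_nonneg _) hjn).trans hw
      have huw : ‖(n : ℝ)⁻¹ • w‖ ≤ R / n := by
        rw [norm_smul, Real.norm_of_nonneg (by positivity), div_eq_inv_mul]
        gcongr
      have huR : ‖(n : ℝ)⁻¹ • w‖ ≤ R :=
        huw.trans (div_le_self hR (by exact_mod_cast hn))
      have h2 := h (p j) (((j : ℝ) / n) • w) (v j) ((n : ℝ)⁻¹ • w) (hpR j hj'.le) hqR (hvR j hj') huR
      rw [← hp j hj', ← h1] at h2
      calc _ ≤ e + C * (e * ‖(n : ℝ)⁻¹ • w‖ + ‖v j - (n : ℝ)⁻¹ • w‖) := h2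
        _ ≤ e + C * (e * (R / n) + D / n ^ 2) := by
            gcongr
            exact hv j hj'
        _ = e * (1 + a) + b := by simp only [a, b]; ring
        _ ≤ (j * b * (1 + a) ^ j) * (1 + a) + b * (1 + a) ^ (j + 1) := by
            refine add_le_add (by gcongr) (le_mul_of_one_le_right hb ?_)
            exact one_le_pow₀ (by linarith)
        _ = _ := by push_cast; ring
  have h1 := key n le_rfl
  rw [div_self hn0.ne', one_smul] at h1
  refine h1.trans ?_
  have h2 : (1 + a) ^ n ≤ Real.exp (C * R) := by
    have : 1 + a ≤ Real.exp a := by rw [add_comm]; exact Real.add_one_le_exp a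
    calc (1 + a) ^ n ≤ Real.exp a ^ n := by gcongr
      _ = Real.exp (C * R) := by rw [← Real.exp_nat_mul]; congr 1; simp only [a]; field_simp
  calc n * b * (1 + a) ^ n ≤ n * b * Real.exp (C * R) := by gcongr
    _ = _ := by simp only [b]; field_simp

/-- The quotient equals `θ t / t`, which tends to 1, times the difference quotient at `θ t`. -/
theorem tendsto_comp_approx {X : Type*} [NormedAddCommGroup X] [NormedSpace ℝ X] {γ : ℝ → X}
    {E : Set ℝ} {w : X}
    (hw : Tendsto (fun h => h⁻¹ • (γ h - γ 0)) (𝓝[>] 0 ⊓ 𝓟 E) (𝓝 w))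
    {θ : ℝ → ℝ} (hθE : ∀ t, 0 < t → θ t ∈ E)
    (hθ : Tendsto (fun t => θ t / t) (𝓝[>] 0) (𝓝 1)) :
    Tendsto (fun t => t⁻¹ • (γ (θ t) - γ 0)) (𝓝[>] 0) (𝓝 w) := by
  have hpos : ∀ᶠ t in 𝓝[>] (0 : ℝ), 0 < t := eventually_mem_nhdsWithin
  have h1 : ∀ᶠ t in 𝓝[>] (0 : ℝ), 0 < θ t := by
    filter_upwards [hpos, hθ.eventually (lt_mem_nhds one_pos)] with t ht h
    have := mul_pos h ht
    rwa [div_mul_cancel₀ _ ht.ne'] at this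
  have h0 : Tendsto θ (𝓝[>] 0) (𝓝 0) := by
    have := hθ.mul (tendsto_id.mono_left (nhdsWithin_le_nhds (s := Ioi (0 : ℝ)) (a := 0)))
    rw [mul_zero] at this
    refine this.congr' ?_
    filter_upwards [hpos] with t ht
    simp [div_mul_cancel₀ _ ht.ne']
  have h2 : Tendsto θ (𝓝[>] 0) (𝓝[>] 0 ⊓ 𝓟 E) := by
    refine tendsto_inf.mpr ⟨tendsto_nhdsWithin_iff.mpr ⟨h0, h1⟩, tendsto_principal.mpr ?_⟩
    filter_upwards [hpos] with t ht using hθE t ht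
  have h3 := hθ.smul (hw.comp h2)
  rw [one_smul] at h3
  refine h3.congr' ?_
  filter_upwards [hpos, h1] with t ht h
  simp only [Function.comp_apply, smul_smul]
  congr 1
  field_simp

/-- A Lipschitz curve into a Banach homogeneous group, defined on a set of parameters that is
dense at `0` to first order, is differentiable at `0` if its first layer is. -/
theorem tendsto_dil_of_tendsto_proj_one (hσ : H.IsHomogeneousNorm σ) {Γ : ℝ → M} {E : Set ℝ}
    (h0E : (0 : ℝ) ∈ E) {L : ℝ} (hL : 0 ≤ L)
    (hΓ : ∀ a ∈ E, ∀ b ∈ E, H.hdist σ (Γ a) (Γ b) ≤ L * |a - b|) {w : M}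
    (hw : Tendsto (fun h => h⁻¹ • (H.proj 1 (Γ h) - H.proj 1 (Γ 0))) (𝓝[>] 0 ⊓ 𝓟 E) (𝓝 w))
    {θ : ℝ → ℝ} (hθE : ∀ t, 0 < t → θ t ∈ E)
    (hθ : Tendsto (fun t => θ t / t) (𝓝[>] 0) (𝓝 1)) :
    Tendsto (fun t => H.dil (1 / t) (H.mul (-Γ 0) (Γ (θ t)))) (𝓝[>] 0) (𝓝 w) := by
  have hpos : ∀ᶠ t in 𝓝[>] (0 : ℝ), 0 < t := eventually_mem_nhdsWithin
  set γ : ℝ → M := fun h => H.proj 1 (Γ h)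
  -- The value 0 at `t = 0` makes the first partition point the base point itself; `θ` is
  -- unconstrained there.
  set τ : ℝ → ℝ := fun t => if 0 < t then θ t else 0 with hτ
  have hτE : ∀ t, τ t ∈ E := fun t => by
    simp only [hτ]; split_ifs with h
    · exact hθE t h
    · exact h0E
  have hg : Tendsto (fun t => t⁻¹ • (γ (τ t) - γ 0)) (𝓝[>] 0) (𝓝 w) := by
    refine (tendsto_comp_approx hw hθE hθ).congr' ?_
    filter_upwards [hpos] with t ht
    simp only [hτ, if_pos ht]
    rfl
  have hτ1 : Tendsto (fun t => τ t / t) (𝓝[>] 0) (𝓝 1) := by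
    refine hθ.congr' ?_
    filter_upwards [hpos] with t ht
    simp only [hτ, if_pos ht]
  have hscale : ∀ c : ℝ, 0 < c → Tendsto (fun t => c * t) (𝓝[>] 0) (𝓝[>] 0) := by
    intro c hc
    refine tendsto_nhdsWithin_iff.mpr ⟨?_, ?_⟩
    · have : Tendsto (fun t : ℝ => c * t) (𝓝 0) (𝓝 (c * 0)) :=
        (continuous_const.mul continuous_id).tendsto 0
      rw [mul_zero] at this
      exact this.mono_left nhdsWithin_le_nhds
    · filter_upwards [hpos] with t ht using mul_pos hc ht
  have hG : ∀ c : ℝ, 0 ≤ c →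
      Tendsto (fun t => t⁻¹ • (γ (τ (c * t)) - γ 0)) (𝓝[>] 0) (𝓝 (c • w)) := by
    intro c hc
    rcases hc.eq_or_lt with rfl | hc
    · simp [hτ]
    · refine ((hg.comp (hscale c hc)).const_smul c).congr' ?_
      filter_upwards [hpos] with t ht
      simp only [Function.comp_apply, smul_smul]
      congr 1
      field_simp
  have hT : ∀ c : ℝ, 0 ≤ c → Tendsto (fun t => τ (c * t) / t) (𝓝[>] 0) (𝓝 c) := by
    intro c hc
    rcases hc.eq_or_lt with rfl | hc
    · simp [hτ]
    · have := (hτ1.comp (hscale c hc)).const_mul c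
      rw [mul_one] at this
      refine this.congr' ?_
      filter_upwards [hpos] with t ht
      simp only [Function.comp_apply]
      field_simp
  obtain ⟨R₁, hR₁, hR⟩ := exists_norm_dil_le hσ (2 * L)
  set R := max R₁ ‖w‖
  -- In `D / n²` the 1 pays for the errors of the first layer at the two ends of a piece, the other
  -- term for the higher layers of an increment of homogeneous norm at most `2 L / n`.
  set D := 1 + H.normConst σ * (2 * L) ^ 2
  have hD : 0 ≤ D := by have := normConst_nonneg (H := H) (σ := σ); positivity
  obtain ⟨C, hC⟩ := H.exists_norm_prod_sub_le R D hD (w := w) (le_max_right _ _)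
  rw [Metric.tendsto_nhds]
  intro ε hε
  obtain ⟨n, hn⟩ := exists_nat_gt (max (C / ε) (max (2 * L) 1))
  have hnC : C / ε < n := (le_max_left _ _).trans_lt hn
  have hnL : 2 * L < n := ((le_max_left _ _).trans (le_max_right _ _)).trans_lt hn
  have hn1 : (1 : ℝ) < n := ((le_max_right _ _).trans (le_max_right _ _)).trans_lt hn
  have hn0 : (0 : ℝ) < n := by linarith
  -- With `n` now fixed, only finitely many limits are needed. The tolerance `1 / (2n)` keeps
  -- rescaled gaps between consecutive points below `2 / n`, and `1 / (2n²)` keeps the first-layer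
  -- increment within `1 / n²` of `w / n`.
  have hev : ∀ᶠ t in 𝓝[>] (0 : ℝ), ∀ j ∈ Finset.range (n + 1),
      ‖t⁻¹ • (γ (τ ((j : ℝ) / n * t)) - γ 0) - ((j : ℝ) / n) • w‖ < 1 / (2 * (n : ℝ) ^ 2) ∧
      |τ ((j : ℝ) / n * t) / t - (j : ℝ) / n| < 1 / (2 * n) := by
    rw [Filter.eventually_all_finset]
    intro j _
    have h1 := Metric.tendsto_nhds.mp (hG ((j : ℝ) / n) (by positivity)) (1 / (2 * (n : ℝ) ^ 2))
      (by positivity)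
    have h2 := Metric.tendsto_nhds.mp (hT ((j : ℝ) / n) (by positivity)) (1 / (2 * n))
      (by positivity)
    filter_upwards [h1, h2] with t h1 h2
    rw [dist_eq_norm] at h1
    rw [Real.dist_eq] at h2
    exact ⟨h1, h2⟩
  filter_upwards [hpos, hev] with t ht hev
  set s : ℕ → ℝ := fun j => τ ((j : ℝ) / n * t)
  have hs0 : s 0 = 0 := by simp [s, hτ]
  have hsn : s n = θ t := by simp [s, hτ, div_self hn0.ne', ht]
  set p : ℕ → M := fun j => H.dil (1 / t) (H.mul (-Γ 0) (Γ (s j)))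
  set v : ℕ → M := fun j => H.dil (1 / t) (H.mul (-Γ (s j)) (Γ (s (j + 1))))
  have hit : 0 ≤ 1 / t := by positivity
  have hscaled : ∀ a ∈ E, ∀ b ∈ E, 1 / t * H.hnorm σ (H.mul (-Γ a) (Γ b)) ≤ L * |a / t - b / t| := by
    intro a ha b hb
    have := hΓ a ha b hb
    rw [hdist] at this
    rw [← sub_div, abs_div, abs_of_pos ht, ← mul_div_assoc, one_div, ← div_eq_inv_mul]
    gcongr
  have hp2 : ∀ j ≤ n, 1 / t * H.hnorm σ (H.mul (-Γ 0) (Γ (s j))) ≤ 2 * L := by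
    intro j hj
    refine (hscaled 0 h0E _ (hτE _)).trans ?_
    have h1 := (hev j (Finset.mem_range.mpr (by omega))).2
    have h2 : (j : ℝ) / n ≤ 1 := by rw [div_le_one hn0]; exact_mod_cast hj
    have h3 : (0 : ℝ) ≤ (j : ℝ) / n := by positivity
    have h4 : 1 / (2 * (n : ℝ)) ≤ 1 := by rw [div_le_one (by positivity)]; linarith
    rw [abs_lt] at h1
    rw [mul_comm 2 L]
    gcongr
    rw [zero_div, zero_sub, abs_neg, abs_le]
    constructor <;> linarith
  have hv2 : ∀ j < n, 1 / t * H.hnorm σ (H.mul (-Γ (s j)) (Γ (s (j + 1)))) ≤ 2 * L / n := by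
    intro j hj
    refine (hscaled _ (hτE _) _ (hτE _)).trans ?_
    have h1 := (hev j (Finset.mem_range.mpr (by omega))).2
    have h2 := (hev (j + 1) (Finset.mem_range.mpr (by omega))).2
    have h3 : ((j + 1 : ℕ) : ℝ) / n = (j : ℝ) / n + 1 / n := by push_cast; ring
    have h4 : 1 / (2 * (n : ℝ)) = 1 / n / 2 := by ring
    rw [show 2 * L / n = L * (2 * (1 / n)) by ring]
    gcongr
    rw [h3] at h2
    rw [h4, abs_lt] at h1 h2
    rw [h3, abs_le]
    constructor <;> linarith
  have hnL1 : 2 * L / n ≤ 1 := by rw [div_le_one hn0]; exact hnL.le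
  have hfin := hC n (by exact_mod_cast hn1.le) p v ?_ ?_ ?_ ?_ ?_
  · have : p n = H.dil (1 / t) (H.mul (-Γ 0) (Γ (θ t))) := by simp only [p, hsn]
    rw [dist_eq_norm, ← this]
    refine hfin.trans_lt ?_
    rw [div_lt_iff₀ hε] at hnC
    rw [div_lt_iff₀ hn0]
    linarith
  · simp only [p, hs0, neg_mul_self, dil_zero]
  · intro j hj
    simp only [p, v]
    rw [← dil_mul, mul_assoc', mul_neg_cancel_left']
  · exact fun j hj => (hR _ _ hit (hp2 j hj)).trans (le_max_left _ _)
  · refine fun j hj => (hR _ _ hit ((hv2 j hj).trans ?_)).trans (le_max_left _ _)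
    exact div_le_self (by positivity) hn1.le
  · intro j hj
    have h1 := (hev j (Finset.mem_range.mpr (by omega))).1
    have h2 := (hev (j + 1) (Finset.mem_range.mpr (by omega))).1
    have h3 := norm_dil_sub_proj_one_le hσ hit (hv2 j hj) hnL1
    have h4 : H.proj 1 (v j) = t⁻¹ • (γ (s (j + 1)) - γ 0) - t⁻¹ • (γ (s j) - γ 0) := by
      simp only [v, proj_dil, proj_one_mul, map_neg, pow_one, one_div, γ, ← smul_sub]
      congr 1; abel
    have h5 : v j - (n : ℝ)⁻¹ • w = (v j - H.proj 1 (v j)) +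
        ((t⁻¹ • (γ (s (j + 1)) - γ 0) - (((j + 1 : ℕ) : ℝ) / n) • w) -
          (t⁻¹ • (γ (s j) - γ 0) - ((j : ℝ) / n) • w)) := by
      have : (((j + 1 : ℕ) : ℝ) / n) • w = ((j : ℝ) / n) • w + (n : ℝ)⁻¹ • w := by
        rw [← add_smul]; congr 1; push_cast; ring
      rw [h4, this]; abel
    rw [h5]
    calc _ ≤ H.normConst σ * (2 * L / n) ^ 2 + (1 / (2 * (n : ℝ) ^ 2) + 1 / (2 * (n : ℝ) ^ 2)) :=
          (norm_add_le _ _).trans (add_le_add h3 ((norm_sub_le _ _).trans (add_le_add h2.le h1.le)))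
      _ = D / n ^ 2 := by simp only [D]; field_simp; ring

end Curves

end Stratification

end BanachLieAlgebra

/-! ### Generation by the first layer and continuity of homogeneous distances -/

namespace BanachLieAlgebra

namespace Stratification

section Generation

variable {G : Type*} [BanachLieAlgebra G] {V : Stratification G}

theorem neg_mul_rev (x y : G) : -V.mul x y = V.mul (-y) (-x) := by
  have h : V.mul (V.mul x y) (V.mul (-y) (-x)) = 0 := by
    rw [mul_assoc', mul_neg_cancel_left', mul_neg_self]
  rw [← V.mul_zero' (-V.mul x y), ← h, neg_mul_cancel_left']

/-- The union of the segments `[-b, b]`, `b ∈ s`. -/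
def segments (s : Finset G) : Set G := insert 0 (⋃ b ∈ s, (fun t : ℝ => t • b) '' Icc (-1) 1)

/-- The `n`-fold products of elements of the segments `[-b, b]`, `b ∈ s`. -/
def segmentProducts (V : Stratification G) (s : Finset G) : ℕ → Set G
  | 0 => {0}
  | n + 1 => (fun p : G × G => V.mul p.1 p.2) '' (segmentProducts V s n ×ˢ segments s)

theorem smul_mem_segments {s : Finset G} {b : G} (hb : b ∈ s) {t : ℝ} (ht : t ∈ Icc (-1 : ℝ) 1) :
    t • b ∈ segments s := Or.inr (mem_iUnion₂.mpr ⟨b, hb, t, ht, rfl⟩)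

theorem neg_mem_segments {s : Finset G} {x : G} (hx : x ∈ segments s) : -x ∈ segments s := by
  rcases hx with rfl | hx
  · rw [neg_zero]; exact Or.inl rfl
  · obtain ⟨b, hb, t, ht, rfl⟩ := mem_iUnion₂.mp hx
    simp only [← neg_smul]
    exact smul_mem_segments hb ⟨by linarith [ht.2], by linarith [ht.1]⟩

theorem isCompact_segments (s : Finset G) : IsCompact (segments s) :=
  (s.isCompact_biUnion fun _ _ => isCompact_Icc.image (by fun_prop)).insert 0

theorem isCompact_segmentProducts (s : Finset G) (n : ℕ) : IsCompact (V.segmentProducts s n) := by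
  induction n with
  | zero => exact isCompact_singleton
  | succ n ih => exact (ih.prod (isCompact_segments s)).image V.continuous_mul

theorem mul_mem_segmentProducts {s : Finset G} {m n : ℕ} {x y : G}
    (hx : x ∈ V.segmentProducts s m) (hy : y ∈ V.segmentProducts s n) :
    V.mul x y ∈ V.segmentProducts s (m + n) := by
  induction n generalizing y with
  | zero => rw [mem_singleton_iff.mp hy, mul_zero']; exact hx
  | succ n ih =>
    obtain ⟨⟨z, k⟩, ⟨hz, hk⟩, rfl⟩ := hy
    exact ⟨(V.mul x z, k), ⟨ih hz, hk⟩, V.mul_assoc' x z k⟩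

theorem segments_subset {s : Finset G} : segments s ⊆ V.segmentProducts s 1 := fun x hx =>
  ⟨(0, x), ⟨rfl, hx⟩, V.zero_mul' x⟩

theorem neg_mem_segmentProducts {s : Finset G} {n : ℕ} {x : G}
    (hx : x ∈ V.segmentProducts s n) : -x ∈ V.segmentProducts s n := by
  induction n generalizing x with
  | zero => rw [mem_singleton_iff.mp hx, neg_zero]; rfl
  | succ n ih =>
    obtain ⟨⟨z, k⟩, ⟨hz, hk⟩, rfl⟩ := hx
    simp only [neg_mul_rev]
    rw [add_comm]
    exact mul_mem_segmentProducts (segments_subset (neg_mem_segments hk)) (ih hz)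

theorem exists_smul_mem_segmentProducts {s : Finset G} {b : G} (hb : b ∈ s) (t : ℝ) :
    ∃ n, t • b ∈ V.segmentProducts s n := by
  obtain ⟨m, hm⟩ := exists_nat_gt |t|
  have hm0 : (0 : ℝ) < m := (abs_nonneg t).trans_lt hm
  have key : ∀ j : ℕ, ((j : ℝ) * (t / m)) • b ∈ V.segmentProducts s j := by
    intro j
    induction j with
    | zero => simp [segmentProducts]
    | succ j ih =>
      refine ⟨(_, (t / m) • b), ⟨ih, smul_mem_segments hb ?_⟩, ?_⟩
      · rw [mem_Icc, ← abs_le, abs_div, abs_of_pos hm0, div_le_one hm0]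
        exact hm.le
      · simp only [smul_mul_smul_self]; congr 1; push_cast; ring
  refine ⟨m, ?_⟩
  have := key m
  rwa [mul_div_cancel₀ _ hm0.ne'] at this

/-- Every layer of a stratified group is reached, modulo higher layers, by products of elements
of lines in the first layer. -/
theorem exists_sub_mem_tail (hV : V.IsStratifiedGroup) {s : Finset G}
    (hs : Submodule.span ℝ (s : Set G) = V.layer 1) {k : ℕ} (hk : 1 ≤ k) {v : G}
    (hv : v ∈ V.layer k) :
    ∃ n, ∃ p ∈ V.segmentProducts s n, p - v ∈ V.tail (k + 1) := by
  have hadd : ∀ k, 1 ≤ k → ∀ v ∈ V.layer k, ∀ w ∈ V.layer k,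
      (∃ n, ∃ p ∈ V.segmentProducts s n, p - v ∈ V.tail (k + 1)) →
      (∃ n, ∃ p ∈ V.segmentProducts s n, p - w ∈ V.tail (k + 1)) →
      ∃ n, ∃ p ∈ V.segmentProducts s n, p - (v + w) ∈ V.tail (k + 1) := by
    rintro k hk v hv w hw ⟨m, p, hp, hpv⟩ ⟨n, q, hq, hqw⟩
    refine ⟨m + n, V.mul p q, mul_mem_segmentProducts hp hq, ?_⟩
    have hk1 : V.tail (k + 1) ≤ V.tail k := V.tail_antitone (by omega)
    have h1 : ∀ p v : G, v ∈ V.layer k → p - v ∈ V.tail (k + 1) → p - 0 ∈ V.tail k := by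
      intro p v hv hpv
      rw [sub_zero, ← sub_add_cancel p v]
      exact Submodule.add_mem _ (hk1 hpv) (V.layer_le_tail le_rfl hv)
    have h2 := V.mul_sub_mul_mem_tail (h1 p v hv hpv) (h1 q w hw hqw)
    rw [mul_zero', sub_zero, sub_zero, sub_zero] at h2
    have : V.mul p q - (v + w) = (V.mul p q - (p + q)) + ((p - v) + (q - w)) := by abel
    rw [this]
    exact Submodule.add_mem _ h2 (Submodule.add_mem _ hpv hqw)
  have hspan : ∀ k, 1 ≤ k → ∀ T : Set G, Submodule.span ℝ T = V.layer k →
      (∀ b ∈ T, ∀ c : ℝ, ∃ n, ∃ p ∈ V.segmentProducts s n, p - c • b ∈ V.tail (k + 1)) →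
      ∀ v ∈ V.layer k, ∃ n, ∃ p ∈ V.segmentProducts s n, p - v ∈ V.tail (k + 1) := by
    intro k hk T hT h v hv
    suffices ∀ c : ℝ, ∃ n, ∃ p ∈ V.segmentProducts s n, p - c • v ∈ V.tail (k + 1) by
      simpa using this 1
    have hv' : v ∈ Submodule.span ℝ T := by rwa [hT]
    induction hv' using Submodule.span_induction with
    | mem b hb => exact h b hb
    | zero =>
      intro c
      exact ⟨0, 0, rfl, by simp⟩
    | add x y hx hy hx' hy' =>
      intro c
      rw [hT] at hx hy
      rw [smul_add]
      exact hadd k hk _ (Submodule.smul_mem _ c hx) _ (Submodule.smul_mem _ c hy)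
        (hx' hx c) (hy' hy c)
    | smul a x hx hx' =>
      intro c
      rw [smul_smul]
      exact hx' (by rwa [hT] at hx) (c * a)
  induction k, hk using Nat.le_induction generalizing v with
  | base =>
    refine hspan 1 le_rfl s hs (fun b hb c => ?_) v hv
    obtain ⟨n, hn⟩ := exists_smul_mem_segmentProducts (V := V) hb c
    exact ⟨n, _, hn, by simp⟩
  | succ k hk ih =>
    refine hspan (k + 1) (by omega) _ (hV.span_lie k hk) ?_ v hv
    rintro _ ⟨x, hx, y, hy, rfl⟩ c
    have hone : ∃ n, ∃ a ∈ V.segmentProducts s n, a - x ∈ V.tail (1 + 1) := by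
      refine hspan 1 le_rfl s hs (fun b hb c => ?_) x hx
      obtain ⟨n, hn⟩ := exists_smul_mem_segmentProducts (V := V) hb c
      exact ⟨n, _, hn, by simp⟩
    obtain ⟨m, a, ha, hax⟩ := hone
    obtain ⟨n, p, hp, hpy⟩ := ih (Submodule.smul_mem _ c hy)
    -- The group commutator `(a p) (p a)⁻¹` realizes `[a, p]`, hence `c [x, y]`, modulo `tail (k +
    -- 2)`: the linear terms of `a p` and `p a` cancel and the halves of the brackets add up.
    refine ⟨_, _, mul_mem_segmentProducts (mul_mem_segmentProducts ha hp)
      (neg_mem_segmentProducts (mul_mem_segmentProducts hp ha)), ?_⟩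
    set u := V.mul a p
    set u' := V.mul p a
    have hpk : p ∈ V.tail k := by
      rw [← sub_add_cancel p (c • y)]
      exact Submodule.add_mem _ (V.tail_antitone (by omega) hpy)
        (V.layer_le_tail le_rfl (Submodule.smul_mem _ c hy))
    have hapk : ⁅a, p⁆ ∈ V.tail (k + 1) := V.lie_mem_tail_succ a hpk
    have hpak : ⁅p, a⁆ ∈ V.tail (k + 1) := by
      rw [← lie_skew]; exact Submodule.neg_mem _ hapk
    have h1 := V.mul_sub_mem_tail_add_two hapk
    have h2 := V.mul_sub_mem_tail_add_two hpak
    have h3 : u - u' - ⁅a, p⁆ ∈ V.tail (k + 2) := by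
      have : u - u' - ⁅a, p⁆ = (u - (a + p + (2 : ℝ)⁻¹ • ⁅a, p⁆)) -
          (u' - (p + a + (2 : ℝ)⁻¹ • ⁅p, a⁆)) := by
        rw [← lie_skew p a]
        module
      rw [this]
      exact Submodule.sub_mem _ h1 h2
    have h4 : ⁅a, p⁆ - c • ⁅x, y⁆ ∈ V.tail (k + 2) := by
      have : ⁅a, p⁆ - c • ⁅x, y⁆ = ⁅a - x, p⁆ + ⁅x, p - c • y⁆ := by
        rw [sub_lie, lie_sub, lie_smul]; abel
      rw [this]
      refine Submodule.add_mem _ ?_ (V.lie_mem_tail_succ x hpy)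
      have := V.lie_mem_tail hax hpk
      rwa [show 1 + 1 + k = k + 2 by ring] at this
    have h5 : u - u' ∈ V.tail (k + 1) := by
      rw [← sub_add_cancel (u - u') ⁅a, p⁆]
      exact Submodule.add_mem _ (V.tail_antitone (by omega) h3) hapk
    have h6 := V.mul_sub_mul_mem_tail (p := u') (p' := u) (q := -u') (q' := -u') h5 (by simp)
    rw [mul_neg_self, sub_zero, sub_self, add_zero] at h6
    have : V.mul u (-u') - c • ⁅x, y⁆ = (V.mul u (-u') - (u - u')) +
        ((u - u' - ⁅a, p⁆) + (⁅a, p⁆ - c • ⁅x, y⁆)) := by abel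
    rw [this]
    exact Submodule.add_mem _ h6 (Submodule.add_mem _ h3 h4)

/-- Descending induction along the tails: an element of `tail k` is corrected on its layer `k` by a
product of segments, and the remaining factor lies in `tail (k + 1)`. -/
theorem iUnion_segmentProducts (hV : V.IsStratifiedGroup) {s : Finset G}
    (hs : Submodule.span ℝ (s : Set G) = V.layer 1) : ⋃ n, V.segmentProducts s n = univ := by
  have key : ∀ j k, k + j = V.step + 1 → 1 ≤ k → ∀ g ∈ V.tail k,
      ∃ n, g ∈ V.segmentProducts s n := by
    intro j
    induction j with
    | zero =>
      intro k hk _ g hg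
      exact ⟨0, V.tail_eq_bot (by omega) hg⟩
    | succ j ih =>
      intro k hk hk1 g hg
      obtain ⟨m, p, hp, hpv⟩ := exists_sub_mem_tail hV hs hk1 (V.proj_mem k g)
      have hgv : g - V.proj k g ∈ V.tail (k + 1) := by
        rw [mem_tail]
        intro i hi
        rw [map_sub]
        rcases Nat.lt_succ_iff_lt_or_eq.mp hi with hi | rfl
        · rw [V.mem_tail.mp hg i hi, V.proj_of_mem_ne (V.proj_mem k g) (by omega), sub_zero]
        · rw [V.proj_of_mem_self (V.proj_mem i g), sub_self]
      have hpk : -p - 0 ∈ V.tail k := by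
        rw [sub_zero, ← sub_add_cancel p (V.proj k g)]
        exact Submodule.neg_mem _ (Submodule.add_mem _ (V.tail_antitone (by omega) hpv)
          (V.layer_le_tail le_rfl (V.proj_mem k g)))
      have h1 := V.mul_sub_mul_mem_tail hpk (q := 0) (q' := g) (by rwa [sub_zero])
      rw [mul_zero', sub_zero, sub_zero, sub_zero] at h1
      have h2 : V.mul (-p) g ∈ V.tail (k + 1) := by
        have : V.mul (-p) g = (V.mul (-p) g - (-p + g)) +
            ((g - V.proj k g) - (p - V.proj k g)) := by abel
        rw [this]
        exact Submodule.add_mem _ h1 (Submodule.sub_mem _ hgv hpv)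
      obtain ⟨n, hn⟩ := ih (k + 1) (by omega) (by omega) _ h2
      refine ⟨m + n, ?_⟩
      have := mul_mem_segmentProducts hp hn
      rwa [mul_neg_cancel_left'] at this
  refine eq_univ_of_forall fun g => mem_iUnion.mpr ?_
  exact key V.step 1 (by omega) le_rfl g (V.mem_tail_one g)

variable {d : G → G → ℝ}

theorem IsHomogeneousDist.nonneg (hd : V.IsHomogeneousDist d) (x y : G) : 0 ≤ d x y := by
  have h1 := hd.triangle x y x
  rw [hd.symm y x, (hd.eq_zero_iff x x).mpr rfl] at h1
  linarith

theorem IsHomogeneousDist.eq_norm (hd : V.IsHomogeneousDist d) (x y : G) :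
    d x y = d 0 (V.mul (-x) y) := by
  rw [← hd.mul_left x y (-x), neg_mul_self]

theorem IsHomogeneousDist.norm_mul_le (hd : V.IsHomogeneousDist d) (x y : G) :
    d 0 (V.mul x y) ≤ d 0 x + d 0 y := by
  refine (hd.triangle 0 x _).trans_eq ?_
  rw [hd.eq_norm x (V.mul x y), neg_mul_cancel_left']

theorem IsHomogeneousDist.norm_neg (hd : V.IsHomogeneousDist d) (x : G) : d 0 (-x) = d 0 x := by
  rw [hd.symm, hd.eq_norm, neg_neg, mul_zero']

theorem IsHomogeneousDist.norm_dil (hd : V.IsHomogeneousDist d) {r : ℝ} (hr : 0 < r) (x : G) :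
    d 0 (V.dil r x) = r * d 0 x := by
  have := hd.dil r hr 0 x
  rwa [dil_zero] at this

theorem dil_of_mem_layer_one {b : G} (hb : b ∈ V.layer 1) (r : ℝ) : V.dil r b = r • b := by
  rw [V.dil_of_mem hb, pow_one]

theorem IsHomogeneousDist.norm_smul (hd : V.IsHomogeneousDist d) {b : G} (hb : b ∈ V.layer 1)
    (t : ℝ) : d 0 (t • b) = |t| * d 0 b := by
  have hpos : ∀ t : ℝ, 0 < t → d 0 (t • b) = t * d 0 b := fun t ht => by
    rw [← dil_of_mem_layer_one hb, hd.norm_dil ht]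
  rcases lt_trichotomy t 0 with ht | rfl | ht
  · rw [← hd.norm_neg, ← neg_smul, hpos _ (by linarith), abs_of_neg ht]
  · simp [(hd.eq_zero_iff 0 0).mpr rfl]
  · rw [hpos t ht, abs_of_pos ht]

theorem IsHomogeneousDist.norm_le_of_mem_segmentProducts (hd : V.IsHomogeneousDist d)
    {s : Finset G} (hs : ∀ b ∈ s, b ∈ V.layer 1) {n : ℕ} {x : G}
    (hx : x ∈ V.segmentProducts s n) : d 0 x ≤ n * ∑ b ∈ s, d 0 b := by
  have h0 : d 0 0 = 0 := (hd.eq_zero_iff 0 0).mpr rfl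
  have hsum : 0 ≤ ∑ b ∈ s, d 0 b := Finset.sum_nonneg fun b _ => hd.nonneg 0 b
  induction n generalizing x with
  | zero => rw [mem_singleton_iff.mp hx, h0]; simp
  | succ n ih =>
    obtain ⟨⟨z, k⟩, ⟨hz, hk⟩, rfl⟩ := hx
    refine (hd.norm_mul_le z k).trans ?_
    have hk' : d 0 k ≤ ∑ b ∈ s, d 0 b := by
      rcases hk with rfl | hk
      · rwa [h0]
      · obtain ⟨b, hb, t, ht, rfl⟩ := mem_iUnion₂.mp hk
        refine le_trans ?_ (Finset.single_le_sum (f := fun b => d 0 b)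
          (fun b _ => hd.nonneg 0 b) hb)
        simp only
        rw [hd.norm_smul (hs b hb)]
        exact mul_le_of_le_one_left (hd.nonneg 0 b) (abs_le.mpr ht)
    push_cast
    linarith [ih hz]

theorem continuous_dil [FiniteDimensional ℝ G] (r : ℝ) : Continuous (V.dil r) := by
  have := (V.dilₗ r).continuous_of_finiteDimensional
  simpa [funext fun x => V.dilₗ_apply r x] using this

/-- A homogeneous distance on a stratified group is continuous at the identity. -/
theorem IsHomogeneousDist.tendsto_norm (hd : V.IsHomogeneousDist d) (hV : V.IsStratifiedGroup) :
    Tendsto (d 0) (𝓝 0) (𝓝 0) := by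
  have := hV.finiteDimensional
  obtain ⟨s, hs⟩ : (V.layer 1).FG := IsNoetherian.noetherian _
  have hsl : ∀ b ∈ s, b ∈ V.layer 1 := fun b hb => hs ▸ Submodule.subset_span hb
  -- By Baire some set of `n`-fold products has an interior point `x₀`. Since `d 0` is bounded on
  -- that set, writing `y = x₀⁻¹ (x₀ y)` bounds it near 0.
  obtain ⟨n, x₀, hx₀⟩ := nonempty_interior_of_iUnion_of_closed
    (fun n => (isCompact_segmentProducts (V := V) s n).isClosed) (iUnion_segmentProducts hV hs)
  set C := 2 * (n * ∑ b ∈ s, d 0 b)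
  have hev : ∀ᶠ y in 𝓝 (0 : G), d 0 y ≤ C := by
    have hc : Continuous fun y => V.mul x₀ y :=
      V.continuous_mul.comp (continuous_const.prodMk continuous_id)
    have h1 : Tendsto (fun y => V.mul x₀ y) (𝓝 0) (𝓝 x₀) := by
      have := hc.tendsto 0
      rwa [mul_zero'] at this
    filter_upwards [h1.eventually (mem_interior_iff_mem_nhds.mp hx₀)] with y hy
    have h2 := hd.norm_mul_le (-x₀) (V.mul x₀ y)
    rw [neg_mul_cancel_left', hd.norm_neg] at h2
    have h3 := hd.norm_le_of_mem_segmentProducts hsl hy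
    have h4 := hd.norm_le_of_mem_segmentProducts hsl (interior_subset hx₀)
    simp only [C]; linarith
  have hC : 0 ≤ C := by
    have := Finset.sum_nonneg fun b (_ : b ∈ s) => hd.nonneg 0 b
    positivity
  rw [Metric.tendsto_nhds]
  intro ε hε
  -- Local boundedness becomes continuity by homogeneity: dilating by `r` shrinks the bound `C` to
  -- `r C < ε`.
  set r := ε / (C + 1)
  have hr : 0 < r := by positivity
  have h1 : Tendsto (V.dil r⁻¹) (𝓝 0) (𝓝 0) := by
    have := (continuous_dil (V := V) r⁻¹).tendsto 0
    rwa [dil_zero] at this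
  filter_upwards [h1.eventually hev] with y hy
  have h2 : d 0 y = r * d 0 (V.dil r⁻¹ y) := by
    rw [← hd.norm_dil hr, dil_dil, mul_inv_cancel₀ hr.ne', dil_one]
  rw [dist_zero_right, Real.norm_of_nonneg (hd.nonneg 0 y), h2]
  calc r * d 0 (V.dil r⁻¹ y) ≤ r * C := by gcongr
    _ < r * (C + 1) := by gcongr; linarith
    _ = ε := div_mul_cancel₀ _ (by positivity)

theorem IsHomogeneousDist.tendsto_dist (hd : V.IsHomogeneousDist d) (hV : V.IsStratifiedGroup)
    (x : G) : Tendsto (d x) (𝓝 x) (𝓝 0) := by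
  have h1 : Tendsto (fun y => V.mul (-x) y) (𝓝 x) (𝓝 0) := by
    have hc : Continuous fun y => V.mul (-x) y :=
      V.continuous_mul.comp (continuous_const.prodMk continuous_id)
    have := hc.tendsto x
    rwa [neg_mul_self] at this
  exact ((hd.tendsto_norm hV).comp h1).congr fun y => (hd.eq_norm x y).symm

end Generation

end Stratification

end BanachLieAlgebra

/-! ### Lipschitz maps and density points on the real line -/

section RealLine

variable {X : Type*} [NormedAddCommGroup X] [NormedSpace ℝ X]

/-- A Lipschitz map on a compact set of real numbers extends to the real line, affinely on
the gaps. -/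
theorem LipschitzOnWith.exists_extend_of_isCompact {E : Set ℝ} (hE : IsCompact E) {K : ℝ≥0}
    {g : ℝ → X} (hg : LipschitzOnWith K g E) :
    ∃ f : ℝ → X, LipschitzWith K f ∧ EqOn f g E := by
  rcases E.eq_empty_or_nonempty with rfl | hne
  · exact ⟨fun _ => 0, LipschitzWith.const' _, eqOn_empty _ _⟩
  have hgE : ∀ x ∈ E, ∀ y ∈ E, x ≤ y → ‖g y - g x‖ ≤ K * (y - x) := by
    intro x hx y hy hxy
    have := hg.dist_le_mul y hy x hx
    rwa [dist_eq_norm, Real.dist_eq, abs_of_nonneg (by linarith)] at this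
  obtain ⟨m, hmE, hm⟩ := hE.exists_isLeast hne
  obtain ⟨M, hME, hM⟩ := hE.exists_isGreatest hne
  have hmM : m ≤ M := hm hME
  -- The nearest points of `E` on either side of `t`. They coincide with `t` when `t ∈ E`; outside
  -- `[m, M]` the values are irrelevant, since the extension is precomposed with the projection onto
  -- `[m, M]`.
  have hab : ∀ t : ℝ, ∃ a b : ℝ, t ∈ Icc m M → a ∈ E ∧ b ∈ E ∧ a ≤ t ∧ t ≤ b ∧
      (∀ e ∈ E, e ≤ t → e ≤ a) ∧ ∀ e ∈ E, t ≤ e → b ≤ e := by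
    intro t
    by_cases ht : t ∈ Icc m M
    · obtain ⟨a, ⟨haE, hat⟩, ha⟩ := (hE.inter_right isClosed_Iic).exists_isGreatest
        (⟨m, hmE, ht.1⟩ : (E ∩ Iic t).Nonempty)
      obtain ⟨b, ⟨hbE, hbt⟩, hb⟩ := (hE.inter_right isClosed_Ici).exists_isLeast
        (⟨M, hME, ht.2⟩ : (E ∩ Ici t).Nonempty)
      exact ⟨a, b, fun _ => ⟨haE, hbE, hat, hbt, fun e he het => ha ⟨he, het⟩,
        fun e he het => hb ⟨he, het⟩⟩⟩
    · exact ⟨0, 0, fun h => absurd h ht⟩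
  choose a b hab using hab
  set h : ℝ → X := fun t => g (a t) + ((t - a t) / (b t - a t)) • (g (b t) - g (a t)) with hh
  have hlow : ∀ t ∈ Icc m M, ‖h t - g (a t)‖ ≤ K * (t - a t) := by
    intro t ht
    obtain ⟨haE, hbE, hat, htb, -, -⟩ := hab t ht
    rw [hh]
    simp only [add_sub_cancel_left]
    rw [norm_smul, Real.norm_of_nonneg (div_nonneg (by linarith) (by linarith))]
    rcases (hat.trans htb).eq_or_lt with hab | hab
    · rw [hab]; simp; nlinarith [K.coe_nonneg]
    · calc _ ≤ (t - a t) / (b t - a t) * (K * (b t - a t)) := by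
            gcongr
            exact hgE _ haE _ hbE hab.le
        _ = K * (t - a t) := by
            have : b t - a t ≠ 0 := by linarith
            field_simp
  have hupp : ∀ t ∈ Icc m M, ‖g (b t) - h t‖ ≤ K * (b t - t) := by
    intro t ht
    obtain ⟨haE, hbE, hat, htb, -, -⟩ := hab t ht
    rcases (hat.trans htb).eq_or_lt with hab | hab
    · have : g (b t) - h t = 0 := by simp [hh, hab]
      rw [this, norm_zero]
      exact mul_nonneg K.coe_nonneg (by linarith)
    · have hne : b t - a t ≠ 0 := by linarith
      have : g (b t) - h t = ((b t - t) / (b t - a t)) • (g (b t) - g (a t)) := by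
        have h1 : (b t - t) / (b t - a t) = 1 - (t - a t) / (b t - a t) := by
          field_simp; ring
        rw [h1, sub_smul, one_smul]
        simp only [hh]
        abel
      rw [this, norm_smul, Real.norm_of_nonneg (div_nonneg (by linarith) (by linarith))]
      calc _ ≤ (b t - t) / (b t - a t) * (K * (b t - a t)) := by
            gcongr
            exact hgE _ haE _ hbE hab.le
        _ = K * (b t - t) := by field_simp
  have hmono : ∀ s ∈ Icc m M, ∀ t ∈ Icc m M, s ≤ t → ‖h t - h s‖ ≤ K * (t - s) := by
    intro s hs t ht hst
    obtain ⟨hasE, hbsE, has, hsb, has', hbs'⟩ := hab s hs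
    obtain ⟨hatE, hbtE, hat, htb, hat', hbt'⟩ := hab t ht
    -- Either a point of `E` separates `s` from `t`, and the path passes through `b s ≤ a t`, or
    -- both lie in one gap, where `h` is affine.
    rcases le_or_gt (b s) t with hbt | hbt
    · have h1 := hlow t ht
      have h2 := hupp s hs
      have h3 := hgE _ hbsE _ hatE (hat' _ hbsE hbt)
      have : h t - h s = (h t - g (a t)) + (g (a t) - g (b s)) + (g (b s) - h s) := by abel
      rw [this]
      refine (norm_add₃_le).trans ?_
      linarith
    · have hats : a t < s := by
        by_contra hcon
        have := hbs' _ hatE (not_lt.mp hcon)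
        linarith
      have ha : a t = a s := le_antisymm (has' _ hatE hats.le) (hat' _ hasE (has.trans hst))
      have hb : b t = b s := le_antisymm (hbt' _ hbsE hbt.le) (hbs' _ hbtE (hst.trans htb))
      have hpos : 0 < b s - a s := by linarith
      have : h t - h s = ((t - s) / (b s - a s)) • (g (b s) - g (a s)) := by
        have h1 : (t - s) / (b s - a s) =
            (t - a s) / (b s - a s) - (s - a s) / (b s - a s) := by ring
        rw [h1, sub_smul, hh]
        simp only [ha, hb]
        abel
      rw [this, norm_smul, Real.norm_of_nonneg (div_nonneg (by linarith) hpos.le)]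
      calc _ ≤ (t - s) / (b s - a s) * (K * (b s - a s)) := by
            gcongr
            exact hgE _ hasE _ hbsE (by linarith)
        _ = K * (t - s) := by field_simp
  have hlip : LipschitzOnWith K h (Icc m M) := by
    refine LipschitzOnWith.of_dist_le_mul fun x hx y hy => ?_
    rcases le_total x y with hxy | hxy
    · rw [dist_comm, dist_comm x, dist_eq_norm, Real.dist_eq, abs_of_nonneg (by linarith)]
      exact hmono x hx y hy hxy
    · rw [dist_eq_norm, Real.dist_eq, abs_of_nonneg (by linarith)]
      exact hmono y hy x hx hxy
  have hclamp : LipschitzWith 1 fun t : ℝ => (projIcc m M hmM t : ℝ) :=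
    LipschitzWith.projIcc hmM
  refine ⟨fun t => h (projIcc m M hmM t), ?_, ?_⟩
  · rw [← lipschitzOnWith_univ]
    have := hlip.comp (hclamp.lipschitzOnWith (s := univ)) fun t _ => (projIcc m M hmM t).2
    rwa [mul_one] at this
  · intro t ht
    have htI : t ∈ Icc m M := ⟨hm ht, hM ht⟩
    obtain ⟨-, -, hat, -, hat', -⟩ := hab t htI
    have ha : a t = t := le_antisymm hat (hat' t ht le_rfl)
    simp only [projIcc_of_mem hmM htI]
    simp [hh, ha]

/-- A Lipschitz map from a compact subset of `[0, 1]` to a space with the Radon–Nikodym property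
is differentiable almost everywhere. -/
theorem HasRNP.ae_tendsto_slope (hX : HasRNP X) {E : Set ℝ} (hE : IsCompact E) {K : ℝ≥0}
    {g : ℝ → X} (hg : LipschitzOnWith K g E) :
    ∀ᵐ t ∂(volume.restrict (Icc (0 : ℝ) 1)), t ∈ E →
      ∃ w, Tendsto (fun h => h⁻¹ • (g (t + h) - g t)) (𝓝[>] 0 ⊓ 𝓟 {h | t + h ∈ E}) (𝓝 w) := by
  obtain ⟨f, hf, hfg⟩ := hg.exists_extend_of_isCompact hE
  have hIoo : ∀ᵐ t ∂(volume.restrict (Icc (0 : ℝ) 1)), t ∈ Ioo (0 : ℝ) 1 := by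
    rw [Measure.restrict_congr_set Ioo_ae_eq_Icc.symm]
    exact ae_restrict_mem measurableSet_Ioo
  filter_upwards [hX f K hf.lipschitzOnWith, hIoo] with t ht htI htE
  have hd : HasDerivAt f (deriv f t) t :=
    (ht.differentiableAt (Icc_mem_nhds htI.1 htI.2)).hasDerivAt
  refine ⟨deriv f t, ?_⟩
  rw [hasDerivAt_iff_tendsto_slope_zero] at hd
  refine (hd.mono_left (inf_le_left.trans (nhdsWithin_mono 0 fun x hx => (ne_of_gt hx)))).congr' ?_
  have : ∀ᶠ h in 𝓝[>] (0 : ℝ) ⊓ 𝓟 {h | t + h ∈ E}, t + h ∈ E :=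
    mem_inf_of_right (mem_principal_self _)
  filter_upwards [this] with h hh
  rw [hfg hh, hfg htE]

/-- The Lebesgue density theorem for right neighbourhoods. -/
theorem ae_tendsto_volume_compl_div {E : Set ℝ} (hE : MeasurableSet E) :
    ∀ᵐ x, x ∈ E → Tendsto (fun t : ℝ => volume {η : ℝ | 0 < η ∧ η < t ∧ x + η ∉ E} /
      ENNReal.ofReal t) (𝓝[>] 0) (𝓝 0) := by
  have h := IsUnifLocDoublingMeasure.ae_tendsto_measure_inter_div (volume : Measure ℝ) E 1
  rw [ae_restrict_iff' hE] at h
  filter_upwards [h] with x hx hxE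
  have hpos : ∀ᶠ t in 𝓝[>] (0 : ℝ), 0 < t := eventually_mem_nhdsWithin
  -- The closed ball about `x + t / 2` of radius `t / 2` is `[x, x + t]`. The density theorem for
  -- doubling measures allows such off-centre balls.
  have h1 := hx hxE (l := 𝓝[>] (0 : ℝ)) (fun t => x + t / 2) (fun t => t / 2) ?_ ?_
  · have h2 := ENNReal.Tendsto.sub (tendsto_const_nhds (x := (1 : ℝ≥0∞))) h1 (Or.inl ENNReal.one_ne_top)
    rw [tsub_self] at h2
    refine tendsto_of_tendsto_of_tendsto_of_le_of_le' tendsto_const_nhds h2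
      (Eventually.of_forall fun _ => zero_le) ?_
    filter_upwards [hpos] with t ht
    have hball : Metric.closedBall (x + t / 2) (t / 2) = Icc x (x + t) := by
      rw [Real.closedBall_eq_Icc]; congr 1 <;> ring
    have hvol : volume (Icc x (x + t)) = ENNReal.ofReal t := by
      rw [Real.volume_Icc, add_sub_cancel_left]
    have ht0 : ENNReal.ofReal t ≠ 0 := by simpa using ht
    have hsub : volume {η : ℝ | 0 < η ∧ η < t ∧ x + η ∉ E} ≤ volume (Icc x (x + t) \ E) := by
      rw [← measure_preimage_add volume x (Icc x (x + t) \ E)]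
      refine measure_mono fun η hη => ⟨⟨?_, ?_⟩, hη.2.2⟩
      · linarith [hη.1]
      · linarith [hη.2.1]
    rw [hball, hvol]
    calc _ ≤ volume (Icc x (x + t) \ E) / ENNReal.ofReal t := by gcongr
      _ = (ENNReal.ofReal t - volume (E ∩ Icc x (x + t))) / ENNReal.ofReal t := by
          congr 1
          refine ENNReal.eq_sub_of_add_eq ?_ ?_
          · exact ((measure_mono inter_subset_right).trans_lt
              (hvol ▸ ENNReal.ofReal_lt_top)).ne
          · rw [inter_comm, measure_sdiff_add_inter _ hE, hvol]
      _ = _ := by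
          rw [ENNReal.sub_div fun _ _ => ht0, ENNReal.div_self ht0 ENNReal.ofReal_ne_top]
  · refine tendsto_nhdsWithin_iff.mpr ⟨?_, ?_⟩
    · have : Tendsto (fun t : ℝ => t / 2) (𝓝 0) (𝓝 (0 / 2)) :=
        (continuous_id.div_const 2).tendsto 0
      rw [zero_div] at this
      exact this.mono_left nhdsWithin_le_nhds
    · filter_upwards [hpos] with t ht using half_pos ht
  · filter_upwards [hpos] with t ht
    rw [one_mul, Real.closedBall_eq_Icc]
    constructor <;> linarith

/-- Points of a closed set that has density one on the right of `0` approximate the identity. -/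
theorem exists_approx_of_tendsto_volume {E : Set ℝ} (hE : IsClosed E) (h0 : (0 : ℝ) ∈ E)
    (h : Tendsto (fun t : ℝ => volume {η : ℝ | 0 < η ∧ η < t ∧ η ∉ E} / ENNReal.ofReal t)
      (𝓝[>] 0) (𝓝 0)) :
    ∃ θ : ℝ → ℝ, (∀ t, θ t ∈ E) ∧ Tendsto (fun t => θ t / t) (𝓝[>] 0) (𝓝 1) := by
  -- Here `θ t` is a point of `E` nearest to `t`. If it were farther than `δ t`, the interval `(t -
  -- δ t, t)` would miss `E` and contradict the density.
  choose θ hθE hθ using fun t : ℝ => hE.exists_infDist_eq_dist ⟨0, h0⟩ t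
  refine ⟨θ, hθE, ?_⟩
  rw [Metric.tendsto_nhds]
  intro ε hε
  have hpos : ∀ᶠ t in 𝓝[>] (0 : ℝ), 0 < t := eventually_mem_nhdsWithin
  set δ := min (ε / 2) (1 / 2)
  have hδ : 0 < δ := by positivity
  have hδ1 : δ < 1 := (min_le_right _ _).trans_lt (by norm_num)
  have hδε : δ < ε := (min_le_left _ _).trans_lt (by linarith)
  filter_upwards [hpos, h.eventually_lt_const (u := ENNReal.ofReal δ) (by simpa using hδ)]
    with t ht hv
  have hkey : |t - θ t| ≤ δ * t := by
    by_contra hcon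
    rw [not_le, ← Real.dist_eq, ← hθ t] at hcon
    have hsub : Ioo (t - δ * t) t ⊆ {η : ℝ | 0 < η ∧ η < t ∧ η ∉ E} := by
      intro η hη
      refine ⟨?_, hη.2, fun hηE => ?_⟩
      · have : 0 ≤ t - δ * t := by nlinarith
        exact this.trans_lt hη.1
      · have := Metric.infDist_le_dist_of_mem (x := t) hηE
        rw [Real.dist_eq, abs_of_pos (by linarith [hη.2])] at this
        linarith [hη.1]
    have hle := measure_mono (μ := volume) hsub
    rw [Real.volume_Ioo, sub_sub_cancel, ENNReal.ofReal_mul hδ.le] at hle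
    rw [ENNReal.div_lt_iff (Or.inl (by simpa using ht)) (Or.inl ENNReal.ofReal_ne_top)] at hv
    exact absurd hv (not_lt.mpr hle)
  rw [Real.dist_eq]
  have : θ t / t - 1 = -(t - θ t) / t := by field_simp; ring
  rw [this, abs_div, abs_neg, abs_of_pos ht, div_lt_iff₀ ht]
  exact hkey.trans_lt (by gcongr)

end RealLine

/-! ### Tonelli along lines and density in a direction -/

namespace BanachLieAlgebra

namespace Stratification

section Fubini

variable {G : Type*} [BanachLieAlgebra G] {V : Stratification G}

theorem continuous_line (ζ : G) : Continuous fun p : G × ℝ => V.mul p.1 (p.2 • ζ) :=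
  V.continuous_mul.comp (continuous_fst.prodMk (continuous_snd.smul continuous_const))

theorem mul_smul_mul_smul (x ζ : G) (s t : ℝ) :
    V.mul (V.mul x (s • ζ)) (t • ζ) = V.mul x ((s + t) • ζ) := by
  rw [mul_assoc', smul_mul_smul_self]

/-- A measurable set that meets almost no point of the segments in direction `ζ` is null for the
Haar measure. -/
theorem IsHaar.measure_eq_zero_of_line [MeasurableSpace G] [BorelSpace G]
    [FiniteDimensional ℝ G] {μ : Measure G} (hμ : V.IsHaar μ) (ζ : G) {B : Set G}
    (hB : MeasurableSet B)
    (h : ∀ x, ∀ᵐ θ ∂(volume.restrict (Icc (0 : ℝ) 1)), V.mul x (θ • ζ) ∉ B) : μ B = 0 := by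
  have : ProperSpace G := FiniteDimensional.proper ℝ G
  have : IsFiniteMeasureOnCompacts μ := ⟨fun K hK => hμ.lt_top_of_isCompact K hK⟩
  let _ : Group G := V.group
  have : ContinuousMul G := ⟨V.continuous_mul⟩
  have : ContinuousInv G := ⟨continuous_neg (G := G)⟩
  have : μ.IsMulLeftInvariant := ⟨hμ.map_mul_left⟩
  set ν := volume.restrict (Icc (0 : ℝ) 1)
  -- After exchanging the quantifiers a single good `θ` suffices: a right translate of `B` is null,
  -- and right translations preserve the null sets of a left Haar measure.
  have h2 : ∀ᵐ θ ∂ν, ∀ᵐ x ∂μ, V.mul x (θ • ζ) ∉ B := Measure.ae_ae_comm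
    (((continuous_line (V := V) ζ).measurable hB).compl) |>.mp (Eventually.of_forall h)
  have hν : ν ≠ 0 := by
    intro h0
    have : ν univ = 0 := by rw [h0]; rfl
    simp [ν] at this
  have : (ae ν).NeBot := ae_neBot.mpr hν
  obtain ⟨θ, hθ⟩ := h2.exists
  rw [← measure_mul_right_null μ (θ • ζ)]
  rw [ae_iff] at hθ
  simp only [not_not] at hθ
  exact hθ

end Fubini

section Density

variable {G : Type*} [BanachLieAlgebra G] {V : Stratification G}

theorem DenseInDirection.mono {A A' : Set G} (hA : A ⊆ A') {x ζ : G}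
    (h : V.DenseInDirection A x ζ) : V.DenseInDirection A' x ζ := by
  refine tendsto_of_tendsto_of_tendsto_of_le_of_le tendsto_const_nhds h (fun _ => zero_le)
    fun t => ?_
  refine ENNReal.div_le_div_right (measure_mono fun θ hθ => ?_) _
  exact ⟨hθ.1, hθ.2.1, fun hcon => hθ.2.2 (hA hcon)⟩

/-- Reduces the limit to countably many conditions, from which measurability in `x` can be read off.
-/
theorem denseInDirection_iff {ζ : G} (hζ : ζ ∈ V.layer 1) (A : Set G) (x : G) :
    V.DenseInDirection A x ζ ↔ ∀ n : ℕ, ∃ k : ℕ, ∀ q : ℚ, 0 < (q : ℝ) → (q : ℝ) < 1 / ((k : ℝ) + 1) →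
      volume {θ : ℝ | 0 < θ ∧ θ < q ∧ V.mul x (θ • ζ) ∉ A} ≤ ENNReal.ofReal (q / ((n : ℝ) + 1)) := by
  have hpos : ∀ᶠ t in 𝓝[>] (0 : ℝ), 0 < t := eventually_mem_nhdsWithin
  simp only [DenseInDirection, dil_of_mem_layer_one hζ]
  constructor
  · intro h n
    have h1 := h.eventually_lt_const (u := ENNReal.ofReal (1 / ((n : ℝ) + 1)))
      (by rw [ENNReal.ofReal_pos]; positivity)
    obtain ⟨δ, hδ, h2⟩ := mem_nhdsGT_iff_exists_Ioo_subset.mp h1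
    obtain ⟨k, hk⟩ := exists_nat_one_div_lt (mem_Ioi.mp hδ)
    refine ⟨k, fun q hq0 hqk => ?_⟩
    have h3 := h2 ⟨hq0, hqk.trans hk⟩
    simp only [mem_ofPred_eq] at h3
    rw [ENNReal.div_lt_iff (Or.inl (by simpa using hq0)) (Or.inl ENNReal.ofReal_ne_top),
      ← ENNReal.ofReal_mul (by positivity)] at h3
    refine h3.le.trans_eq ?_
    congr 1; ring
  · intro h
    rw [ENNReal.tendsto_nhds_zero]
    intro ε hε
    obtain ⟨ε', hε', hε'ε⟩ : ∃ ε' : ℝ, 0 < ε' ∧ ENNReal.ofReal ε' ≤ ε := by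
      rcases eq_or_ne ε ∞ with rfl | hne
      · exact ⟨1, one_pos, le_top⟩
      · exact ⟨ε.toReal, ENNReal.toReal_pos hε.ne' hne, ENNReal.ofReal_toReal_le⟩
    obtain ⟨n, hn⟩ := exists_nat_one_div_lt (half_pos hε')
    obtain ⟨k, hk⟩ := h n
    have hk0 : (0 : ℝ) < 1 / ((k : ℝ) + 1) := by positivity
    filter_upwards [hpos, Ioo_mem_nhdsGT hk0] with t ht htk
    -- The bad set grows with `t`, so a rational `q` in `(t, 2 t)` controls it at the price of a
    -- factor 2, absorbed by choosing `1 / (n + 1) < ε' / 2`.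
    obtain ⟨q, hq1, hq2⟩ := exists_rat_btwn (lt_min htk.2 (by linarith : t < 2 * t))
    have hq0 : (0 : ℝ) < q := ht.trans hq1
    have h1 := hk q hq0 (hq2.trans_le (min_le_left _ _))
    have h2 : volume {θ : ℝ | 0 < θ ∧ θ < t ∧ V.mul x (θ • ζ) ∉ A} ≤
        volume {θ : ℝ | 0 < θ ∧ θ < q ∧ V.mul x (θ • ζ) ∉ A} :=
      measure_mono fun θ hθ => ⟨hθ.1, hθ.2.1.trans hq1, hθ.2.2⟩
    refine le_trans ?_ hε'ε
    rw [ENNReal.div_le_iff (by simpa using ht) ENNReal.ofReal_ne_top, ← ENNReal.ofReal_mul hε'.le]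
    refine (h2.trans h1).trans (ENNReal.ofReal_le_ofReal ?_)
    have hq3 : (q : ℝ) < 2 * t := hq2.trans_le (min_le_right _ _)
    calc (q : ℝ) / ((n : ℝ) + 1) = q * (1 / ((n : ℝ) + 1)) := by ring
      _ ≤ (2 * t) * (ε' / 2) := by gcongr
      _ = ε' * t := by ring

theorem measurableSet_denseInDirection [MeasurableSpace G] [BorelSpace G]
    [FiniteDimensional ℝ G] {ζ : G} (hζ : ζ ∈ V.layer 1) {A : Set G} (hA : MeasurableSet A) :
    MeasurableSet {x | V.DenseInDirection A x ζ} := by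
  have : ProperSpace G := FiniteDimensional.proper ℝ G
  simp only [denseInDirection_iff hζ, ofPred_forall, ofPred_exists]
  refine MeasurableSet.iInter fun n => MeasurableSet.iUnion fun k => MeasurableSet.iInter fun q =>
    MeasurableSet.iInter fun _ => MeasurableSet.iInter fun _ => ?_
  have hm : MeasurableSet {p : G × ℝ | 0 < p.2 ∧ p.2 < q ∧ V.mul p.1 (p.2 • ζ) ∉ A} :=
    (measurable_snd measurableSet_Ioi).inter ((measurable_snd measurableSet_Iio).inter
      ((continuous_line (V := V) ζ).measurable hA).compl)
  exact measurableSet_le (measurable_measure_prodMk_left hm) measurable_const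

/-- Every line in direction `ζ` meets `K` in a closed set of parameters, almost all of which are
right density points. -/
theorem ae_denseInDirection [MeasurableSpace G] [BorelSpace G] [FiniteDimensional ℝ G]
    {μ : Measure G} (hμ : V.IsHaar μ) {ζ : G} (hζ : ζ ∈ V.layer 1) {K : Set G}
    (hK : IsCompact K) : ∀ᵐ x ∂μ, x ∈ K → V.DenseInDirection K x ζ := by
  have hB : MeasurableSet {x | ¬ (x ∈ K → V.DenseInDirection K x ζ)} := by
    have : {x | ¬ (x ∈ K → V.DenseInDirection K x ζ)} =
        K ∩ {x | V.DenseInDirection K x ζ}ᶜ := by ext; simp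
    rw [this]
    exact hK.measurableSet.inter (measurableSet_denseInDirection hζ hK.measurableSet).compl
  refine hμ.measure_eq_zero_of_line ζ hB fun x => ?_
  set E : Set ℝ := {θ | V.mul x (θ • ζ) ∈ K}
  have hE : IsClosed E := hK.isClosed.preimage
    ((continuous_line (V := V) ζ).comp (continuous_const.prodMk continuous_id))
  refine ae_restrict_of_ae ?_
  filter_upwards [ae_tendsto_volume_compl_div hE.measurableSet] with θ hθ
  refine fun hcon => hcon fun hθE => ?_
  simp only [DenseInDirection, dil_of_mem_layer_one hζ, mul_smul_mul_smul]
  exact hθ hθE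

end Density

/-! ### Difference quotients of the first layer -/

section FirstLayer

variable {G : Type*} [BanachLieAlgebra G] {V : Stratification G} {X : Type*}
  [NormedAddCommGroup X] [NormedSpace ℝ X]

/-- The difference quotient of `g` at `x` in direction `ζ`. -/
noncomputable def dirQuot (V : Stratification G) (g : G → X) (ζ x : G) (h : ℝ) : X :=
  h⁻¹ • (g (V.mul x (h • ζ)) - g x)

/-- Pairs of increments violating the Cauchy condition for difference quotients. -/
def cauchyDefect (V : Stratification G) (g : G → X) (ζ : G) (K : Set G) (n k j : ℕ) :
    Set (G × ℝ × ℝ) :=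
  {p | p ∈ K ×ˢ (Icc (1 / ((j : ℝ) + 1)) (1 / ((k : ℝ) + 1)) ×ˢ
      Icc (1 / ((j : ℝ) + 1)) (1 / ((k : ℝ) + 1))) ∧
    V.mul p.1 (p.2.1 • ζ) ∈ K ∧ V.mul p.1 (p.2.2 • ζ) ∈ K ∧
    1 / ((n : ℝ) + 1) ≤ ‖V.dirQuot g ζ p.1 p.2.1 - V.dirQuot g ζ p.1 p.2.2‖}

/-- The bound `1 / (j + 1)` keeps the increments away from 0, where the difference quotients are
singular. The defect is then closed in a compact set, and its projection to `G` is compact, hence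
Borel. -/
theorem isCompact_cauchyDefect {g : G → X} {ζ : G} {K : Set G} (hK : IsCompact K)
    (hg : ContinuousOn g K) (n k j : ℕ) : IsCompact (V.cauchyDefect g ζ K n k j) := by
  set c₁ : G × ℝ × ℝ → G := fun p => V.mul p.1 (p.2.1 • ζ)
  set c₂ : G × ℝ × ℝ → G := fun p => V.mul p.1 (p.2.2 • ζ)
  have hc₁ : Continuous c₁ :=
    (continuous_line ζ).comp (continuous_fst.prodMk (continuous_fst.comp continuous_snd))
  have hc₂ : Continuous c₂ :=
    (continuous_line ζ).comp (continuous_fst.prodMk (continuous_snd.comp continuous_snd))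
  set I := Icc (1 / ((j : ℝ) + 1)) (1 / ((k : ℝ) + 1))
  set S : Set (G × ℝ × ℝ) := (K ×ˢ (I ×ˢ I)) ∩ (c₁ ⁻¹' K ∩ c₂ ⁻¹' K)
  have hS : IsCompact S := (hK.prod (isCompact_Icc.prod isCompact_Icc)).inter_right
    ((hK.isClosed.preimage hc₁).inter (hK.isClosed.preimage hc₂))
  have hI : ∀ h ∈ I, h ≠ 0 := fun h hh => by
    have : (0 : ℝ) < 1 / ((j : ℝ) + 1) := by positivity
    exact (this.trans_le hh.1).ne'
  have hcont : ContinuousOn (fun p : G × ℝ × ℝ =>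
      ‖V.dirQuot g ζ p.1 p.2.1 - V.dirQuot g ζ p.1 p.2.2‖) S := by
    have hg0 : ContinuousOn (fun p : G × ℝ × ℝ => g p.1) S :=
      hg.comp continuous_fst.continuousOn fun p hp => hp.1.1
    refine ((ContinuousOn.smul ?_ ((hg.comp hc₁.continuousOn fun p hp => hp.2.1).sub hg0)).sub
      (ContinuousOn.smul ?_ ((hg.comp hc₂.continuousOn fun p hp => hp.2.2).sub hg0))).norm
    · exact (continuous_fst.comp continuous_snd).continuousOn.inv₀ fun p hp => hI _ hp.1.2.1
    · exact (continuous_snd.comp continuous_snd).continuousOn.inv₀ fun p hp => hI _ hp.1.2.2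
  have hclosed := hcont.preimage_isClosed_of_isClosed hS.isClosed (isClosed_Ici (a := 1 / ((n : ℝ) + 1)))
  have heq : V.cauchyDefect g ζ K n k j = S ∩ (fun p : G × ℝ × ℝ =>
      ‖V.dirQuot g ζ p.1 p.2.1 - V.dirQuot g ζ p.1 p.2.2‖) ⁻¹' Ici (1 / ((n : ℝ) + 1)) := by
    ext p
    simp only [cauchyDefect, S, c₁, c₂, I, mem_ofPred_eq, mem_inter_iff, mem_preimage, mem_Ici]
    tauto
  rw [heq]
  exact hS.of_isClosed_subset hclosed inter_subset_left

/-- Completeness replaces the unknown limit by the Cauchy criterion, which involves only countably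
many parameters `n`, `k`, `j`. -/
theorem exists_tendsto_dirQuot_iff [CompleteSpace X] (g : G → X) (ζ : G) {K : Set G} {x : G}
    (hx : x ∈ K) :
    (∃ w, Tendsto (V.dirQuot g ζ x) (𝓝[>] 0 ⊓ 𝓟 {h | V.mul x (h • ζ) ∈ K}) (𝓝 w)) ↔
      ¬ ∃ n : ℕ, ∀ k : ℕ, ∃ j : ℕ, x ∈ Prod.fst '' V.cauchyDefect g ζ K n k j := by
  have hbasis : (𝓝[>] (0 : ℝ) ⊓ 𝓟 {h | V.mul x (h • ζ) ∈ K}).HasBasis (fun _ : ℕ => True)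
      fun k => Ioc 0 (1 / ((k : ℝ) + 1)) ∩ {h | V.mul x (h • ζ) ∈ K} := by
    refine HasBasis.inf_principal ?_ _
    refine (nhdsGT_basis_Ioc (0 : ℝ)).to_hasBasis (fun δ hδ => ?_) fun k _ => ?_
    · obtain ⟨k, hk⟩ := exists_nat_one_div_lt hδ
      exact ⟨k, trivial, Ioc_subset_Ioc_right hk.le⟩
    · exact ⟨1 / ((k : ℝ) + 1), by positivity, subset_rfl⟩
  -- If no small increments lead into `K`, every limit exists trivially, and the defects are empty
  -- over `x` for large `k`.
  rcases eq_or_neBot (𝓝[>] (0 : ℝ) ⊓ 𝓟 {h | V.mul x (h • ζ) ∈ K}) with hbot | hne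
  · simp only [hbot, tendsto_bot, exists_const, true_iff]
    rintro ⟨n, hn⟩
    have hmem : (∅ : Set ℝ) ∈ 𝓝[>] (0 : ℝ) ⊓ 𝓟 {h | V.mul x (h • ζ) ∈ K} := by
      rw [hbot]; trivial
    obtain ⟨k, -, hk⟩ := hbasis.mem_iff.mp hmem
    obtain ⟨j, p, hp, rfl⟩ := hn k
    refine hk (a := p.2.1) ⟨⟨lt_of_lt_of_le ?_ hp.1.2.1.1, hp.1.2.1.2⟩, hp.2.1⟩
    positivity
  rw [← cauchy_map_iff_exists_tendsto, cauchy_map_iff', (hbasis.prod_self).tendsto_iff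
    Metric.uniformity_basis_dist_inv_nat_succ]
  constructor
  · rintro h ⟨n, hn⟩
    obtain ⟨k, -, hk⟩ := h n trivial
    obtain ⟨j, p, hp, rfl⟩ := hn k
    have hj : (0 : ℝ) < 1 / ((j : ℝ) + 1) := by positivity
    have := hk (p.2.1, p.2.2) ⟨⟨⟨hj.trans_le hp.1.2.1.1, hp.1.2.1.2⟩, hp.2.1⟩,
      ⟨⟨hj.trans_le hp.1.2.2.1, hp.1.2.2.2⟩, hp.2.2.1⟩⟩
    rw [mem_ofPred_eq, dist_eq_norm] at this
    exact absurd hp.2.2.2 (not_le.mpr this)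
  · intro h n _
    by_contra hcon
    refine h ⟨n, fun k => ?_⟩
    simp only [true_and, not_exists, not_forall] at hcon
    obtain ⟨⟨h₁, h₂⟩, ⟨⟨hh₁, hK₁⟩, hh₂, hK₂⟩, hlt⟩ := hcon k
    rw [mem_ofPred_eq, dist_eq_norm, not_lt] at hlt
    obtain ⟨j, hj⟩ := exists_nat_one_div_lt (lt_min hh₁.1 hh₂.1)
    exact ⟨j, (x, h₁, h₂), ⟨⟨hx, ⟨(hj.trans_le (min_le_left _ _)).le, hh₁.2⟩,
      ⟨(hj.trans_le (min_le_right _ _)).le, hh₂.2⟩⟩, hK₁, hK₂, hlt⟩, rfl⟩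

theorem ae_exists_tendsto_dirQuot [MeasurableSpace G] [BorelSpace G] [FiniteDimensional ℝ G]
    [CompleteSpace X] {μ : Measure G} (hμ : V.IsHaar μ) (hX : HasRNP X) {ζ : G} {K : Set G}
    (hK : IsCompact K) {g : G → X} (hg : ContinuousOn g K) {L : ℝ≥0}
    (hL : ∀ x : G, ∀ s t : ℝ, V.mul x (s • ζ) ∈ K → V.mul x (t • ζ) ∈ K →
      dist (g (V.mul x (s • ζ))) (g (V.mul x (t • ζ))) ≤ L * dist s t) :
    ∀ᵐ x ∂μ, x ∈ K →
      ∃ w, Tendsto (V.dirQuot g ζ x) (𝓝[>] 0 ⊓ 𝓟 {h | V.mul x (h • ζ) ∈ K}) (𝓝 w) := by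
  have hB : MeasurableSet {x | ¬ (x ∈ K →
      ∃ w, Tendsto (V.dirQuot g ζ x) (𝓝[>] 0 ⊓ 𝓟 {h | V.mul x (h • ζ) ∈ K}) (𝓝 w))} := by
    have heq : {x | ¬ (x ∈ K → ∃ w, Tendsto (V.dirQuot g ζ x)
        (𝓝[>] 0 ⊓ 𝓟 {h | V.mul x (h • ζ) ∈ K}) (𝓝 w))} =
        K ∩ ⋃ n : ℕ, ⋂ k : ℕ, ⋃ j : ℕ, Prod.fst '' V.cauchyDefect g ζ K n k j := by
      ext x
      simp only [mem_ofPred_eq, Classical.not_imp, mem_inter_iff, mem_iUnion, mem_iInter]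
      refine and_congr_right fun hx => ?_
      rw [exists_tendsto_dirQuot_iff g ζ hx, not_not]
    rw [heq]
    exact hK.measurableSet.inter (MeasurableSet.iUnion fun n => MeasurableSet.iInter fun k =>
      MeasurableSet.iUnion fun j =>
        ((isCompact_cauchyDefect hK hg n k j).image continuous_fst).measurableSet)
  refine hμ.measure_eq_zero_of_line ζ hB fun x => ?_
  set E : Set ℝ := {θ | V.mul x (θ • ζ) ∈ K} ∩ Icc 0 1
  have hE : IsCompact E := isCompact_Icc.inter_left (hK.isClosed.preimage
    ((continuous_line (V := V) ζ).comp (continuous_const.prodMk continuous_id)))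
  have hgE : LipschitzOnWith L (fun θ => g (V.mul x (θ • ζ))) E :=
    LipschitzOnWith.of_dist_le_mul fun s hs t ht => hL x s t hs.1 ht.1
  -- For `θ < 1` small positive increments stay in `[0, 1]`, so restricting `E` to that interval
  -- does not change the limit.
  have hIco : ∀ᵐ t ∂(volume.restrict (Icc (0 : ℝ) 1)), t ∈ Ico (0 : ℝ) 1 := by
    rw [Measure.restrict_congr_set Ico_ae_eq_Icc.symm]
    exact ae_restrict_mem measurableSet_Ico
  filter_upwards [hX.ae_tendsto_slope hE hgE, hIco] with θ hθ hθI
  refine fun hcon => hcon fun hθK => ?_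
  obtain ⟨w, hw⟩ := hθ ⟨hθK, Ico_subset_Icc_self hθI⟩
  refine ⟨w, ?_⟩
  have hfun : V.dirQuot g ζ (V.mul x (θ • ζ)) =
      fun h => h⁻¹ • (g (V.mul x ((θ + h) • ζ)) - g (V.mul x (θ • ζ))) := by
    funext h
    rw [dirQuot, mul_smul_mul_smul]
  rw [hfun]
  refine hw.mono_left ?_
  simp only [mul_smul_mul_smul]
  have hnear : ∀ᶠ h in 𝓝[>] (0 : ℝ), θ + h ∈ Icc (0 : ℝ) 1 := by
    filter_upwards [Ioo_mem_nhdsGT (sub_pos.mpr hθI.2)] with h hh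
    exact ⟨by linarith [hθI.1, hh.1], by linarith [hh.2]⟩
  rw [le_inf_iff]
  refine ⟨inf_le_left, ?_⟩
  rw [le_principal_iff]
  filter_upwards [mem_inf_of_left hnear, mem_inf_of_right (mem_principal_self _)] with h h1 h2
  exact ⟨h2, h1⟩

end FirstLayer

end Stratification

end BanachLieAlgebra

/-! ### Differentiability almost everywhere -/

namespace BanachLieAlgebra

namespace Stratification

section Differentiability

variable {G : Type*} [BanachLieAlgebra G] {V : Stratification G} {d : G → G → ℝ}
  {M : Type*} [BanachLieAlgebra M] {H : Stratification M} {σ : ℕ → ℝ≥0}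

theorem norm_proj_one_sub_le (hσ : H.IsHomogeneousNorm σ) (x y : M) :
    ‖H.proj 1 x - H.proj 1 y‖ ≤ H.hdist σ x y := by
  have h1 : H.proj 1 y - H.proj 1 x = H.proj 1 (H.mul (-x) y) := by
    rw [proj_one_mul, map_neg, sub_eq_neg_add]
  rw [norm_sub_rev, h1, hdist]
  by_cases h : 1 ∈ Finset.Icc 1 H.step
  · simpa [hσ.one] using norm_proj_le hσ h (H.mul (-x) y)
  · rw [H.proj_eq_zero h, norm_zero]
    exact hnorm_nonneg _

theorem IsHomogeneousDist.dist_mul_smul (hd : V.IsHomogeneousDist d) {ζ : G}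
    (hζ : ζ ∈ V.layer 1) (x : G) (s t : ℝ) :
    d (V.mul x (s • ζ)) (V.mul x (t • ζ)) = |s - t| * d 0 ζ := by
  rw [hd.mul_left, hd.eq_norm, ← neg_smul, smul_mul_smul_self, hd.norm_smul hζ, abs_sub_comm,
    sub_eq_neg_add]

/-- Small perturbations in the homogeneous norm do not change the limit of rescaled products. -/
theorem tendsto_dil_mul (hσ : H.IsHomogeneousNorm σ) {u v : ℝ → M} {w : M}
    (hu : Tendsto (fun t => H.dil (1 / t) (u t)) (𝓝[>] 0) (𝓝 w))
    (hv : Tendsto (fun t => 1 / t * H.hnorm σ (v t)) (𝓝[>] 0) (𝓝 0)) :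
    Tendsto (fun t => H.dil (1 / t) (H.mul (u t) (v t))) (𝓝[>] 0) (𝓝 w) := by
  have hpos : ∀ᶠ t in 𝓝[>] (0 : ℝ), 0 < t := eventually_mem_nhdsWithin
  have h1 : Tendsto (fun t => H.dil (1 / t) (v t)) (𝓝[>] 0) (𝓝 0) := by
    have h2 := hv.const_mul (H.normConst σ)
    rw [mul_zero] at h2
    refine squeeze_zero_norm' ?_ h2
    filter_upwards [hpos, hv.eventually (ge_mem_nhds one_pos)] with t ht h
    exact norm_dil_le hσ (by positivity) le_rfl h
  have h3 := (H.continuous_mul.tendsto (w, 0)).comp (hu.prodMk_nhds h1)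
  simp only [mul_zero'] at h3
  exact h3.congr fun t => (H.dil_mul _ _ _).symm

/-- A Lipschitz map is differentiable at a point in a horizontal direction as soon as its
horizontal component is. -/
theorem dirDifferentiableAt_of_tendsto_proj_one (hd : V.IsHomogeneousDist d)
    (hσ : H.IsHomogeneousNorm σ) {A : Set G} {f : G → M} {L : ℝ} (hL : 0 ≤ L)
    (hf : ∀ x ∈ A, ∀ y ∈ A, H.hdist σ (f x) (f y) ≤ L * d x y) {ζ : G} (hζ : ζ ∈ V.layer 1)
    (hζ0 : ζ ≠ 0) {x : G} (hx : x ∈ A) {E : Set ℝ} (hE : IsClosed E) (h0 : (0 : ℝ) ∈ E)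
    (hEA : ∀ θ ∈ E, V.mul x (θ • ζ) ∈ A)
    (hdens : Tendsto (fun t : ℝ => volume {η : ℝ | 0 < η ∧ η < t ∧ η ∉ E} / ENNReal.ofReal t)
      (𝓝[>] 0) (𝓝 0)) {w : M}
    (hw : Tendsto (fun h : ℝ => h⁻¹ • (H.proj 1 (f (V.mul x (h • ζ))) - H.proj 1 (f x)))
      (𝓝[>] 0 ⊓ 𝓟 E) (𝓝 w)) : DirDifferentiableAt V H d A f x ζ := by
  have hpos : ∀ᶠ t in 𝓝[>] (0 : ℝ), 0 < t := eventually_mem_nhdsWithin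
  obtain ⟨θ, hθE, hθ⟩ := exists_approx_of_tendsto_volume hE h0 hdens
  have hd0 : 0 ≤ d 0 ζ := hd.nonneg 0 ζ
  have hθd : Tendsto (fun t => d (θ t • ζ) (V.dil t ζ) / t) (𝓝[>] 0) (𝓝 0) := by
    have h1 := ((hθ.sub_const 1).abs).mul_const (d 0 ζ)
    rw [sub_self, abs_zero, zero_mul] at h1
    refine h1.congr' ?_
    filter_upwards [hpos] with t ht
    have h2 := hd.dist_mul_smul hζ 0 (θ t) t
    rw [zero_mul', zero_mul'] at h2
    rw [dil_of_mem_layer_one hζ, h2, div_sub_one ht.ne', abs_div, abs_of_pos ht, div_mul_eq_mul_div]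
  have hbase : Tendsto (fun t => H.dil (1 / t) (H.mul (-f x) (f (V.mul x (θ t • ζ)))))
      (𝓝[>] 0) (𝓝 w) := by
    have h1 := tendsto_dil_of_tendsto_proj_one hσ (Γ := fun s => f (V.mul x (s • ζ))) h0
      (mul_nonneg hL hd0) (fun a ha b hb => ?_) (w := w) ?_ (fun t _ => hθE t) hθ
    · simpa only [zero_smul, mul_zero'] using h1
    · refine (hf _ (hEA a ha) _ (hEA b hb)).trans_eq ?_
      rw [hd.dist_mul_smul hζ]; ring
    · simpa only [zero_smul, mul_zero'] using hw
  refine ⟨w, hx, hζ0, ⟨fun t => θ t • ζ, fun t _ => hEA _ (hθE t), hθd⟩, fun c hc => ?_⟩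
  -- Passing from the points `θ t • ζ` to arbitrary approximating points `c t` costs a right factor
  -- of homogeneous norm at most `L d (θ t • ζ) (c t) = o(t)`.
  have hsplit : ∀ t, H.mul (-f x) (f (V.mul x (c t))) =
      H.mul (H.mul (-f x) (f (V.mul x (θ t • ζ))))
        (H.mul (-f (V.mul x (θ t • ζ))) (f (V.mul x (c t)))) := fun t => by
    rw [mul_assoc', mul_neg_cancel_left']
  simp only [hsplit]
  refine tendsto_dil_mul hσ hbase ?_
  have h1 := (hθd.add hc.2).const_mul L
  rw [add_zero, mul_zero] at h1
  refine squeeze_zero' ?_ ?_ h1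
  · filter_upwards [hpos] with t ht
    exact mul_nonneg (by positivity) (hnorm_nonneg _)
  · filter_upwards [hpos] with t ht
    have h2 := hf _ (hEA _ (hθE t)) _ (hc.1 t ht)
    rw [hd.mul_left] at h2
    have h3 := hd.triangle (θ t • ζ) (V.dil t ζ) (c t)
    rw [hd.symm (V.dil t ζ)] at h3
    calc 1 / t * H.hdist σ (f (V.mul x (θ t • ζ))) (f (V.mul x (c t)))
        ≤ 1 / t * (L * (d (θ t • ζ) (V.dil t ζ) + d (c t) (V.dil t ζ))) := by
          gcongr; exact h2.trans (by gcongr)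
      _ = _ := by ring

theorem ae_dirDifferentiableAt_of_isCompact [MeasurableSpace G] [BorelSpace G]
    (hV : V.IsStratifiedGroup) (hd : V.IsHomogeneousDist d) {μ : Measure G} (hμ : V.IsHaar μ)
    (hσ : H.IsHomogeneousNorm σ) (hX : HasRNP (H.layer 1)) {A K : Set G} (hK : IsCompact K)
    (hKA : K ⊆ A) {ζ : G} (hζ : ζ ∈ V.layer 1) (hζ0 : ζ ≠ 0) {f : G → M} {L : ℝ} (hL : 0 ≤ L)
    (hf : ∀ x ∈ A, ∀ y ∈ A, H.hdist σ (f x) (f y) ≤ L * d x y) :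
    ∀ᵐ x ∂μ, x ∈ K → V.DenseInDirection A x ζ ∧ DirDifferentiableAt V H d A f x ζ := by
  have := hV.finiteDimensional
  have : CompleteSpace (H.layer 1) := (H.isClosed_layer 1).completeSpace_coe
  set g : G → H.layer 1 := fun x => ⟨H.proj 1 (f x), H.proj_mem 1 _⟩
  have hgf : ∀ x ∈ K, ∀ y ∈ K, dist (g x) (g y) ≤ L * d x y := fun x hx y hy => by
    rw [dist_eq_norm]
    exact (norm_proj_one_sub_le hσ (f x) (f y)).trans (hf x (hKA hx) y (hKA hy))
  -- The Lipschitz bound is in terms of `d`; topological continuity of `g` requires the continuity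
  -- of `d`, proved from the stratification.
  have hg : ContinuousOn g K := fun x hx => by
    rw [ContinuousWithinAt, tendsto_iff_dist_tendsto_zero]
    have h1 := ((hd.tendsto_dist hV x).mono_left (nhdsWithin_le_nhds (s := K))).const_mul L
    rw [mul_zero] at h1
    refine squeeze_zero' (Eventually.of_forall fun _ => dist_nonneg) ?_ h1
    filter_upwards [self_mem_nhdsWithin] with y hy
    rw [hd.symm]
    exact hgf y hy x hx
  have hline : ∀ x : G, ∀ s t : ℝ, V.mul x (s • ζ) ∈ K → V.mul x (t • ζ) ∈ K →
      dist (g (V.mul x (s • ζ))) (g (V.mul x (t • ζ))) ≤ (L * d 0 ζ).toNNReal * dist s t := by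
    intro x s t hs ht
    refine (hgf _ hs _ ht).trans_eq ?_
    rw [hd.dist_mul_smul hζ, Real.coe_toNNReal _ (mul_nonneg hL (hd.nonneg 0 ζ)), Real.dist_eq]
    ring
  filter_upwards [ae_denseInDirection hμ hζ hK, ae_exists_tendsto_dirQuot hμ hX hK hg hline]
    with x h1 h2 hx
  refine ⟨(h1 hx).mono hKA, ?_⟩
  obtain ⟨w, hw⟩ := h2 hx
  have hdens := h1 hx
  simp only [DenseInDirection, dil_of_mem_layer_one hζ] at hdens
  refine dirDifferentiableAt_of_tendsto_proj_one hd hσ hL hf hζ hζ0 (hKA hx)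
    (E := {θ : ℝ | V.mul x (θ • ζ) ∈ K}) (w := (w : M))
    (hK.isClosed.preimage
      ((continuous_line ζ).comp (continuous_const.prodMk continuous_id))) ?_
    (fun θ hθ => hKA hθ) hdens ?_
  · change V.mul x ((0 : ℝ) • ζ) ∈ K
    rwa [zero_smul, mul_zero']
  · exact ((H.layer 1).subtypeL.continuous.tendsto w).comp hw

end Differentiability

end Stratification

end BanachLieAlgebra

/-- A property that holds almost everywhere on each compact subset of a null measurable set holds
almost everywhere on that set. -/
theorem MeasureTheory.ae_mem_imp_of_forall_isCompact {G : Type*} [MetricSpace G]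
    [ProperSpace G] [MeasurableSpace G] [BorelSpace G] {μ : Measure G}
    [IsFiniteMeasureOnCompacts μ] {A : Set G} (hA : NullMeasurableSet A μ) {p : G → Prop}
    (h : ∀ K, IsCompact K → K ⊆ A → ∀ᵐ x ∂μ, x ∈ K → p x) : ∀ᵐ x ∂μ, x ∈ A → p x := by
  obtain ⟨B, hBA, hB, hae⟩ := hA.exists_measurable_subset_ae_eq
  have hBp : ∀ᵐ x ∂μ, x ∈ B → p x := by
    rcases isEmpty_or_nonempty G with hG | ⟨⟨a⟩⟩
    · exact Eventually.of_forall fun x => hG.elim x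
    have hn : ∀ n : ℕ, ∀ᵐ x ∂μ, x ∈ B ∩ Metric.closedBall a n → p x := by
      intro n
      have hBn : MeasurableSet (B ∩ Metric.closedBall a n) := hB.inter measurableSet_closedBall
      have hfin : μ (B ∩ Metric.closedBall a n) ≠ ∞ :=
        ((measure_mono inter_subset_right).trans_lt
          (isCompact_closedBall a n).measure_lt_top).ne
      rw [ae_iff]
      refine le_antisymm (ENNReal.le_of_forall_pos_le_add fun ε hε _ => ?_) zero_le
      -- Inner regularity: the exceptional points lie in a null set together with a remainder of
      -- measure less than `ε`.
      obtain ⟨K, hKB, hK, hKε⟩ := hBn.exists_isCompact_sdiff_lt hfin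
        (ENNReal.coe_ne_zero.mpr hε.ne')
      have hKp := h K hK (hKB.trans (inter_subset_left.trans hBA))
      rw [ae_iff] at hKp
      refine (measure_mono (t := {x | ¬ (x ∈ K → p x)} ∪ (B ∩ Metric.closedBall a n) \ K)
        fun x hx => ?_).trans ((measure_union_le _ _).trans ?_)
      · by_cases hxK : x ∈ K
        · exact Or.inl fun hcon => hx fun _ => hcon hxK
        · exact Or.inr ⟨by_contra fun hcon => hx fun hmem => (hcon hmem).elim, hxK⟩
      · rw [hKp]
        gcongr
    filter_upwards [ae_all_iff.mpr hn] with x hx hxB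
    obtain ⟨n, hn⟩ := exists_nat_ge (dist x a)
    exact hx n ⟨hxB, hn⟩
  filter_upwards [hBp, hae.mem_iff] with x hx hiff hxA
  exact hx (hiff.mpr hxA)

theorem mainTheorem4
    {G : Type*} [BanachLieAlgebra G] [MeasurableSpace G] [BorelSpace G]
    {M : Type*} [BanachLieAlgebra M]
    (V : BanachLieAlgebra.Stratification G) (hV : V.IsStratifiedGroup)
    (d : G → G → ℝ) (hd : V.IsHomogeneousDist d)
    (μ : Measure G) (hμ : V.IsHaar μ)
    (H : BanachLieAlgebra.Stratification M)
    (σ : ℕ → ℝ≥0) (hσ : H.IsHomogeneousNorm σ)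
    (hRNP : HasRNP (H.layer 1))
    (A : Set G) (hA : NullMeasurableSet A μ)
    (ζ : G) (hζ : ζ ∈ V.layer 1) (hζ0 : ζ ≠ 0)
    (f : G → M) (hf : ∃ L : ℝ, ∀ x ∈ A, ∀ y ∈ A, H.hdist σ (f x) (f y) ≤ L * d x y) :
    ∀ᵐ x ∂μ, x ∈ A →
      V.DenseInDirection A x ζ ∧
        BanachLieAlgebra.Stratification.DirDifferentiableAt V H d A f x ζ := by
  have := hV.finiteDimensional
  have : ProperSpace G := FiniteDimensional.proper ℝ G
  have : IsFiniteMeasureOnCompacts μ := ⟨fun K hK => hμ.lt_top_of_isCompact K hK⟩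
  obtain ⟨L, hL⟩ := hf
  refine ae_mem_imp_of_forall_isCompact hA fun K hK hKA => ?_
  -- The given constant may be negative, so `max L 0` is used instead.
  refine BanachLieAlgebra.Stratification.ae_dirDifferentiableAt_of_isCompact hV hd hμ hσ hRNP hK
    hKA hζ hζ0 (le_max_right L 0) fun x hx y hy => (hL x hx y hy).trans ?_
  exact mul_le_mul_of_nonneg_right (le_max_left L 0) (hd.nonneg x y)
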